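/- Let $k$ be a commutative ring and let $H$ be a Hopf algebra over $k$, with antipode $S$, that is projective as a $k$-module. Write $\Delta(h)=\sum h_{(1)}\otimes h_{(2)}$, let $H^*=\mathrm{Hom}_k(H,k)$ be the convolution algebra of $H$, and let $\mathcal M_H$ be the category of right $H$-modules. **Definitions (for bijective $S$).** A right-left Yetter-Drinfel'd module is a $k$-module $M$ that is a right $H$-module and a left $H$-comodule, $m\mapsto\sum m_{\langle -1\rangle}\otimes m_{\langle 0\rangle}$, such that $$\sum (mh)_{\langle -1\rangle}\otimes (mh)_{\langle 0\rangle}=\sum S^{-1}(h_{(3)})\,m_{\langle -1\rangle}\,h_{(1)}\otimes m_{\langle 0\rangle}h_{(2)}\qquad(h\in H,\ m\in M).$$ With the $H$-linear and $H$-colinear maps these form a category ${}^H\mathcal{YD}_H$; let $F:{}^H\mathcal{YD}_H\to\mathcal M_H$ be the functor forgetting the coaction. A functor $F:\mathcal C\to\mathcal D$ is separable if the natural transformation $\mathrm{Hom}_{\mathcal C}(X,Y)\to\mathrm{Hom}_{\mathcal D}(FX,FY)$, $f\mapsto F(f)$, has a left inverse that is natural in $X,Y\in\mathcal C$. A morphism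 $R\to T$ of $k$-algebras is a separable extension if the multiplication map $T\otimes_R T\to T$ has a section that is a map of $T$-bimodules. Koppinen's generalized double $\mathcal D(H)$ is the $k$-module $\mathrm{End}_k(H)$ with unit $h\mapsto\varepsilon(h)1$ and product $$(f\bullet g)(h)=\sum f(h_{(1)})_{(2)}\;g\bigl(S^{-1}(f(h_{(1)})_{(3)})\,h_{(2)}\,f(h_{(1)})_{(1)}\bigr).$$ The algebra $D(H)$ is $H\otimes H^*$ with unit $1\bowtie\varepsilon$ and product $$(h\bowtie f)(h'\bowtie f')=\sum h_{(2)}h'\bowtie f*\langle f',S^{-1}(h_{(3)})\,?\,h_{(1)}\rangle ,$$ where $\langle f',x\,?\,y\rangle$ denotes the map $l\mapsto f'(xly)$; it is an extension of $H$ via $h\mapsto h\bowtie\varepsilon$, and if $H$ is finitely generated it is the Drinfel'd double of $H$. A quantum $H$-integral is a $k$-linear map $\gamma:H\to\mathcal D(H)$ that satisfies the following two conditions. 1. It is right $H^*$-linear: $\gamma\bigl(\sum h^*(h_{(1)})h_{(2)}\bigr)=\gamma(h)\cdot h^*$ for $h\in H$, $h^*\in H^*$, where $(f\cdot h^*)(l)=\sum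 f(l_{(1)})_{(2)}\,h^*\bigl(S^{-1}(f(l_{(1)})_{(3)})\,l_{(2)}\,f(l_{(1)})_{(1)}\bigr)$. 2. It is centralized by the left and right actions of $H$: for all $g,h,l\in H$, $$\sum g_{(3)}\,\gamma\bigl(S^{-1}(g_{(5)})\,h\,g_{(1)}\bigr)\bigl(S^{-1}(g_{(4)})\,l\,g_{(2)}\bigr)=\gamma(h)(l)\,g .$$ It is total if $\sum\gamma(h_{(1)})(h_{(2)})=\varepsilon(h)1_H$ for all $h\in H$. **Statement.** (a) Suppose that $S$ is bijective. Then the forgetful functor $F:{}^H\mathcal{YD}_H\to\mathcal M_H$ is separable if and only if there exists a total quantum $H$-integral $\gamma:H\to\mathcal D(H)$. (b) Suppose that $H$ is finitely generated (and, as above, projective) as a $k$-module, with no assumption on $S$. Then $S$ is bijective, the map $D(H)\to\mathcal D(H)$, $h\bowtie f\mapsto\bigl(l\mapsto f(l)h\bigr)$, is an isomorphism of algebras, and the following are equivalent: (i) $F$ is separable; (ii) the extension $H\to D(H)$ is separable; (iii) there exists a total quantum $H$-integral $\gamma:H\to\mathcal D(H)\cong D(H)$. -/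

import Mathlib

open scoped TensorProduct
open Coalgebra

section Opposite
variable {k H : Type*} [CommRing k] [Ring H]

/-- The opposite algebra of a bialgebra, with the same coalgebra structure, is a bialgebra. -/
noncomputable instance MulOpposite.instBialgebraOp [Bialgebra k H] : Bialgebra k Hᵐᵒᵖ :=
  Bialgebra.mk' k Hᵐᵒᵖ (by simp [MulOpposite.counit_def])
    (by intros; simp [MulOpposite.counit_def, mul_comm])
    (by simp [MulOpposite.comul_def, Algebra.TensorProduct.one_def])
    (by
      intro a b
      simp only [MulOpposite.comul_def, LinearMap.comp_apply, LinearEquiv.coe_coe,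
        MulOpposite.coe_opLinearEquiv_symm, MulOpposite.unop_mul, Bialgebra.comul_mul]
      generalize (comul (R := k) a.unop) = x
      generalize (comul (R := k) b.unop) = y
      induction x with
      | zero => simp
      | add x x' hx hx' => simp only [mul_add, add_mul, map_add, hx, hx']
      | tmul p q =>
        induction y with
        | zero => simp
        | add y y' hy hy' => simp only [mul_add, add_mul, map_add, hy, hy']
        | tmul r s => simp)

/-- `∑ (h₁ ⊗ h₂) ⊗ (h₃ ⊗ h₄)` is obtained by applying `Δ` in the middle of `∑ h₁ ⊗ h₂ ⊗ h₃`. -/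
theorem four_coassoc {C : Type*} [AddCommGroup C] [Module k C] [Coalgebra k C] :
   (TensorProduct.map (comul (R := k) (A := C)) (comul (R := k) (A := C))) ∘ₗ (comul (R := k) (A := C)) =
    (TensorProduct.assoc k C C (C ⊗[k] C)).symm.toLinearMap ∘ₗ LinearMap.lTensor C ((TensorProduct.assoc k C C C).toLinearMap ∘ₗ LinearMap.rTensor C comul ∘ₗ comul) ∘ₗ comul := by
  simp only [coassoc_simps]

variable [HopfAlgebra k H]
open HopfAlgebra LinearMap WithConv

/-- `Δ (S h) = ∑ S h₂ ⊗ S h₁`. -/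
theorem comul_comp_antipode :
    (comul (R := k) (A := H)) ∘ₗ antipode k =
      TensorProduct.map (antipode k) (antipode k) ∘ₗ
        (TensorProduct.comm k H H).toLinearMap ∘ₗ comul := by
  apply WithConv.toConv_injective
  symm
  apply left_inv_eq_right_inv (a := toConv (comul (R := k) (A := H))) _ comul_right_inv
  apply WithConv.ofConv_injective
  rw [LinearMap.convMul_def, ofConv_toConv]
  have h1 : TensorProduct.map ((TensorProduct.map (antipode k) (antipode k) ∘ₗ
        (TensorProduct.comm k H H).toLinearMap ∘ₗ comul)) (comul (R := k) (A := H)) =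
      TensorProduct.map ((TensorProduct.map (antipode k) (antipode k) ∘ₗ
        (TensorProduct.comm k H H).toLinearMap)) LinearMap.id ∘ₗ TensorProduct.map (comul (R := k) (A := H)) (comul (R := k) (A := H)) := by
    rw [← TensorProduct.map_comp]; rfl
  rw [h1, LinearMap.comp_assoc, four_coassoc]
  have key (l : H) (y : H ⊗[k] H) : (mul' k (H ⊗[k] H)) (TensorProduct.map ((TensorProduct.map (antipode k) (antipode k) ∘ₗ
        (TensorProduct.comm k H H).toLinearMap)) LinearMap.id ((TensorProduct.assoc k H H (H ⊗[k] H)).symm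
         (l ⊗ₜ (TensorProduct.assoc k H H H (rTensor H comul y)))))
         = 1 ⊗ₜ (antipode k l * TensorProduct.lid k H (rTensor H counit y)) := by
    induction y with
    | zero => simp
    | add y z hy hz => simp only [map_add, TensorProduct.tmul_add, mul_add, hy, hz]
    | tmul p q =>
      rw [rTensor_tmul, ← (ℛ k p).eq]
      simp only [TensorProduct.sum_tmul, map_sum, TensorProduct.tmul_sum, TensorProduct.assoc_tmul,
        TensorProduct.assoc_symm_tmul, TensorProduct.map_tmul, LinearMap.comp_apply,
        LinearEquiv.coe_coe, TensorProduct.comm_tmul, LinearMap.id_apply, mul'_apply,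
        Algebra.TensorProduct.tmul_mul_tmul]
      rw [← TensorProduct.sum_tmul, sum_antipode_mul_eq_smul, TensorProduct.smul_tmul]
      simp
  ext h
  simp only [LinearMap.comp_apply, LinearEquiv.coe_coe]
  rw [← (ℛ k h).eq]
  simp only [map_sum, lTensor_tmul, LinearMap.comp_apply, LinearEquiv.coe_coe, key, rTensor_counit_comul, TensorProduct.lid_tmul, one_smul]
  rw [← TensorProduct.tmul_sum, sum_antipode_mul_eq_smul]
  simp [Algebra.TensorProduct.one_def, Algebra.algebraMap_eq_smul_one]
end Opposite

/-- A Doi-Hopf datum `(L, A, C)` over `k`: a bialgebra `L`, a left `L`-comodule algebra `A`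
and a right `L`-module coalgebra `C`. -/
structure DoiHopfDatum (k L A C : Type*) [CommRing k] [Ring L] [Bialgebra k L] [Ring A]
    [Algebra k A] [AddCommGroup C] [Module k C] [Coalgebra k C] where
  /-- the left coaction `a ↦ ∑ a₋₁ ⊗ a₀`, an algebra map -/
  coaction : A →ₐ[k] L ⊗[k] A
  coaction_counit : ∀ a, TensorProduct.lid k A (LinearMap.rTensor A counit (coaction a)) = a
  coaction_coassoc : ∀ a,
    TensorProduct.assoc k L L A (LinearMap.rTensor A comul (coaction a)) =
      LinearMap.lTensor L coaction.toLinearMap (coaction a)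
  /-- the right action `c ⊗ x ↦ c · x`, a coalgebra map -/
  action : C ⊗[k] L →ₗ[k] C
  action_one : ∀ c, action (c ⊗ₜ 1) = c
  action_mul : ∀ c x y, action (c ⊗ₜ (x * y)) = action (action (c ⊗ₜ x) ⊗ₜ y)
  counit_action : ∀ z, counit (R := k) (action z) = counit (R := k) z
  comul_action : ∀ z, comul (R := k) (action z) = TensorProduct.map action action (comul (R := k) z)

section antipodeInv
variable {k H : Type*} [CommRing k] [Ring H] [HopfAlgebra k H]
open HopfAlgebra

/-- The inverse `S⁻¹` of a bijective antipode. -/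
noncomputable def antipodeInv (hS : Function.Bijective (antipode k (A := H))) : H →ₗ[k] H :=
  (LinearEquiv.ofBijective (antipode k) hS).symm.toLinearMap

theorem antipode_antipodeInv (hS : Function.Bijective (antipode k (A := H))) (h : H) :
    antipode k (antipodeInv hS h) = h :=
  (LinearEquiv.ofBijective (antipode k) hS).apply_symm_apply h

/-- `S⁻¹`, as an algebra map `H → Hᵒᵖ`. -/
noncomputable def antipodeInvHom (hS : Function.Bijective (antipode k (A := H))) : H →ₐ[k] Hᵐᵒᵖ :=
  .ofLinearMap ((MulOpposite.opLinearEquiv k).toLinearMap ∘ₗ antipodeInv hS)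
    (MulOpposite.unop_injective (hS.1 (by simp [antipode_antipodeInv])))
    (fun x y => MulOpposite.unop_injective (hS.1 (by
      simp [antipode_antipodeInv, antipode_mul_antidistrib])))

theorem comul_antipodeInvHom (hS : Function.Bijective (antipode k (A := H))) :
    (comul (R := k) (A := Hᵐᵒᵖ)) ∘ₗ (antipodeInvHom hS).toLinearMap =
      TensorProduct.map (antipodeInvHom hS).toLinearMap (antipodeInvHom hS).toLinearMap ∘ₗ
        (TensorProduct.comm k H H).toLinearMap ∘ₗ comul := by
  have h0 : antipodeInv hS ∘ₗ antipode k = LinearMap.id :=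
    LinearMap.ext fun h => (LinearEquiv.ofBijective (antipode k) hS).symm_apply_apply h
  have h1 : comul ∘ₗ antipodeInv hS =
      TensorProduct.map (antipodeInv hS) (antipodeInv hS) ∘ₗ
        (TensorProduct.comm k H H).toLinearMap ∘ₗ (comul (R := k)) := by
    ext h
    obtain ⟨h, rfl⟩ := hS.2 h
    have h2 := LinearMap.congr_fun (comul_comp_antipode (k := k) (H := H)) h
    have h3 := LinearMap.congr_fun h0 h
    simp only [LinearMap.comp_apply, LinearMap.id_apply] at h2 h3 ⊢
    rw [h2, h3]
    have h5 : TensorProduct.map (antipodeInv hS) (antipodeInv hS) ∘ₗ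
        (TensorProduct.comm k H H).toLinearMap ∘ₗ
        TensorProduct.map (antipode k) (antipode k) ∘ₗ
        (TensorProduct.comm k H H).toLinearMap = LinearMap.id := by
      ext x y
      have hx := LinearMap.congr_fun h0 x
      have hy := LinearMap.congr_fun h0 y
      simp only [LinearMap.comp_apply, LinearMap.id_apply] at hx hy
      simp [hx, hy]
    exact (LinearMap.congr_fun h5 (comul h)).symm
  have h4 : (antipodeInvHom hS).toLinearMap =
    (MulOpposite.opLinearEquiv k).toLinearMap ∘ₗ antipodeInv hS := rfl
  rw [h4, MulOpposite.comul_def, TensorProduct.map_comp]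
  simp only [LinearMap.comp_assoc, ← h1]
  rfl

theorem counit_antipodeInvHom (hS : Function.Bijective (antipode k (A := H))) (h : H) :
    counit (R := k) (antipodeInvHom hS h) = counit (R := k) h := by
  obtain ⟨h, rfl⟩ := hS.2 h
  rw [counit_antipode]
  change counit (R := k) ((LinearEquiv.ofBijective (antipode k) hS).symm (LinearEquiv.ofBijective (antipode k) hS h)) = _
  rw [LinearEquiv.symm_apply_apply]

/-- The left `H ⊗ Hᵒᵖ`-coaction on `H`: `h ↦ ∑ (h₁ ⊗ S⁻¹ h₃) ⊗ h₂`. -/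
noncomputable def ydCoaction (hS : Function.Bijective (antipode k (A := H))) :
    H →ₐ[k] (H ⊗[k] Hᵐᵒᵖ) ⊗[k] H :=
  ((Algebra.TensorProduct.assoc k k k H Hᵐᵒᵖ H).symm : _ →ₐ[k] _).comp <|
  (Algebra.TensorProduct.map (.id k H) <|
    (Algebra.TensorProduct.map (antipodeInvHom hS) (.id k H)).comp <|
    (Algebra.TensorProduct.comm k H H : H ⊗[k] H →ₐ[k] H ⊗[k] H).comp <|
    Bialgebra.comulAlgHom k H).comp <|
  Bialgebra.comulAlgHom k H

/-- The right `H ⊗ Hᵒᵖ`-action on `H`: `l · (x ⊗ y) = y l x`. -/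
noncomputable def ydAction (k H : Type*) [CommRing k] [Ring H] [Algebra k H] :
    H ⊗[k] (H ⊗[k] Hᵐᵒᵖ) →ₗ[k] H :=
  LinearMap.mul' k H ∘ₗ
    TensorProduct.map (MulOpposite.opLinearEquiv k).symm.toLinearMap (LinearMap.mul' k H) ∘ₗ
    (TensorProduct.comm k (H ⊗[k] H) Hᵐᵒᵖ).toLinearMap ∘ₗ
    (TensorProduct.assoc k H H Hᵐᵒᵖ).symm.toLinearMap

@[simp] theorem ydAction_tmul (l x : H) (y : Hᵐᵒᵖ) :
    ydAction k H (l ⊗ₜ (x ⊗ₜ y)) = y.unop * (l * x) := by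
  simp [ydAction]

theorem ydCoaction_toLinearMap (hS : Function.Bijective (antipode k (A := H))) :
    (ydCoaction hS).toLinearMap = (TensorProduct.assoc k H Hᵐᵒᵖ H).symm.toLinearMap ∘ₗ
      TensorProduct.map LinearMap.id (TensorProduct.map (antipodeInvHom hS).toLinearMap LinearMap.id ∘ₗ
        (TensorProduct.comm k H H).toLinearMap ∘ₗ comul) ∘ₗ comul := rfl

theorem five_coassoc {C : Type*} [AddCommGroup C] [Module k C] [Coalgebra k C] :
    TensorProduct.map (comul (R := k) (A := C)) (LinearMap.lTensor C comul ∘ₗ comul) ∘ₗ comul =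
      (TensorProduct.assoc k C C (C ⊗[k] (C ⊗[k] C))).symm.toLinearMap ∘ₗ
        LinearMap.lTensor C (LinearMap.lTensor C (TensorProduct.assoc k C C C).toLinearMap ∘ₗ
          (TensorProduct.assoc k C (C ⊗[k] C) C).toLinearMap ∘ₗ
          LinearMap.rTensor C (LinearMap.lTensor C comul ∘ₗ comul) ∘ₗ comul) ∘ₗ comul := by
  simp only [coassoc_simps]

theorem ydCoaction_coassoc (hS : Function.Bijective (antipode k (A := H))) :
    (TensorProduct.assoc k (H ⊗[k] Hᵐᵒᵖ) (H ⊗[k] Hᵐᵒᵖ) H).toLinearMap ∘ₗ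
      LinearMap.rTensor H comul ∘ₗ (ydCoaction hS).toLinearMap =
    LinearMap.lTensor (H ⊗[k] Hᵐᵒᵖ) (ydCoaction hS).toLinearMap ∘ₗ (ydCoaction hS).toLinearMap := by
  set s : H →ₗ[k] Hᵐᵒᵖ := (antipodeInvHom hS).toLinearMap with hs
  -- `(p ⊗ q) ⊗ (m ⊗ (r ⊗ t)) ↦ (p ⊗ s t) ⊗ ((q ⊗ s r) ⊗ m)`
  let P : (H ⊗[k] H) ⊗[k] (H ⊗[k] (H ⊗[k] H)) →ₗ[k]
      (H ⊗[k] Hᵐᵒᵖ) ⊗[k] ((H ⊗[k] Hᵐᵒᵖ) ⊗[k] H) :=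
    (TensorProduct.assoc k _ _ _).toLinearMap ∘ₗ
      LinearMap.rTensor H ((TensorProduct.tensorTensorTensorComm k H H Hᵐᵒᵖ Hᵐᵒᵖ).toLinearMap ∘ₗ
        LinearMap.lTensor _ (TensorProduct.map s s ∘ₗ (TensorProduct.comm k H H).toLinearMap)) ∘ₗ
      (TensorProduct.assoc k _ _ _).symm.toLinearMap ∘ₗ
      LinearMap.lTensor _ (TensorProduct.comm k H (H ⊗[k] H)).toLinearMap
  have h1 : (TensorProduct.assoc k (H ⊗[k] Hᵐᵒᵖ) (H ⊗[k] Hᵐᵒᵖ) H).toLinearMap ∘ₗ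
      LinearMap.rTensor H comul ∘ₗ (ydCoaction hS).toLinearMap =
      P ∘ₗ TensorProduct.map (comul (R := k) (A := H)) (LinearMap.lTensor H comul ∘ₗ comul) ∘ₗ
        comul := by
    have h2 : (TensorProduct.assoc k (H ⊗[k] Hᵐᵒᵖ) (H ⊗[k] Hᵐᵒᵖ) H).toLinearMap ∘ₗ
        LinearMap.rTensor H comul ∘ₗ (TensorProduct.assoc k H Hᵐᵒᵖ H).symm.toLinearMap ∘ₗ
        LinearMap.lTensor H (TensorProduct.map s LinearMap.id ∘ₗ
          (TensorProduct.comm k H H).toLinearMap) =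
        P ∘ₗ TensorProduct.map (comul (R := k) (A := H)) (LinearMap.lTensor H comul) := by
      ext p m r
      have h3 := LinearMap.congr_fun (comul_antipodeInvHom hS) r
      simp only [LinearMap.comp_apply] at h3
      simp [P, TensorProduct.comul_def, s, -AlgHom.toLinearMap_apply] at h3 ⊢
      rw [h3]
      rfl
    have h5 := congrArg (· ∘ₗ (LinearMap.lTensor H comul ∘ₗ (comul (R := k) (A := H)))) h2
    rw [ydCoaction_toLinearMap]
    simp only [LinearMap.comp_assoc, LinearMap.lTensor,
      CoassocSimps.TensorProduct.map_comp_assoc, LinearMap.comp_id] at h5 ⊢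
    exact h5
  rw [h1, five_coassoc]
  let K : H ⊗[k] (H ⊗[k] H) →ₗ[k] (H ⊗[k] Hᵐᵒᵖ) ⊗[k] H :=
    (TensorProduct.assoc k H Hᵐᵒᵖ H).symm.toLinearMap ∘ₗ
      LinearMap.lTensor H (LinearMap.rTensor H s ∘ₗ (TensorProduct.comm k H H).toLinearMap)
  let W : H →ₗ[k] H ⊗[k] (H ⊗[k] H) := LinearMap.lTensor H comul ∘ₗ comul
  let Q : H ⊗[k] ((H ⊗[k] (H ⊗[k] H)) ⊗[k] H) →ₗ[k] (H ⊗[k] H) ⊗[k] (H ⊗[k] (H ⊗[k] H)) :=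
    (TensorProduct.assoc k H H (H ⊗[k] (H ⊗[k] H))).symm.toLinearMap ∘ₗ
        LinearMap.lTensor H (LinearMap.lTensor H (TensorProduct.assoc k H H H).toLinearMap ∘ₗ
          (TensorProduct.assoc k H (H ⊗[k] H) H).toLinearMap)
  have hK : (ydCoaction hS).toLinearMap = K ∘ₗ W := by
    rw [ydCoaction_toLinearMap]
    simp only [K, W, LinearMap.lTensor, LinearMap.rTensor, LinearMap.comp_assoc,
      CoassocSimps.TensorProduct.map_comp_assoc, LinearMap.comp_id]
    rfl
  have h6 (a d : H) (w : H ⊗[k] (H ⊗[k] H)) :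
      (a ⊗ₜ[k] s d) ⊗ₜ[k] K w = P (Q (a ⊗ₜ (w ⊗ₜ d))) := by
    induction w with
    | zero => simp
    | add y z hy hz => simp only [map_add, TensorProduct.tmul_add, TensorProduct.add_tmul, hy, hz]
    | tmul b w =>
      induction w with
      | zero => simp
      | add y z hy hz => simp only [map_add, TensorProduct.tmul_add, TensorProduct.add_tmul, hy, hz]
      | tmul m c => simp [K, P, Q, s]
  have h7 : LinearMap.lTensor (H ⊗[k] Hᵐᵒᵖ) (K ∘ₗ W) ∘ₗ K =
      P ∘ₗ Q ∘ₗ LinearMap.lTensor H (LinearMap.rTensor H W) := by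
    ext a m d
    have := h6 a d (W m)
    simpa [K] using this
  have h8 := congrArg (· ∘ₗ W) h7
  rw [hK]
  simp only [W, Q, LinearMap.comp_assoc, LinearMap.lTensor_comp] at h8 ⊢
  exact h8.symm

theorem ydCoaction_counit (hS : Function.Bijective (antipode k (A := H))) (h : H) :
    TensorProduct.lid k H (LinearMap.rTensor H counit (ydCoaction hS h)) = h := by
  have h1 : (TensorProduct.lid k H).toLinearMap ∘ₗ LinearMap.rTensor H counit ∘ₗ
      (TensorProduct.assoc k H Hᵐᵒᵖ H).symm.toLinearMap ∘ₗ
      LinearMap.lTensor H (LinearMap.rTensor H (antipodeInvHom hS).toLinearMap ∘ₗ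
        (TensorProduct.comm k H H).toLinearMap) =
      (TensorProduct.lid k H).toLinearMap ∘ₗ LinearMap.rTensor H counit ∘ₗ
        LinearMap.lTensor H ((TensorProduct.rid k H).toLinearMap ∘ₗ
          LinearMap.lTensor H counit) := by
    ext a m d
    simp [TensorProduct.counit_def, counit_antipodeInvHom, smul_smul]
  have h3 : (TensorProduct.rid k H).toLinearMap ∘ₗ LinearMap.lTensor H counit ∘ₗ comul =
      (LinearMap.id : H →ₗ[k] H) := by
    ext x
    simp
  have h2 := congrArg (· ∘ₗ (LinearMap.lTensor H comul ∘ₗ (comul (R := k) (A := H)))) h1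
  have h4 : ∀ x, ydCoaction hS x = (ydCoaction hS).toLinearMap x := fun _ => rfl
  rw [h4, ydCoaction_toLinearMap]
  simp only [LinearMap.comp_assoc, LinearMap.lTensor, LinearMap.rTensor,
    CoassocSimps.TensorProduct.map_comp_assoc, LinearMap.comp_id] at h2 h3 ⊢
  rw [h3] at h2
  refine (LinearMap.congr_fun h2 h).trans ?_
  simp [← LinearMap.rTensor_def]

/-- The Doi-Hopf datum `(H ⊗ Hᵒᵖ, H, H)` attached to a Hopf algebra with bijective antipode. -/
noncomputable def ydDatum (hS : Function.Bijective (antipode k (A := H))) :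
    DoiHopfDatum k (H ⊗[k] Hᵐᵒᵖ) H H where
  coaction := ydCoaction hS
  coaction_counit := ydCoaction_counit hS
  coaction_coassoc := fun a => LinearMap.congr_fun (ydCoaction_coassoc hS) a
  action := ydAction k H
  action_one c := by simp [Algebra.TensorProduct.one_def]
  action_mul c x y := by
    induction x with
    | zero => simp
    | add x x' hx hx' => simp only [add_mul, TensorProduct.tmul_add, TensorProduct.add_tmul, map_add, hx, hx']
    | tmul a b =>
      induction y with
      | zero => simp
      | add y y' hy hy' => simp only [mul_add, TensorProduct.tmul_add, map_add, hy, hy']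
      | tmul a' b' => simp [mul_assoc]
  counit_action z := by
    have : counit (R := k) ∘ₗ ydAction k H = counit (R := k) := by
      ext c a b
      simp [TensorProduct.counit_def, MulOpposite.counit_def]
      ring
    exact LinearMap.congr_fun this z
  comul_action z := by
    have : comul (R := k) ∘ₗ ydAction k H =
      TensorProduct.map (ydAction k H) (ydAction k H) ∘ₗ comul (R := k) := by
      ext c a b
      simp [TensorProduct.comul_def, MulOpposite.comul_def]
      generalize comul (R := k) c = x
      generalize comul (R := k) a = y
      generalize comul (R := k) b.unop = w
      induction x with
      | zero => simp
      | add x x' hx hx' => simp only [add_mul, mul_add, TensorProduct.add_tmul, map_add, hx, hx']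
      | tmul p q =>
        induction y with
        | zero => simp
        | add y y' hy hy' =>
          simp only [mul_add, TensorProduct.add_tmul, TensorProduct.tmul_add, map_add, hy, hy']
        | tmul r t =>
          induction w with
          | zero => simp
          | add w w' hw hw' => simp only [add_mul, TensorProduct.tmul_add, map_add, hw, hw']
          | tmul u v => simp
    exact LinearMap.congr_fun this z

end antipodeInv

section smash
variable {k L A C : Type*} [CommRing k] [Ring L] [Bialgebra k L] [Ring A] [Algebra k A]
  [AddCommGroup C] [Module k C] [Coalgebra k C]

namespace DoiHopfDatum

section aux
variable {k A C : Type*} [CommRing k] [Ring A] [Algebra k A] [AddCommGroup C] [Module k C]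

/-- `c ⊗ b ↦ b * g c`. -/
noncomputable def evalMul (g : C →ₗ[k] A) : C ⊗[k] A →ₗ[k] A :=
  LinearMap.mul' k A ∘ₗ TensorProduct.map LinearMap.id g ∘ₗ (TensorProduct.comm k C A).toLinearMap

/-- `c ⊗ a ↦ c ⊗ b * a`. -/
noncomputable def leftMul (C : Type*) [AddCommGroup C] [Module k C] (b : A) : C ⊗[k] A →ₗ[k] C ⊗[k] A :=
  LinearMap.lTensor C (LinearMap.mulLeft k b)

theorem evalMul_leftMul (g : C →ₗ[k] A) (b : A) (z : C ⊗[k] A) : evalMul g (leftMul C b z) = b * evalMul g z := by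
  induction z with
  | zero => simp
  | add x y hx hy => simp only [map_add, mul_add, hx, hy]
  | tmul c a => simp [evalMul, leftMul, mul_assoc]

theorem leftMul_mul (a b : A) (z : C ⊗[k] A) : leftMul C (a * b) z = leftMul C a (leftMul C b z) := by
  induction z with
  | zero => simp
  | add x y hx hy => simp only [map_add, hx, hy]
  | tmul c a => simp [leftMul]

/-- The left `A`-linear extension `c ⊗ b ↦ b · g c` of `g : C → C ⊗ A`. -/
noncomputable def bind (g : C →ₗ[k] C ⊗[k] A) : C ⊗[k] A →ₗ[k] C ⊗[k] A :=
  LinearMap.lTensor C (LinearMap.mul' k A) ∘ₗ (TensorProduct.leftComm k A C A).toLinearMap ∘ₗ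
   LinearMap.lTensor A g ∘ₗ (TensorProduct.comm k C A).toLinearMap

theorem lTensor_leftComm (b : A) (z : C ⊗[k] A) : LinearMap.lTensor C (LinearMap.mul' k A)
    (TensorProduct.leftComm k A C A (b ⊗ₜ z)) = leftMul C b z := by
  induction z with
  | zero => simp
  | add x y hx hy => simp only [map_add, TensorProduct.tmul_add, hx, hy]
  | tmul c a => simp [leftMul]

theorem bind_tmul (g : C →ₗ[k] C ⊗[k] A) (c : C) (b : A) : bind g (c ⊗ₜ b) = leftMul C b (g c) := by
  simp only [bind, LinearMap.comp_apply, LinearEquiv.coe_coe, TensorProduct.comm_tmul, LinearMap.lTensor_tmul]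
  exact lTensor_leftComm b (g c)

end aux

variable (D : DoiHopfDatum k L A C)

/-- `c ⊗ a ↦ ∑ c·a₋₁ ⊗ a₀`. -/
noncomputable def twist : C ⊗[k] A →ₗ[k] C ⊗[k] A :=
  LinearMap.rTensor A D.action ∘ₗ (TensorProduct.assoc k C L A).symm.toLinearMap ∘ₗ
    LinearMap.lTensor C D.coaction.toLinearMap

/-- `c ↦ ∑ c₂·f(c₁)₋₁ ⊗ f(c₁)₀`. -/
noncomputable def spread (f : C →ₗ[k] A) : C →ₗ[k] C ⊗[k] A :=
  D.twist ∘ₗ LinearMap.lTensor C f ∘ₗ (TensorProduct.comm k C C).toLinearMap ∘ₗ comul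

theorem twist_one (c : C) : D.twist (c ⊗ₜ 1) = c ⊗ₜ 1 := by
  simp [twist, Algebra.TensorProduct.one_def, D.action_one]

theorem twist_counit (z : C ⊗[k] A) :
    TensorProduct.lid k A (LinearMap.rTensor A counit (D.twist z)) =
      TensorProduct.lid k A (LinearMap.rTensor A counit z) := by
  induction z with
  | zero => simp
  | add x y hx hy => simp only [map_add, hx, hy]
  | tmul c a =>
    have h (w : L ⊗[k] A) : TensorProduct.lid k A (LinearMap.rTensor A counit
        (LinearMap.rTensor A D.action ((TensorProduct.assoc k C L A).symm (c ⊗ₜ w)))) =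
        counit (R := k) c • TensorProduct.lid k A (LinearMap.rTensor A counit w) := by
      induction w with
      | zero => simp
      | add x y hx hy => simp only [map_add, TensorProduct.tmul_add, smul_add, hx, hy]
      | tmul x a => simp [D.counit_action, TensorProduct.counit_def, smul_smul, mul_comm]
    simp only [twist, LinearMap.comp_apply, LinearMap.lTensor_tmul, LinearEquiv.coe_coe,
      AlgHom.toLinearMap_apply]
    rw [h, D.coaction_counit]
    simp

theorem twist_mul (c : C) (a b : A) :
    D.twist (c ⊗ₜ (a * b)) =
      bind (D.twist ∘ₗ (TensorProduct.mk k C A).flip b) (D.twist (c ⊗ₜ a)) := by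
  have h (w z : L ⊗[k] A) : LinearMap.rTensor A D.action ((TensorProduct.assoc k C L A).symm
        (c ⊗ₜ (w * z))) = bind (LinearMap.rTensor A D.action ∘ₗ
          (TensorProduct.assoc k C L A).symm.toLinearMap ∘ₗ (TensorProduct.mk k C (L ⊗[k] A)).flip z)
          (LinearMap.rTensor A D.action ((TensorProduct.assoc k C L A).symm (c ⊗ₜ w))) := by
    induction w with
    | zero => simp
    | add x y hx hy => simp only [map_add, TensorProduct.tmul_add, add_mul, hx, hy]
    | tmul x a =>
      simp only [TensorProduct.assoc_symm_tmul, LinearMap.rTensor_tmul, bind_tmul]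
      induction z with
      | zero => simp
      | add x y hx hy =>
        simp only [map_add, TensorProduct.tmul_add, mul_add, hx, hy, LinearMap.comp_add,
          LinearMap.add_apply]
      | tmul y b => simp [leftMul, D.action_mul]
  simp only [twist, LinearMap.comp_apply, LinearMap.lTensor_tmul, LinearEquiv.coe_coe,
      AlgHom.toLinearMap_apply, map_mul]
  rw [h]
  rfl

/-- `d ⊗ (e ⊗ a) ↦ ∑ d·a₋₂ ⊗ (e·a₋₁ ⊗ a₀)`. -/
noncomputable def twist2 : C ⊗[k] (C ⊗[k] A) →ₗ[k] C ⊗[k] (C ⊗[k] A) :=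
  LinearMap.lTensor C D.twist ∘ₗ (TensorProduct.leftComm k C C A).toLinearMap ∘ₗ
    LinearMap.lTensor C D.twist ∘ₗ (TensorProduct.leftComm k C C A).toLinearMap

theorem comul_twist (c : C) (a : A) :
    TensorProduct.assoc k C C A (LinearMap.rTensor A comul (D.twist (c ⊗ₜ a))) =
      D.twist2 (TensorProduct.assoc k C C A (comul c ⊗ₜ a)) := by
  let E (y : C ⊗[k] C) : L ⊗[k] (L ⊗[k] A) →ₗ[k] C ⊗[k] (C ⊗[k] A) :=
    (TensorProduct.assoc k C C A).toLinearMap ∘ₗ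
      LinearMap.rTensor A (TensorProduct.map D.action D.action ∘ₗ
        (TensorProduct.tensorTensorTensorComm k C C L L).toLinearMap ∘ₗ
        TensorProduct.mk k (C ⊗[k] C) (L ⊗[k] L) y) ∘ₗ
      (TensorProduct.assoc k L L A).symm.toLinearMap
  have h1 (w : L ⊗[k] A) : TensorProduct.assoc k C C A (LinearMap.rTensor A comul
      (LinearMap.rTensor A D.action ((TensorProduct.assoc k C L A).symm (c ⊗ₜ w)))) =
      E (comul c) (TensorProduct.assoc k L L A (LinearMap.rTensor A comul w)) := by
    induction w with
    | zero => simp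
    | add x y hx hy => simp only [map_add, TensorProduct.tmul_add, hx, hy]
    | tmul x a => 
      simp [E, D.comul_action, TensorProduct.comul_def]
      rfl
  have h2 (d e : C) (w : L ⊗[k] A) :
      E (d ⊗ₜ e) (LinearMap.lTensor L D.coaction.toLinearMap w) =
        LinearMap.lTensor C D.twist (TensorProduct.leftComm k C C A (e ⊗ₜ
          (LinearMap.rTensor A D.action ((TensorProduct.assoc k C L A).symm (d ⊗ₜ w))))) := by
    induction w with
    | zero => simp
    | add x y hx hy => simp only [map_add, TensorProduct.tmul_add, hx, hy]
    | tmul x a =>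
      simp only [LinearMap.lTensor_tmul, TensorProduct.assoc_symm_tmul, LinearMap.rTensor_tmul,
        TensorProduct.leftComm_tmul, twist, LinearMap.comp_apply, LinearEquiv.coe_coe,
        AlgHom.toLinearMap_apply]
      generalize D.coaction a = w
      induction w with
      | zero => simp
      | add x y hx hy => simp only [map_add, TensorProduct.tmul_add, hx, hy]
      | tmul y a => simp [E]
  have h3 (y : C ⊗[k] C) : E y (LinearMap.lTensor L D.coaction.toLinearMap (D.coaction a)) =
      D.twist2 (TensorProduct.assoc k C C A (y ⊗ₜ a)) := by
    induction y with
    | zero => simp [E]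
    | add x y hx hy =>
      simp only [map_add, TensorProduct.add_tmul, ← hx, ← hy]
      simp [E, LinearMap.comp_add, LinearMap.rTensor_add]
    | tmul d e => rw [h2]; rfl
  rw [← h3, ← D.coaction_coassoc, ← h1]
  rfl

theorem spread_evalMul_spread (f g : C →ₗ[k] A) :
    D.spread (evalMul g ∘ₗ D.spread f) = bind (D.spread g) ∘ₗ D.spread f := by
  let U : C ⊗[k] (C ⊗[k] A) →ₗ[k] C ⊗[k] A :=
    LinearMap.lTensor C (LinearMap.mul' k A) ∘ₗ (TensorProduct.leftComm k A C A).toLinearMap ∘ₗ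
      LinearMap.lTensor A (D.twist ∘ₗ (TensorProduct.comm k A C).toLinearMap) ∘ₗ
      (TensorProduct.leftComm k A A C).toLinearMap ∘ₗ
      TensorProduct.map g (TensorProduct.comm k C A).toLinearMap
  have hU (d e : C) (a : A) : U (d ⊗ₜ (e ⊗ₜ a)) = leftMul C a (D.twist (e ⊗ₜ g d)) := by
    simp only [U, LinearMap.comp_apply, LinearEquiv.coe_coe, TensorProduct.map_tmul,
      TensorProduct.comm_tmul, TensorProduct.leftComm_tmul, LinearMap.lTensor_tmul]
    exact lTensor_leftComm _ _
  have hU' (d : C) (z : C ⊗[k] A) : U (d ⊗ₜ z) =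
      bind (D.twist ∘ₗ (TensorProduct.mk k C A).flip (g d)) z := by
    induction z with
    | zero => simp
    | add x y hx hy => simp only [map_add, TensorProduct.tmul_add, hx, hy]
    | tmul e a => rw [hU, bind_tmul]; rfl
  have h1 (z : C ⊗[k] A) : bind (D.spread g) z =
      U (TensorProduct.assoc k C C A (LinearMap.rTensor A comul z)) := by
    induction z with
    | zero => simp
    | add x y hx hy => simp only [map_add, hx, hy]
    | tmul c a =>
      rw [bind_tmul]
      simp only [spread, LinearMap.comp_apply, LinearEquiv.coe_coe, LinearMap.rTensor_tmul]
      generalize comul (R := k) c = y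
      induction y with
      | zero => simp
      | add x y hx hy => simp only [map_add, TensorProduct.add_tmul, hx, hy]
      | tmul d e => simp [hU]
  have h2 (d e : C) (a : A) : D.twist (e ⊗ₜ evalMul g (D.twist (d ⊗ₜ a))) =
      U (D.twist2 (d ⊗ₜ (e ⊗ₜ a))) := by
    simp only [twist2, LinearMap.comp_apply, LinearEquiv.coe_coe, TensorProduct.leftComm_tmul,
      LinearMap.lTensor_tmul]
    generalize D.twist (d ⊗ₜ a) = z
    induction z with
    | zero => simp
    | add x y hx hy => simp only [map_add, TensorProduct.tmul_add, hx, hy]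
    | tmul d a =>
      simp only [TensorProduct.leftComm_tmul, LinearMap.lTensor_tmul, hU']
      rw [← twist_mul]
      rfl
  let X : C ⊗[k] (C ⊗[k] C) →ₗ[k] C ⊗[k] A := U ∘ₗ D.twist2 ∘ₗ
    (TensorProduct.assoc k C C A).toLinearMap ∘ₗ LinearMap.lTensor (C ⊗[k] C) f ∘ₗ
    (TensorProduct.comm k C (C ⊗[k] C)).toLinearMap
  have hl (z : C ⊗[k] C) : D.twist (LinearMap.lTensor C (evalMul g ∘ₗ D.spread f)
      (TensorProduct.comm k C C z)) =
        X (TensorProduct.assoc k C C C (LinearMap.rTensor C comul z)) := by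
    induction z with
    | zero => simp
    | add x y hx hy => simp only [map_add, hx, hy]
    | tmul c e =>
      simp only [TensorProduct.comm_tmul, LinearMap.lTensor_tmul, LinearMap.comp_apply, spread,
        LinearMap.rTensor_tmul, LinearEquiv.coe_coe]
      generalize comul (R := k) c = y
      induction y with
      | zero => simp
      | add x y hx hy => simp only [map_add, TensorProduct.add_tmul, TensorProduct.tmul_add, hx, hy]
      | tmul c d => simp [X, h2]
  have hr (z : C ⊗[k] C) : U (TensorProduct.assoc k C C A (LinearMap.rTensor A comul
      (D.twist (LinearMap.lTensor C f (TensorProduct.comm k C C z))))) =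
        X (LinearMap.lTensor C comul z) := by
    induction z with
    | zero => simp
    | add x y hx hy => simp only [map_add, hx, hy]
    | tmul c d => simp [X, comul_twist]
  ext c
  have h3 := h1 (D.spread f c)
  rw [LinearMap.comp_apply, h3]
  have h4 := hr (comul c)
  have h5 := hl (comul c)
  rw [coassoc_apply, ← h4] at h5
  exact h5

end DoiHopfDatum

/-- Koppinen's smash product `#(C, A)`: the `k`-module `Hom(C, A)` with the product
`(f • g)(c) = ∑ f(c₁)₀ g(c₂ · f(c₁)₋₁)` and the unit `c ↦ ε(c) 1`. -/
def Koppinen (_D : DoiHopfDatum k L A C) : Type _ := C →ₗ[k] A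

namespace Koppinen
open DoiHopfDatum
variable (D : DoiHopfDatum k L A C)

noncomputable instance : AddCommGroup (Koppinen D) := inferInstanceAs (AddCommGroup (C →ₗ[k] A))
noncomputable instance : Module k (Koppinen D) := inferInstanceAs (Module k (C →ₗ[k] A))

/-- The underlying linear map of an element of `#(C, A)`. -/
noncomputable def toHom : Koppinen D ≃ₗ[k] (C →ₗ[k] A) := LinearEquiv.refl k (C →ₗ[k] A)

noncomputable instance : Mul (Koppinen D) :=
  ⟨fun f g => (toHom D).symm (evalMul (toHom D g) ∘ₗ D.spread (toHom D f))⟩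

noncomputable instance : One (Koppinen D) :=
  ⟨(toHom D).symm (Algebra.linearMap k A ∘ₗ counit)⟩

theorem toHom_mul (f g : Koppinen D) :
  toHom D (f * g) = evalMul (toHom D g) ∘ₗ D.spread (toHom D f) := rfl

theorem toHom_one : toHom D 1 = Algebra.linearMap k A ∘ₗ counit := rfl

theorem spread_one : D.spread (Algebra.linearMap k A ∘ₗ counit) = (TensorProduct.mk k C A).flip 1 := by
  ext c
  have : LinearMap.lTensor C (Algebra.linearMap k A ∘ₗ counit) (TensorProduct.comm k C C (comul c)) = c ⊗ₜ 1 := by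
    have h : LinearMap.lTensor C (Algebra.linearMap k A ∘ₗ counit) ∘ₗ
      (TensorProduct.comm k C C).toLinearMap = (LinearMap.lTensor C (Algebra.linearMap k A)) ∘ₗ (TensorProduct.comm k k C).toLinearMap ∘ₗ LinearMap.rTensor C counit := by
      ext; simp
    have := LinearMap.congr_fun h (comul c)
    simp only [LinearMap.comp_apply, LinearEquiv.coe_coe] at this
    rw [this]
    simp
  simp only [spread, LinearMap.comp_apply, LinearEquiv.coe_coe, this, twist_one]
  rfl

theorem evalMul_one (z : C ⊗[k] A) : evalMul (Algebra.linearMap k A ∘ₗ counit) z = TensorProduct.lid k A (LinearMap.rTensor A counit z) := by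
  induction z with
  | zero => simp
  | add x y hx hy => simp only [map_add, hx, hy]
  | tmul c a => simp [evalMul, Algebra.smul_def, Algebra.commutes]

theorem evalMul_bind (g h : C →ₗ[k] A) (z : C ⊗[k] A) :
    evalMul h (bind (D.spread g) z) = evalMul (evalMul h ∘ₗ D.spread g) z := by
  induction z with
  | zero => simp
  | add x y hx hy => simp only [map_add, hx, hy]
  | tmul c a => rw [bind_tmul, evalMul_leftMul]; simp [evalMul]

noncomputable instance : Ring (Koppinen D) where
  __ := (inferInstance : AddCommGroup (Koppinen D))
  mul := (· * ·)
  one := 1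
  left_distrib f g h := (toHom D).injective (by
    simp only [toHom_mul, map_add]
    simp [evalMul, TensorProduct.map_add_right, LinearMap.comp_add, LinearMap.add_comp])
  right_distrib f g h := (toHom D).injective (by
    simp only [toHom_mul, map_add]
    simp [spread, LinearMap.lTensor_add, LinearMap.comp_add, LinearMap.add_comp])
  zero_mul f := (toHom D).injective (by
    simp only [toHom_mul, map_zero]; simp [spread])
  mul_zero f := (toHom D).injective (by
    simp only [toHom_mul, map_zero]; simp [evalMul])
  mul_assoc f g h := (toHom D).injective (by
    simp only [toHom_mul, spread_evalMul_spread]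
    ext c
    simp only [LinearMap.comp_apply, evalMul_bind])
  one_mul f := (toHom D).injective (by
    ext c
    simp [toHom_mul, toHom_one, spread_one, evalMul])
  mul_one f := (toHom D).injective (by
    ext c
    rw [toHom_mul, toHom_one, LinearMap.comp_apply, evalMul_one]
    simp only [spread, LinearMap.comp_apply, twist_counit]
    simp only [LinearEquiv.coe_coe]
    have h (z : C ⊗[k] C) : TensorProduct.lid k A (LinearMap.rTensor A counit (LinearMap.lTensor C (toHom D f) (TensorProduct.comm k C C z))) = TensorProduct.rid k A ((LinearMap.rTensor k (toHom D f)) (LinearMap.lTensor C counit z)) := by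
      induction z with
      | zero => simp
      | add x y hx hy => simp only [map_add, hx, hy]
      | tmul c a => simp
    rw [h]
    simp)

noncomputable instance : Algebra k (Koppinen D) :=
  Algebra.ofModule
    (fun r f g => (toHom D).injective (by
      simp only [toHom_mul, map_smul]
      simp [spread, LinearMap.lTensor_smul, LinearMap.comp_smul, LinearMap.smul_comp]))
    (fun r f g => (toHom D).injective (by
      simp only [toHom_mul, map_smul]
      simp [evalMul, TensorProduct.map_smul_right, LinearMap.comp_smul, LinearMap.smul_comp]))

end Koppinen
end smash

section smash2
variable {k L A C : Type*} [CommRing k] [Ring L] [Bialgebra k L] [Ring A] [Algebra k A]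
  [AddCommGroup C] [Module k C] [Coalgebra k C]

namespace DoiHopfDatum
variable (D : DoiHopfDatum k L A C)

/-- The left action of `L` on `C*`: `(x · f)(c) = f (c · x)`. -/
noncomputable def dualAction : L →ₗ[k] WithConv (C →ₗ[k] k) →ₗ[k] WithConv (C →ₗ[k] k) :=
  LinearMap.mk₂ k (fun x f => .toConv (f.ofConv ∘ₗ D.action ∘ₗ (TensorProduct.mk k C L).flip x))
    (fun x y f => by ext c; simp) (fun r x f => by ext c; simp)
    (fun x f g => by ext c; simp) (fun r x f => by ext c; simp)

@[simp] theorem dualAction_apply (x : L) (f : WithConv (C →ₗ[k] k)) (c : C) :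
    D.dualAction x f c = f (D.action (c ⊗ₜ x)) := rfl

/-- `a ⊗ f ↦ ∑ a₀ ⊗ a₋₁ · f`. -/
noncomputable def cotwist : A ⊗[k] WithConv (C →ₗ[k] k) →ₗ[k] A ⊗[k] WithConv (C →ₗ[k] k) :=
  LinearMap.lTensor A (TensorProduct.lift D.dualAction) ∘ₗ
    (TensorProduct.assoc k A L (WithConv (C →ₗ[k] k))).toLinearMap ∘ₗ
    LinearMap.rTensor _ ((TensorProduct.comm k L A).toLinearMap ∘ₗ D.coaction.toLinearMap)

section aux
variable {k A B : Type*} [CommRing k] [Ring A] [Algebra k A] [Ring B] [Algebra k B]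

/-- `a ⊗ b ↦ ∑ u a ⊗ v` where `g b = ∑ u ⊗ v`. -/
noncomputable def rext (g : B →ₗ[k] A ⊗[k] B) : A ⊗[k] B →ₗ[k] A ⊗[k] B :=
  LinearMap.rTensor B (LinearMap.mul' k A ∘ₗ (TensorProduct.comm k A A).toLinearMap) ∘ₗ
    (TensorProduct.assoc k A A B).symm.toLinearMap ∘ₗ LinearMap.lTensor A g

theorem rext_tmul (g : B →ₗ[k] A ⊗[k] B) (a : A) (b : B) :
    rext g (a ⊗ₜ b) = LinearMap.rTensor B (LinearMap.mulRight k a) (g b) := by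
  simp only [rext, LinearMap.comp_apply, LinearMap.lTensor_tmul, LinearEquiv.coe_coe]
  generalize g b = z
  induction z with
  | zero => simp
  | add x y hx hy => simp only [map_add, TensorProduct.tmul_add, hx, hy]
  | tmul c d => simp

/-- `a ⊗ b ↦ ∑ u ⊗ b v` where `g a = ∑ u ⊗ v`. -/
noncomputable def lext (g : A →ₗ[k] A ⊗[k] B) : A ⊗[k] B →ₗ[k] A ⊗[k] B :=
  LinearMap.lTensor A (LinearMap.mul' k B ∘ₗ (TensorProduct.comm k B B).toLinearMap) ∘ₗ
    (TensorProduct.assoc k A B B).toLinearMap ∘ₗ LinearMap.rTensor B g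

theorem lext_tmul (g : A →ₗ[k] A ⊗[k] B) (a : A) (b : B) :
    lext g (a ⊗ₜ b) = LinearMap.lTensor A (LinearMap.mulLeft k b) (g a) := by
  simp only [lext, LinearMap.comp_apply, LinearMap.rTensor_tmul, LinearEquiv.coe_coe]
  generalize g a = z
  induction z with
  | zero => simp
  | add x y hx hy => simp only [map_add, TensorProduct.add_tmul, hx, hy]
  | tmul c d => simp

end aux

theorem dualAction_mul (x y : L) (f : WithConv (C →ₗ[k] k)) :
    D.dualAction (x * y) f = D.dualAction x (D.dualAction y f) := by
  ext c; simp [D.action_mul]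

theorem dualAction_conv (x : L) (f g : WithConv (C →ₗ[k] k)) :
    D.dualAction x (f * g) = LinearMap.mul' k _ (TensorProduct.map (D.dualAction.flip f)
      (D.dualAction.flip g) (comul x)) := by
  ext c
  simp only [dualAction_apply, LinearMap.convMul_apply, D.comul_action, TensorProduct.comul_tmul]
  generalize comul (R := k) x = z
  induction z with
  | zero => simp
  | add x y hx hy => simp only [map_add, TensorProduct.tmul_add, hx, hy, WithConv.ofConv_add, LinearMap.add_apply]
  | tmul x y =>
    simp only [TensorProduct.map_tmul, LinearMap.flip_apply, LinearMap.mul'_apply, LinearMap.convMul_apply]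
    generalize comul (R := k) c = w
    induction w with
    | zero => simp
    | add x y hx hy => simp only [map_add, TensorProduct.add_tmul, hx, hy]
    | tmul c d => simp

theorem cotwist_mul (a b : A) (h : WithConv (C →ₗ[k] k)) :
    D.cotwist ((a * b) ⊗ₜ h) =
      rext (D.cotwist ∘ₗ TensorProduct.mk k A _ a) (D.cotwist (b ⊗ₜ h)) := by
  simp only [cotwist, LinearMap.comp_apply, LinearMap.rTensor_tmul, AlgHom.toLinearMap_apply,
    LinearEquiv.coe_coe, map_mul]
  generalize D.coaction b = w
  induction w with
  | zero => simp
  | add x y hx hy => simp only [map_add, mul_add, TensorProduct.add_tmul, hx, hy]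
  | tmul y b =>
    simp only [TensorProduct.comm_tmul, TensorProduct.assoc_tmul, LinearMap.lTensor_tmul,
      TensorProduct.lift.tmul, rext_tmul, LinearMap.comp_apply, TensorProduct.mk_apply,
      LinearMap.rTensor_tmul, AlgHom.toLinearMap_apply, LinearEquiv.coe_coe]
    generalize D.coaction a = w
    induction w with
    | zero => simp
    | add x y hx hy => simp only [map_add, add_mul, TensorProduct.add_tmul, hx, hy]
    | tmul x a => simp [dualAction_mul]

theorem cotwist_conv (a : A) (g h : WithConv (C →ₗ[k] k)) :
    D.cotwist (a ⊗ₜ (g * h)) =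
      lext (D.cotwist ∘ₗ (TensorProduct.mk k A _).flip h) (D.cotwist (a ⊗ₜ g)) := by
  let E : L ⊗[k] (L ⊗[k] A) →ₗ[k] A ⊗[k] WithConv (C →ₗ[k] k) :=
    (TensorProduct.comm k _ A).toLinearMap ∘ₗ
      LinearMap.rTensor A (LinearMap.mul' k _ ∘ₗ
        TensorProduct.map (D.dualAction.flip g) (D.dualAction.flip h)) ∘ₗ
      (TensorProduct.assoc k L L A).symm.toLinearMap
  have h1 (w : L ⊗[k] A) : LinearMap.lTensor A (TensorProduct.lift D.dualAction)
      (TensorProduct.assoc k A L (WithConv (C →ₗ[k] k))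
        (TensorProduct.comm k L A w ⊗ₜ (g * h))) =
        E (TensorProduct.assoc k L L A (LinearMap.rTensor A comul w)) := by
    induction w with
    | zero => simp
    | add x y hx hy => simp only [map_add, TensorProduct.add_tmul, hx, hy]
    | tmul x a => simp [E, dualAction_conv]
  have h2 (w : L ⊗[k] A) : lext (D.cotwist ∘ₗ (TensorProduct.mk k A _).flip h)
      (LinearMap.lTensor A (TensorProduct.lift D.dualAction)
        (TensorProduct.assoc k A L (WithConv (C →ₗ[k] k)) (TensorProduct.comm k L A w ⊗ₜ g))) =
        E (LinearMap.lTensor L D.coaction.toLinearMap w) := by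
    induction w with
    | zero => simp
    | add x y hx hy => simp only [map_add, TensorProduct.add_tmul, hx, hy]
    | tmul x a =>
      simp only [TensorProduct.comm_tmul, TensorProduct.assoc_tmul, LinearMap.lTensor_tmul,
        TensorProduct.lift.tmul, lext_tmul, LinearMap.comp_apply, LinearMap.flip_apply,
        TensorProduct.mk_apply, cotwist, LinearMap.rTensor_tmul, AlgHom.toLinearMap_apply,
        LinearEquiv.coe_coe]
      generalize D.coaction a = w
      induction w with
      | zero => simp
      | add x y hx hy => simp only [map_add, TensorProduct.tmul_add, TensorProduct.add_tmul, hx, hy]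
      | tmul x a => simp [E]
  have h3 := h1 (D.coaction a)
  have h4 := h2 (D.coaction a)
  rw [D.coaction_coassoc, ← h4] at h3
  exact h3

theorem cotwist_one_left (g : WithConv (C →ₗ[k] k)) : D.cotwist (1 ⊗ₜ g) = 1 ⊗ₜ g := by
  have : D.dualAction 1 g = g := by ext c; simp [D.action_one]
  simp [cotwist, Algebra.TensorProduct.one_def, this]

theorem cotwist_one_right (a : A) :
    D.cotwist (a ⊗ₜ (1 : WithConv (C →ₗ[k] k))) = a ⊗ₜ 1 := by
  have h1 (x : L) : D.dualAction x 1 = counit (R := k) x • (1 : WithConv (C →ₗ[k] k)) := by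
    ext c; simp [D.counit_action, TensorProduct.counit_def]
  have h2 (w : L ⊗[k] A) : LinearMap.lTensor A (TensorProduct.lift D.dualAction)
      (TensorProduct.assoc k A L (WithConv (C →ₗ[k] k)) (TensorProduct.comm k L A w ⊗ₜ 1)) =
      TensorProduct.lid k A (LinearMap.rTensor A counit w) ⊗ₜ 1 := by
    induction w with
    | zero => simp
    | add x y hx hy => simp only [map_add, TensorProduct.add_tmul, hx, hy]
    | tmul x a => simp [h1, TensorProduct.smul_tmul]
  have := h2 (D.coaction a)
  rw [D.coaction_counit] at this
  exact this

end DoiHopfDatum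

/-- The smash product `A # C*`: the `k`-module `A ⊗ C*`, where `C*` has the convolution product,
with `(a # f)(b # g) = ∑ a₀ b # f * (a₋₁ · g)` and unit `1 # ε`. -/
def SmashProduct (_D : DoiHopfDatum k L A C) : Type _ := A ⊗[k] WithConv (C →ₗ[k] k)

namespace SmashProduct
open DoiHopfDatum
variable (D : DoiHopfDatum k L A C)

noncomputable instance : AddCommGroup (SmashProduct D) :=
  inferInstanceAs (AddCommGroup (A ⊗[k] WithConv (C →ₗ[k] k)))
noncomputable instance : Module k (SmashProduct D) :=
  inferInstanceAs (Module k (A ⊗[k] WithConv (C →ₗ[k] k)))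

/-- The underlying tensor of an element of `A # C*`. -/
noncomputable def toTensor : SmashProduct D ≃ₗ[k] A ⊗[k] WithConv (C →ₗ[k] k) :=
  LinearEquiv.refl k (A ⊗[k] WithConv (C →ₗ[k] k))

/-- The product `(a ⊗ f) ⊗ (b ⊗ g) ↦ ∑ a₀ b ⊗ f * (a₋₁ · g)`. -/
noncomputable def mulMap :
    (A ⊗[k] WithConv (C →ₗ[k] k)) ⊗[k] (A ⊗[k] WithConv (C →ₗ[k] k)) →ₗ[k]
      A ⊗[k] WithConv (C →ₗ[k] k) :=
  TensorProduct.map (LinearMap.mul' k A)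
      (LinearMap.mul' k _ ∘ₗ (TensorProduct.comm k _ _).toLinearMap) ∘ₗ
    (TensorProduct.tensorTensorTensorComm k A _ A _).toLinearMap ∘ₗ
    TensorProduct.map D.cotwist (TensorProduct.comm k _ A).toLinearMap ∘ₗ
    (TensorProduct.tensorTensorTensorComm k A _ _ A).toLinearMap ∘ₗ
    LinearMap.lTensor _ (TensorProduct.comm k A _).toLinearMap

/-- `a ⊗ g ↦ a b ⊗ f g`. -/
noncomputable def sandwich (f : WithConv (C →ₗ[k] k)) (b : A) :
    A ⊗[k] WithConv (C →ₗ[k] k) →ₗ[k] A ⊗[k] WithConv (C →ₗ[k] k) :=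
  TensorProduct.map (LinearMap.mulRight k b) (LinearMap.mulLeft k f)

theorem mulMap_tmul (a b : A) (f g : WithConv (C →ₗ[k] k)) :
    mulMap D ((a ⊗ₜ f) ⊗ₜ (b ⊗ₜ g)) = sandwich f b (D.cotwist (a ⊗ₜ g)) := by
  simp only [mulMap, sandwich, LinearMap.comp_apply, LinearEquiv.coe_coe, LinearMap.lTensor_tmul,
    TensorProduct.comm_tmul, TensorProduct.tensorTensorTensorComm_tmul, TensorProduct.map_tmul]
  generalize D.cotwist (a ⊗ₜ g) = z
  induction z with
  | zero => simp
  | add x y hx hy => simp only [map_add, TensorProduct.add_tmul, hx, hy]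
  | tmul c d => simp

theorem mulMap_assoc (x y z : A ⊗[k] WithConv (C →ₗ[k] k)) :
    mulMap D (mulMap D (x ⊗ₜ y) ⊗ₜ z) = mulMap D (x ⊗ₜ mulMap D (y ⊗ₜ z)) := by
  induction x with
  | zero => simp
  | add x x' hx hx' => simp only [map_add, TensorProduct.add_tmul, hx, hx']
  | tmul a f =>
  induction y with
  | zero => simp
  | add x x' hx hx' => simp only [map_add, TensorProduct.add_tmul, TensorProduct.tmul_add, hx, hx']
  | tmul b g =>
  induction z with
  | zero => simp
  | add x x' hx hx' => simp only [map_add, TensorProduct.tmul_add, hx, hx']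
  | tmul c h =>
  rw [mulMap_tmul, mulMap_tmul]
  let N : A ⊗[k] WithConv (C →ₗ[k] k) →ₗ[k] A →ₗ[k] A ⊗[k] WithConv (C →ₗ[k] k) :=
    LinearMap.mk₂ k (fun w a' => rext (D.cotwist ∘ₗ TensorProduct.mk k A _ a') w)
      (fun w w' a' => map_add _ _ _) (fun r w a' => map_smul _ _ _)
      (fun w a' a'' => by simp [rext, LinearMap.comp_add, LinearMap.lTensor_add])
      (fun r w a' => by simp [rext, LinearMap.comp_smul, LinearMap.lTensor_smul])
  have hN (w a') : N w a' = rext (D.cotwist ∘ₗ TensorProduct.mk k A _ a') w := rfl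
  have hl (v : A ⊗[k] WithConv (C →ₗ[k] k)) :
      mulMap D (sandwich f b v ⊗ₜ (c ⊗ₜ h)) =
        sandwich f c (lext (N (D.cotwist (b ⊗ₜ h))) v) := by
    induction v with
    | zero => simp
    | add x x' hx hx' => simp only [map_add, TensorProduct.add_tmul, hx, hx']
    | tmul a' g' =>
      simp only [sandwich, TensorProduct.map_tmul, LinearMap.mulRight_apply,
        LinearMap.mulLeft_apply, mulMap_tmul, cotwist_mul, lext_tmul, hN]
      generalize rext (D.cotwist ∘ₗ TensorProduct.mk k A _ a') (D.cotwist (b ⊗ₜ h)) = w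
      induction w with
      | zero => simp
      | add x x' hx hx' => simp only [map_add, hx, hx']
      | tmul p q => simp
  rw [hl]
  generalize D.cotwist (b ⊗ₜ h) = w
  induction w with
  | zero => simp [lext]
  | add x x' hx hx' => 
    simp only [map_add, TensorProduct.tmul_add, ← hx, ← hx']
    simp [lext, LinearMap.rTensor_add, LinearMap.comp_add]
  | tmul b' h' =>
    simp only [sandwich, TensorProduct.map_tmul, LinearMap.mulRight_apply,
      LinearMap.mulLeft_apply, mulMap_tmul, cotwist_conv]
    generalize D.cotwist (a ⊗ₜ g) = v
    induction v with
    | zero => simp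
    | add x x' hx hx' => simp only [map_add, hx, hx']
    | tmul a' g' =>
      simp only [lext_tmul, hN, rext_tmul, LinearMap.comp_apply, TensorProduct.mk_apply,
        LinearMap.flip_apply]
      generalize D.cotwist (a' ⊗ₜ h') = w
      induction w with
      | zero => simp
      | add x x' hx hx' => simp only [map_add, hx, hx']
      | tmul p q => simp [mul_assoc]

theorem one_mulMap (x : A ⊗[k] WithConv (C →ₗ[k] k)) : mulMap D ((1 ⊗ₜ 1) ⊗ₜ x) = x := by
  induction x with
  | zero => simp
  | add x x' hx hx' => simp only [map_add, TensorProduct.tmul_add, hx, hx']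
  | tmul a f => simp [mulMap_tmul, cotwist_one_left, sandwich]

theorem mulMap_one (x : A ⊗[k] WithConv (C →ₗ[k] k)) : mulMap D (x ⊗ₜ (1 ⊗ₜ 1)) = x := by
  induction x with
  | zero => simp
  | add x x' hx hx' => simp only [map_add, TensorProduct.add_tmul, hx, hx']
  | tmul a f => simp [mulMap_tmul, cotwist_one_right, sandwich]

noncomputable instance : Mul (SmashProduct D) :=
  ⟨fun x y => (toTensor D).symm (mulMap D (toTensor D x ⊗ₜ toTensor D y))⟩

noncomputable instance : One (SmashProduct D) := ⟨(toTensor D).symm (1 ⊗ₜ 1)⟩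

theorem toTensor_mul (x y : SmashProduct D) :
    toTensor D (x * y) = mulMap D (toTensor D x ⊗ₜ toTensor D y) := rfl

theorem toTensor_one : toTensor D 1 = 1 ⊗ₜ 1 := rfl

noncomputable instance : Ring (SmashProduct D) where
  __ := (inferInstance : AddCommGroup (SmashProduct D))
  mul := (· * ·)
  one := 1
  left_distrib x y z := (toTensor D).injective (by
    simp only [toTensor_mul, map_add, TensorProduct.tmul_add])
  right_distrib x y z := (toTensor D).injective (by
    simp only [toTensor_mul, map_add, TensorProduct.add_tmul])
  zero_mul x := (toTensor D).injective (by simp [toTensor_mul])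
  mul_zero x := (toTensor D).injective (by simp [toTensor_mul])
  mul_assoc x y z := (toTensor D).injective (by simp only [toTensor_mul, mulMap_assoc])
  one_mul x := (toTensor D).injective (by rw [toTensor_mul, toTensor_one, one_mulMap])
  mul_one x := (toTensor D).injective (by rw [toTensor_mul, toTensor_one, mulMap_one])

noncomputable instance : Algebra k (SmashProduct D) :=
  Algebra.ofModule
    (fun r x y => (toTensor D).injective (by
      simp [toTensor_mul, ← TensorProduct.smul_tmul']))
    (fun r x y => (toTensor D).injective (by simp [toTensor_mul]))

/-- The algebra map `A → A # C*`, `a ↦ a # ε`. -/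
noncomputable def inclusion : A →ₐ[k] SmashProduct D :=
  .ofLinearMap ((toTensor D).symm.toLinearMap ∘ₗ (TensorProduct.mk k A _).flip 1) rfl
    (fun a b => (toTensor D).injective (by
      rw [toTensor_mul]
      simp [mulMap_tmul, cotwist_one_right, sandwich]))

/-- The algebra map `C* → A # C*`, `f ↦ 1 # f`. -/
noncomputable def inclusionDual : WithConv (C →ₗ[k] k) →ₐ[k] SmashProduct D :=
  .ofLinearMap ((toTensor D).symm.toLinearMap ∘ₗ TensorProduct.mk k A _ 1) rfl
    (fun f g => (toTensor D).injective (by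
      rw [toTensor_mul]
      simp [mulMap_tmul, cotwist_one_left, sandwich]))


/-- `a ⊗ f ↦ (c ↦ f c • a)`. -/
noncomputable def tensorToHom (k A C : Type*) [CommRing k] [Ring A] [Algebra k A]
    [AddCommGroup C] [Module k C] : A ⊗[k] WithConv (C →ₗ[k] k) →ₗ[k] (C →ₗ[k] A) :=
  TensorProduct.lift (LinearMap.mk₂ k (fun a f => LinearMap.toSpanSingleton k A a ∘ₗ f.ofConv)
    (fun a b f => by ext; simp) (fun r a f => by ext c; simp [smul_comm r (f.ofConv c) a])
    (fun a f g => by ext; simp [add_smul]) (fun r a f => by ext; simp [mul_smul]))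

@[simp] theorem tensorToHom_tmul {k A C : Type*} [CommRing k] [Ring A] [Algebra k A]
    [AddCommGroup C] [Module k C] (a : A) (f : WithConv (C →ₗ[k] k)) (c : C) :
    tensorToHom k A C (a ⊗ₜ f) c = f.ofConv c • a := rfl

theorem tensorToHom_mulMap (x y : A ⊗[k] WithConv (C →ₗ[k] k)) :
    tensorToHom k A C (mulMap D (x ⊗ₜ y)) =
      evalMul (tensorToHom k A C y) ∘ₗ D.spread (tensorToHom k A C x) := by
  induction x with
  | zero => simp [spread]
  | add x x' hx hx' =>
    simp only [map_add, TensorProduct.add_tmul, hx, hx']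
    simp [spread, LinearMap.lTensor_add, LinearMap.comp_add, LinearMap.add_comp]
  | tmul a f =>
  induction y with
  | zero => simp [evalMul]
  | add y y' hy hy' =>
    simp only [map_add, TensorProduct.tmul_add, hy, hy']
    simp [evalMul, TensorProduct.map_add_right, LinearMap.comp_add, LinearMap.add_comp]
  | tmul b g =>
  ext c
  rw [mulMap_tmul]
  simp only [spread, LinearMap.comp_apply, LinearEquiv.coe_coe]
  have h1 (w : L ⊗[k] A) (d : C ⊗[k] C) :
      tensorToHom k A C (sandwich f b (LinearMap.lTensor A (TensorProduct.lift D.dualAction)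
      (TensorProduct.assoc k A L (WithConv (C →ₗ[k] k)) (TensorProduct.comm k L A w ⊗ₜ g)))) c =
      evalMul (tensorToHom k A C (b ⊗ₜ g)) (LinearMap.rTensor A D.action
        ((TensorProduct.assoc k C L A).symm (LinearMap.lTensor C
          (LinearMap.toSpanSingleton k _ w ∘ₗ f.ofConv)
          (TensorProduct.comm k C C (comul c))))) := by
    induction w with
    | zero => simp
    | add x y hx hy =>
      simp only [map_add, TensorProduct.add_tmul, LinearMap.add_apply, hx, hy,
        LinearMap.toSpanSingleton_add, LinearMap.add_comp, LinearMap.lTensor_add]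
    | tmul x a =>
      simp only [TensorProduct.comm_tmul, TensorProduct.assoc_tmul, LinearMap.lTensor_tmul,
        TensorProduct.lift.tmul, sandwich, TensorProduct.map_tmul, LinearMap.mulRight_apply,
        LinearMap.mulLeft_apply, tensorToHom_tmul, LinearMap.convMul_apply]
      generalize comul (R := k) c = z
      induction z with
      | zero => simp
      | add x y hx hy => simp only [map_add, add_smul, hx, hy]
      | tmul p q => simp [evalMul, mul_smul]
  have h2 : LinearMap.lTensor C D.coaction.toLinearMap ∘ₗ
      LinearMap.lTensor C (tensorToHom k A C (a ⊗ₜ f)) =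
      LinearMap.lTensor C (LinearMap.toSpanSingleton k _ (D.coaction a) ∘ₗ f.ofConv) := by
    rw [← LinearMap.lTensor_comp]
    congr 1
    ext c
    simp
  have h3 := h1 (D.coaction a) (comul c)
  rw [← h2] at h3
  exact h3

/-- The algebra map `i : A # C* → #(C, A)`, `i (a # f) = (c ↦ f c • a)`. -/
noncomputable def toKoppinen : SmashProduct D →ₐ[k] Koppinen D :=
  .ofLinearMap ((Koppinen.toHom D).symm.toLinearMap ∘ₗ tensorToHom k A C ∘ₗ
      (toTensor D).toLinearMap)
    ((Koppinen.toHom D).injective (by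
      ext c
      simp [toTensor_one, Koppinen.toHom_one, Algebra.algebraMap_eq_smul_one]))
    (fun x y => (Koppinen.toHom D).injective (by
      simp [toTensor_mul, Koppinen.toHom_mul, tensorToHom_mulMap]))

end SmashProduct
end smash2

section modules
open CategoryTheory

universe w

/-- The `k`-linear map `M ⊗ A → M`, `m ⊗ a ↦ m · a`, of a right `A`-module `M`. -/
noncomputable def rightMul (k A M : Type*) [CommRing k] [Ring A] [Algebra k A] [AddCommGroup M]
    [Module k M] [Module Aᵐᵒᵖ M] [IsScalarTower k Aᵐᵒᵖ M] : M ⊗[k] A →ₗ[k] M :=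
  TensorProduct.lift ((Algebra.lsmul k k M).toLinearMap ∘ₗ
    (MulOpposite.opLinearEquiv k : A ≃ₗ[k] Aᵐᵒᵖ).toLinearMap).flip

variable {k L A C : Type*} [CommRing k] [Ring L] [Bialgebra k L] [Ring A] [Algebra k A]
  [AddCommGroup C] [Module k C] [Coalgebra k C]

/-- The right action of `a : A` on `C ⊗ M`, `c ⊗ m ↦ ∑ c·a₋₁ ⊗ m·a₀`. -/
noncomputable def DoiHopfDatum.tensorRightAction (D : DoiHopfDatum k L A C) (M : Type*)
    [AddCommGroup M] [Module k M] [Module Aᵐᵒᵖ M] [IsScalarTower k Aᵐᵒᵖ M] (a : A) :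
    C ⊗[k] M →ₗ[k] C ⊗[k] M :=
  LinearMap.lTensor C (rightMul k A M) ∘ₗ (TensorProduct.leftComm k M C A).toLinearMap ∘ₗ
    LinearMap.lTensor M (D.twist ∘ₗ (TensorProduct.mk k C A).flip a) ∘ₗ
    (TensorProduct.comm k C M).toLinearMap

/-- A right-left Doi-Hopf module: a right `A`-module (that is, an `Aᵐᵒᵖ`-module) and left
`C`-comodule `M`, over the same `k`-module, with `ρ(m·a) = ∑ m₋₁·a₋₁ ⊗ m₀·a₀`. -/
structure DoiHopfModule (D : DoiHopfDatum k L A C) where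
  /-- the underlying type -/
  carrier : Type w
  [addCommGroup : AddCommGroup carrier]
  [module : Module k carrier]
  [moduleOp : Module Aᵐᵒᵖ carrier]
  [isScalarTower : IsScalarTower k Aᵐᵒᵖ carrier]
  /-- the left coaction `m ↦ ∑ m₋₁ ⊗ m₀` -/
  coact : carrier →ₗ[k] C ⊗[k] carrier
  counit_coact : ∀ m, TensorProduct.lid k carrier (LinearMap.rTensor carrier counit (coact m)) = m
  coassoc_coact : ∀ m,
    TensorProduct.assoc k C C carrier (LinearMap.rTensor carrier comul (coact m)) =
      LinearMap.lTensor C coact (coact m)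
  coact_smul : ∀ (m : carrier) (a : A),
    coact (MulOpposite.op a • m) = D.tensorRightAction carrier a (coact m)

namespace DoiHopfModule
variable {D : DoiHopfDatum k L A C}

attribute [instance] addCommGroup module moduleOp isScalarTower

/-- Morphisms: `A`-linear and `C`-colinear maps. -/
@[ext]
structure Hom (M N : DoiHopfModule.{w} D) where
  /-- the underlying `A`-linear map -/
  toLinearMap : M.carrier →ₗ[Aᵐᵒᵖ] N.carrier
  colinear : ∀ m, N.coact (toLinearMap m) =
    LinearMap.lTensor C (toLinearMap.restrictScalars k) (M.coact m)

instance : Category (DoiHopfModule.{w} D) where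
  Hom := Hom
  id M := ⟨LinearMap.id, fun m => by
    have : (LinearMap.id : M.carrier →ₗ[Aᵐᵒᵖ] M.carrier).restrictScalars k = LinearMap.id := rfl
    simp [this]⟩
  comp f g := ⟨g.toLinearMap ∘ₗ f.toLinearMap, fun m => by
    have : (g.toLinearMap ∘ₗ f.toLinearMap).restrictScalars k =
      g.toLinearMap.restrictScalars k ∘ₗ f.toLinearMap.restrictScalars k := rfl
    rw [this, LinearMap.lTensor_comp, LinearMap.comp_apply, LinearMap.comp_apply, g.colinear,
      f.colinear]⟩

variable (D) in
/-- The functor to right `A`-modules that forgets the `C`-coaction. -/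
def forget : DoiHopfModule.{w} D ⥤ ModuleCat.{w} Aᵐᵒᵖ where
  obj M := ModuleCat.of Aᵐᵒᵖ M.carrier
  map f := ModuleCat.ofHom f.toLinearMap

end DoiHopfModule

universe v₁ v₂ u₁ u₂
/-- A functor `F` is separable if the natural transformation
`Hom(X, Y) → Hom(F X, F Y)`, `f ↦ F f`, of functors `𝒞ᵒᵖ × 𝒞 ⥤ Sets` has a natural left inverse. -/
def IsSeparableFunctor {𝒞 : Type u₁} [Category.{v₁} 𝒞] {𝒟 : Type u₂} [Category.{v₂} 𝒟]
    (F : 𝒞 ⥤ 𝒟) : Prop :=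
  ∃ P : ∀ X Y : 𝒞, (F.obj X ⟶ F.obj Y) → (X ⟶ Y),
    (∀ {X' X Y Y' : 𝒞} (a : X' ⟶ X) (g : F.obj X ⟶ F.obj Y) (b : Y ⟶ Y'),
      P X' Y' (F.map a ≫ g ≫ F.map b) = a ≫ P X Y g ≫ b) ∧
    ∀ {X Y : 𝒞} (f : X ⟶ Y), P X Y (F.map f) = f

end modules

section extension
variable {k R S : Type*} [CommRing k] [Ring R] [Algebra k R] [Ring S] [Algebra k S]

/-- The `k`-submodule of `S ⊗ S` spanned by all `s φ(r) ⊗ t - s ⊗ φ(r) t`. -/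
def balancedRel (φ : R →ₐ[k] S) : Submodule k (S ⊗[k] S) :=
  Submodule.span k {z | ∃ (s : S) (r : R) (t : S), z = (s * φ r) ⊗ₜ[k] t - s ⊗ₜ[k] (φ r * t)}

/-- The tensor product `S ⊗_R S` of `S` with itself over the (noncommutative) `k`-algebra `R`. -/
abbrev BalancedTensor (φ : R →ₐ[k] S) : Type _ := (S ⊗[k] S) ⧸ balancedRel φ

namespace BalancedTensor
variable (φ : R →ₐ[k] S)

/-- `x ⊗ y ↦ s x ⊗ y`. -/
def leftAct (s : S) : BalancedTensor φ →ₗ[k] BalancedTensor φ :=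
  Submodule.mapQ _ _ (LinearMap.rTensor S (LinearMap.mulLeft k s)) <| by
    rw [balancedRel, Submodule.span_le]
    rintro _ ⟨x, r, y, rfl⟩
    exact Submodule.subset_span ⟨s * x, r, y, by simp [mul_assoc]⟩

/-- `x ⊗ y ↦ x ⊗ y s`. -/
def rightAct (s : S) : BalancedTensor φ →ₗ[k] BalancedTensor φ :=
  Submodule.mapQ _ _ (LinearMap.lTensor S (LinearMap.mulRight k s)) <| by
    rw [balancedRel, Submodule.span_le]
    rintro _ ⟨x, r, y, rfl⟩
    exact Submodule.subset_span ⟨x, r, y * s, by simp [mul_assoc]⟩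

/-- The multiplication map `S ⊗_R S → S`. -/
def mult : BalancedTensor φ →ₗ[k] S :=
  Submodule.liftQ _ (LinearMap.mul' k S) <| by
    rw [balancedRel, Submodule.span_le]
    rintro _ ⟨x, r, y, rfl⟩
    simp [mul_assoc]

end BalancedTensor

/-- The ring extension `φ : R → S` is separable: the multiplication map `S ⊗_R S → S` has a
section `σ` that is a map of `S`-bimodules. -/
def IsSeparableExtension (φ : R →ₐ[k] S) : Prop :=
  ∃ σ : S →ₗ[k] BalancedTensor φ,
    (∀ s t x, σ (s * x * t) = BalancedTensor.leftAct φ s (BalancedTensor.rightAct φ t (σ x))) ∧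
    ∀ x, BalancedTensor.mult φ (σ x) = x

end extension

section yd
open HopfAlgebra CategoryTheory

universe w

variable {k H : Type*} [CommRing k] [Ring H] [HopfAlgebra k H]

/-- Koppinen's generalized double `𝒟(H) = #(H, H)`: the `k`-module `End(H)` with the product
`(f • g)(h) = ∑ f(h₁)₂ g(S⁻¹(f(h₁)₃) h₂ f(h₁)₁)`. -/
abbrev GeneralizedDouble (hS : Function.Bijective (antipode k (A := H))) : Type _ :=
  Koppinen (ydDatum hS)

/-- The algebra underlying the Drinfel'd double `D(H) = H # H*`: the `k`-module `H ⊗ H*` with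
the product `(h ⋈ f)(h' ⋈ f') = ∑ h₂ h' ⋈ f * ⟨f', S⁻¹(h₃) ? h₁⟩`. -/
abbrev DrinfeldDouble (hS : Function.Bijective (antipode k (A := H))) : Type _ :=
  SmashProduct (ydDatum hS)

/-- The extension `H → D(H)`, `h ↦ h ⋈ ε`. -/
noncomputable abbrev toDrinfeldDouble (hS : Function.Bijective (antipode k (A := H))) :
    H →ₐ[k] DrinfeldDouble hS :=
  SmashProduct.inclusion (ydDatum hS)

/-- The canonical algebra map `D(H) → 𝒟(H)`, `h ⋈ f ↦ (l ↦ f(l) h)`. -/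
noncomputable abbrev drinfeldToGeneralized (hS : Function.Bijective (antipode k (A := H))) :
    DrinfeldDouble hS →ₐ[k] GeneralizedDouble hS :=
  SmashProduct.toKoppinen (ydDatum hS)

/-- Right-left Yetter-Drinfel'd modules: right `H`-modules and left `H`-comodules `M` with
`ρ(m·h) = ∑ S⁻¹(h₃) m₋₁ h₁ ⊗ m₀·h₂`, viewed as Doi-Hopf modules over `(H ⊗ Hᵒᵖ, H, H)`. -/
abbrev YetterDrinfeldModule (hS : Function.Bijective (antipode k (A := H))) : Type _ :=
  DoiHopfModule.{w} (ydDatum hS)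

/-- The functor from Yetter-Drinfel'd modules to right `H`-modules that forgets the coaction. -/
noncomputable abbrev YetterDrinfeldModule.forget (hS : Function.Bijective (antipode k (A := H))) :
    YetterDrinfeldModule.{w} hS ⥤ ModuleCat.{w} Hᵐᵒᵖ :=
  DoiHopfModule.forget (ydDatum hS)

/-- A quantum `H`-integral: a right `H*`-linear map `γ : H → 𝒟(H)` that is centralized by the
left and right actions of `H` on `Hom(H, 𝒟(H))`. Here `𝒟(H)` is an `(H, H # H*)`-bimodule by
restriction of scalars along the canonical map `i : H # H* → 𝒟(H)`. -/
structure IsQuantumIntegral (hS : Function.Bijective (antipode k (A := H)))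
    (γ : H →ₗ[k] GeneralizedDouble hS) : Prop where
  /-- `γ(h ↼ f) = γ(h) · f`, where `h ↼ f = ∑ f(h₁) h₂` -/
  dual_linear : ∀ (h : H) (f : WithConv (H →ₗ[k] k)),
    γ (TensorProduct.lid k H (LinearMap.rTensor H f.ofConv (comul h))) =
      γ h * drinfeldToGeneralized hS (SmashProduct.inclusionDual (ydDatum hS) f)
  /-- `∑ g₀ · γ(h · g₋₁) = γ(h) · g`, where `∑ h · g₋₁ ⊗ g₀ = ∑ S⁻¹(g₃) h g₁ ⊗ g₂` -/
  central : ∀ g h : H,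
    TensorProduct.lift
      (LinearMap.mk₂ k (fun l b => drinfeldToGeneralized hS (toDrinfeldDouble hS b) * γ l)
        (fun l l' b => by simp [mul_add]) (fun r l b => by simp)
        (fun l b b' => by simp [add_mul]) (fun r l b => by simp))
      ((ydDatum hS).twist (h ⊗ₜ g)) =
      γ h * drinfeldToGeneralized hS (toDrinfeldDouble hS g)

/-- A quantum `H`-integral is total if `∑ γ(h₁)(h₂) = ε(h) 1`. -/
structure IsTotalQuantumIntegral (hS : Function.Bijective (antipode k (A := H)))
    (γ : H →ₗ[k] GeneralizedDouble hS) : Prop extends IsQuantumIntegral hS γ where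
  total : ∀ h : H,
    TensorProduct.lift ((Koppinen.toHom (ydDatum hS)).toLinearMap ∘ₗ γ) (comul h) =
      algebraMap k H (counit h)

end yd

universe u v

/-! Everything is proved for an arbitrary Doi-Hopf datum `(L, A, C)` and then specialized to `(H ⊗
Hᵒᵖ, H, H)`. Write `θ c d` for `γ(c)(d)`.

Separability of the functor. The functor `F` forgetting the coaction has the right adjoint `N ↦ C ⊗
N`, with unit the coaction `M → C ⊗ M` and counit `ε ⊗ N`. By Rafael's criterion `F` is separable
exactly when the coactions have a natural retraction `ν` (`isSeparableFunctor_forget_iff_nonempty`).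
Naturality makes `ν` computable: `A` is free on `1`, and each coaction `M → C ⊗ M` is itself a
morphism, so `ν_M(c ⊗ m) = ∑ m₀ · θ c m₋₁` with `θ c d = (ε ⊗ A)(ν(c ⊗ (d ⊗ 1)))`. Colinearity,
`A`-linearity and the retraction property of `ν` become the fields `colinear`, `central` and `total`
of `DoiHopfDatum.IsTotalIntegral`; conversely the formula turns any such `θ` into a retraction.
Since functionals separate the elements of `C ⊗ A` when `C` is projective, colinearity of `θ` is the
same as `C*`-linearity of `γ` (`Koppinen.isTotalIntegral_iff`). This gives (a).

Separability of the extension. Put `S = A # C*`. As a right `A`-module `S` is `C* ⊗ A`, because `(1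
# f)(a # ε) = a # f`; hence `S ⊗_A S ≅ C* ⊗ S`. If `C` is finitely generated projective, this is
`Hom(C, S)`, and `S` is the Koppinen smash product. A separability element therefore becomes a map
`γ`: commuting with `C*` is dual linearity, commuting with `A` is centrality, and having product `1`
is totality (`isSeparabilityElement_toBalanced_iff`).

Bijectivity of the antipode. For `H` finitely generated projective, `H*` is a right Hopf module, so
it is generated over `H` by the integrals `p`. If `S(h) = 0`, then `p(x) h = 0` for all integrals
`p` and all `x`; writing `ε` through integrals and evaluating at `1` gives `h = 0`. Over a field
injectivity implies surjectivity by dimension, and the general case reduces to residue fields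
(`antipode_bijective`). -/

section pairing

/-! ### Functionals on `C` and evaluation maps on `C ⊗ A`. -/

variable {k A C : Type*} [CommRing k] [Ring A] [Algebra k A] [AddCommGroup C] [Module k C]

/-- A projective `C` is a direct summand of a free module. The inclusion stays injective after
tensoring with `A`, and its coordinates are functionals on `C`, so they already detect equality.
This is the only use of projectivity in part (a). -/
theorem TensorProduct.ext_of_dual_left [Module.Projective k C] {z w : C ⊗[k] A}
    (h : ∀ f : C →ₗ[k] k, TensorProduct.lid k A (LinearMap.rTensor A f z) =
      TensorProduct.lid k A (LinearMap.rTensor A f w)) : z = w := by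
  obtain ⟨s, hs⟩ := Module.projective_def'.mp ‹Module.Projective k C›
  have hinj : Function.Injective (LinearMap.rTensor A s) := by
    refine Function.LeftInverse.injective (g := LinearMap.rTensor A (Finsupp.linearCombination k id)) ?_
    intro x
    rw [← LinearMap.comp_apply, ← LinearMap.rTensor_comp, hs, LinearMap.rTensor_id,
      LinearMap.id_apply]
  apply hinj
  classical
  apply (TensorProduct.finsuppScalarLeft k A C).injective
  ext i
  -- The `i`-th coordinate in `C →₀ A` is the slice by the functional `lapply i ∘ s`.
  have hi (y : C ⊗[k] A) : TensorProduct.finsuppScalarLeft k A C (LinearMap.rTensor A s y) i =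
      TensorProduct.lid k A (LinearMap.rTensor A (Finsupp.lapply i ∘ₗ s) y) := by
    induction y with
    | zero => simp
    | add x y hx hy => simp only [map_add, Finsupp.add_apply, hx, hy]
    | tmul c a => simp [TensorProduct.finsuppScalarLeft_apply_tmul_apply]
  rw [hi, hi, h]

namespace DoiHopfDatum

/-- `c ⊗ (d ⊗ a) ↦ a * θ c d`. -/
noncomputable def evalMul₂ (θ : C →ₗ[k] C →ₗ[k] A) : C ⊗[k] (C ⊗[k] A) →ₗ[k] A :=
  TensorProduct.lift (LinearMap.mk₂ k (fun c z => evalMul (θ c) z)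
    (fun c c' z => by simp [evalMul, TensorProduct.map_add_right]) (fun r c z => by simp [evalMul, TensorProduct.map_smul_right])
    (fun c z z' => by simp) (fun r c z => by simp))

@[simp] theorem evalMul_tmul (g : C →ₗ[k] A) (c : C) (a : A) : evalMul g (c ⊗ₜ a) = a * g c := by
  simp [evalMul]

@[simp] theorem evalMul₂_tmul (θ : C →ₗ[k] C →ₗ[k] A) (c : C) (z : C ⊗[k] A) :
    evalMul₂ θ (c ⊗ₜ z) = evalMul (θ c) z := rfl

end DoiHopfDatum

namespace Koppinen

/-- The left side `∑ a₀ · γ(c·a₋₁)` of the centrality condition. -/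
noncomputable def smulLift {B : Type*} [Ring B] [Algebra k B] (i : A →ₐ[k] B) (γ : C →ₗ[k] B) :
    C ⊗[k] A →ₗ[k] B :=
  TensorProduct.lift
    (LinearMap.mk₂ k (fun l b => i b * γ l)
        (fun l l' b => by simp [mul_add]) (fun r l b => by simp)
        (fun l b b' => by simp [add_mul]) (fun r l b => by simp))

@[simp] theorem smulLift_tmul {B : Type*} [Ring B] [Algebra k B] (i : A →ₐ[k] B) (γ : C →ₗ[k] B)
    (c : C) (a : A) : smulLift i γ (c ⊗ₜ a) = i a * γ c := rfl

end Koppinen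
end pairing

/-! ### Total integrals: the two-variable form `θ` and the form with values in `#(C, A)`. -/

section integral

variable {k L A C : Type*} [CommRing k] [Ring L] [Bialgebra k L] [Ring A] [Algebra k A]
  [AddCommGroup C] [Module k C] [Coalgebra k C]

namespace DoiHopfDatum

/-- A total integral of a Doi-Hopf datum, as a family `θ c d = γ(c)(d)`: it is `C`-colinear,
`∑ c₁ ⊗ θ c₂ d = ∑ d₂·(θ c d₁)₋₁ ⊗ (θ c d₁)₀`, centralized by `A`,
`∑ a₀ θ (c·a₋₂) (d·a₋₁) = θ c d a`, and normalized by `∑ θ c₁ c₂ = ε(c) 1`. -/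
structure IsTotalIntegral (D : DoiHopfDatum k L A C) (θ : C →ₗ[k] C →ₗ[k] A) : Prop where
  colinear : ∀ c d, LinearMap.lTensor C (θ.flip d) (comul c) = D.spread (θ c) d
  central : ∀ c d a, evalMul₂ θ (D.twist2 (c ⊗ₜ (d ⊗ₜ a))) = θ c d * a
  total : ∀ c, TensorProduct.lift θ (comul c) = algebraMap k A (counit c)

end DoiHopfDatum

namespace Koppinen
open DoiHopfDatum SmashProduct
variable (D : DoiHopfDatum k L A C)

theorem toHom_inclusion (a : A) (c : C) :
    toHom D (toKoppinen D (inclusion D a)) c = counit (R := k) c • a := rfl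

theorem toHom_inclusionDual (f : WithConv (C →ₗ[k] k)) (c : C) :
    toHom D (toKoppinen D (inclusionDual D f)) c = f.ofConv c • 1 := rfl

/-- The function `i(a)` is `c ↦ ε(c) a`, so counitality collapses the comultiplication in `spread`
and only `∑ a₀ g(c·a₋₁)` is left. In the centrality condition this supplies the second of the two
twists that make up `twist2`. -/
theorem toHom_inclusion_mul (a : A) (g : Koppinen D) (c : C) :
    toHom D (toKoppinen D (inclusion D a) * g) c = evalMul (toHom D g) (D.twist (c ⊗ₜ a)) := by
  rw [toHom_mul, LinearMap.comp_apply, spread]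
  simp only [LinearMap.comp_apply]
  congr 2
  have h : LinearMap.lTensor C (toHom D (toKoppinen D (inclusion D a))) ∘ₗ
      (TensorProduct.comm k C C).toLinearMap =
      LinearMap.lTensor C (LinearMap.toSpanSingleton k A a) ∘ₗ
        (TensorProduct.comm k k C).toLinearMap ∘ₗ LinearMap.rTensor C counit := by
    ext c d
    simp [toHom_inclusion]
  have h' := LinearMap.congr_fun h (comul c)
  simp only [LinearMap.comp_apply] at h'
  rw [h', rTensor_counit_comul]
  simp

theorem toHom_inclusionDual_mul (f : WithConv (C →ₗ[k] k)) (g : Koppinen D) (c : C) :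
    toHom D (toKoppinen D (inclusionDual D f) * g) c =
      TensorProduct.lid k A (TensorProduct.map f.ofConv (toHom D g) (comul c)) := by
  rw [toHom_mul, LinearMap.comp_apply, spread]
  simp only [LinearMap.comp_apply]
  generalize comul (R := k) c = z
  induction z with
  | zero => simp
  | add x y hx hy => simp only [map_add, hx, hy]
  | tmul c d => simp [toHom_inclusionDual, twist_one]

/-- The same computation as for `g • 1`, with `a` carried along on the right; the unit law of `#(C,
A)` finishes it. -/
theorem toHom_mul_inclusion (g : Koppinen D) (a : A) (c : C) :
    toHom D (g * toKoppinen D (inclusion D a)) c = toHom D g c * a := by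
  have h (z : C ⊗[k] A) : evalMul (toHom D (toKoppinen D (inclusion D a))) z =
      TensorProduct.lid k A (LinearMap.rTensor A counit z) * a := by
    induction z with
    | zero => simp
    | add x y hx hy => simp only [map_add, add_mul, hx, hy]
    | tmul c d => simp [toHom_inclusion]
  rw [toHom_mul, LinearMap.comp_apply, h, ← Koppinen.evalMul_one]
  congr 1
  exact LinearMap.congr_fun (congrArg (toHom D) (mul_one g)) c

/-- Right multiplication by `f` slices the `C`-leg of `spread`. This is why dual linearity of `γ` is
the colinearity identity paired with all functionals. -/
theorem toHom_mul_inclusionDual (g : Koppinen D) (f : WithConv (C →ₗ[k] k)) (c : C) :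
    toHom D (g * toKoppinen D (inclusionDual D f)) c =
      TensorProduct.lid k A (LinearMap.rTensor A f.ofConv (D.spread (toHom D g) c)) := by
  rw [toHom_mul, LinearMap.comp_apply]
  generalize D.spread (toHom D g) c = z
  induction z with
  | zero => simp
  | add x y hx hy => simp only [map_add, hx, hy]
  | tmul c d => simp [toHom_inclusionDual]

/-- A total integral with values in `#(C, A)`. -/
structure IsTotalIntegral (γ : C →ₗ[k] Koppinen D) : Prop where
  dual_linear : ∀ (c : C) (f : WithConv (C →ₗ[k] k)),
    γ (TensorProduct.lid k C (LinearMap.rTensor C f.ofConv (comul c))) =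
      γ c * toKoppinen D (inclusionDual D f)
  central : ∀ (a : A) (c : C), smulLift ((toKoppinen D).comp (inclusion D)) γ (D.twist (c ⊗ₜ a)) =
    γ c * toKoppinen D (inclusion D a)
  total : ∀ c, TensorProduct.lift ((toHom D).toLinearMap ∘ₗ γ) (comul c) =
    algebraMap k A (counit c)

/-- Evaluating an identity in `#(C, A)` at `d` translates each condition on `γ` into one on `θ`.
Centrality and totality match directly; dual linearity gives the colinearity identity only after
slicing by functionals, and projectivity of `C` removes the slice. -/
theorem isTotalIntegral_iff [Module.Projective k C] (γ : C →ₗ[k] Koppinen D) :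
    IsTotalIntegral D γ ↔ D.IsTotalIntegral ((toHom D).toLinearMap ∘ₗ γ) := by
  set θ : C →ₗ[k] C →ₗ[k] A := (toHom D).toLinearMap ∘ₗ γ with hθ
  have hcol (c d : C) (f : WithConv (C →ₗ[k] k)) :
      toHom D (γ (TensorProduct.lid k C (LinearMap.rTensor C f.ofConv (comul c)))) d =
      TensorProduct.lid k A (LinearMap.rTensor A f.ofConv
        (LinearMap.lTensor C (θ.flip d) (comul c))) := by
    generalize comul (R := k) c = z
    induction z with
    | zero => simp
    | add x y hx hy => simp only [map_add, LinearMap.add_apply, hx, hy]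
    | tmul c d => simp [hθ]
  have hcen (c d : C) (a : A) : toHom D (smulLift ((toKoppinen D).comp (inclusion D)) γ
      (D.twist (c ⊗ₜ a))) d = evalMul₂ θ (D.twist2 (c ⊗ₜ (d ⊗ₜ a))) := by
    simp only [twist2, LinearMap.comp_apply, LinearEquiv.coe_coe, TensorProduct.leftComm_tmul,
      LinearMap.lTensor_tmul]
    generalize D.twist (c ⊗ₜ a) = z
    induction z with
    | zero => simp
    | add x y hx hy =>
      simp only [map_add, LinearMap.add_apply, TensorProduct.tmul_add, hx, hy]
    | tmul c a => simp [toHom_inclusion_mul, hθ]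
  constructor
  · intro h
    refine ⟨fun c d => TensorProduct.ext_of_dual_left fun f => ?_, fun c d a => ?_, h.total⟩
    · have h1 := hcol c d (.toConv f)
      rw [WithConv.ofConv_toConv] at h1
      rw [← h1, ← WithConv.ofConv_toConv f, h.dual_linear, toHom_mul_inclusionDual]
      rfl
    · rw [← hcen, h.central, toHom_mul_inclusion]
      rfl
  · intro h
    refine ⟨fun c f => (toHom D).injective (LinearMap.ext fun d => ?_),
      fun a c => (toHom D).injective (LinearMap.ext fun d => ?_), h.total⟩
    · rw [hcol, h.colinear, toHom_mul_inclusionDual]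
      rfl
    · rw [hcen, h.central, toHom_mul_inclusion]
      rfl

end Koppinen
end integral

/-- The quantum integral conditions are, by definition, the general ones for the datum `(H ⊗ Hᵒᵖ, H,
H)`; only the grouping of the fields differs. -/
theorem isTotalQuantumIntegral_iff {k H : Type*} [CommRing k] [Ring H] [HopfAlgebra k H]
    (hS : Function.Bijective (HopfAlgebra.antipode k (A := H)))
    (γ : H →ₗ[k] GeneralizedDouble hS) :
    IsTotalQuantumIntegral hS γ ↔ Koppinen.IsTotalIntegral (ydDatum hS) γ :=
  ⟨fun h => ⟨h.dual_linear, h.central, h.total⟩, fun h => ⟨⟨h.dual_linear, h.central⟩, h.total⟩⟩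

/-! ### The cofree Doi-Hopf modules `C ⊗ N`, which give the right adjoint of the forgetful functor.
-/

section cofree
open CategoryTheory

universe w

section action

variable {k A C M M' : Type*} [CommRing k] [Ring A] [Algebra k A] [AddCommGroup C] [Module k C]
  [AddCommGroup M] [Module k M] [Module Aᵐᵒᵖ M] [IsScalarTower k Aᵐᵒᵖ M]
  [AddCommGroup M'] [Module k M'] [Module Aᵐᵒᵖ M'] [IsScalarTower k Aᵐᵒᵖ M']

/-- The map `A → M`, `a ↦ m · a`. -/
noncomputable def rightOrbit (k A : Type*) {M : Type*} [CommRing k] [Ring A] [Algebra k A]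
    [AddCommGroup M] [Module k M] [Module Aᵐᵒᵖ M] [IsScalarTower k Aᵐᵒᵖ M] (m : M) : A →ₗ[k] M :=
  rightMul k A M ∘ₗ TensorProduct.mk k M A m

@[simp] theorem rightMul_tmul (m : M) (a : A) :
    rightMul k A M (m ⊗ₜ a) = MulOpposite.op a • m := rfl

@[simp] theorem rightOrbit_apply (m : M) (a : A) :
    rightOrbit k A m a = MulOpposite.op a • m := rfl

theorem map_comp_rightOrbit (f : M →ₗ[Aᵐᵒᵖ] M') (m : M) :
    f.restrictScalars k ∘ₗ rightOrbit k A m = rightOrbit k A (f m) := by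
  ext a
  simp

/-- `c ⊗ m ↦ m · g c`. -/
noncomputable def evalAct (M : Type*) [AddCommGroup M] [Module k M] [Module Aᵐᵒᵖ M]
    [IsScalarTower k Aᵐᵒᵖ M] (g : C →ₗ[k] A) : C ⊗[k] M →ₗ[k] M :=
  rightMul k A M ∘ₗ (TensorProduct.comm k A M).toLinearMap ∘ₗ LinearMap.rTensor M g

@[simp] theorem evalAct_tmul (g : C →ₗ[k] A) (c : C) (m : M) :
    evalAct M g (c ⊗ₜ m) = MulOpposite.op (g c) • m := rfl

theorem evalAct_map (f : M →ₗ[Aᵐᵒᵖ] M') (g : C →ₗ[k] A) (z : C ⊗[k] M) :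
    evalAct M' g (LinearMap.lTensor C (f.restrictScalars k) z) = f (evalAct M g z) := by
  induction z with
  | zero => simp
  | add x y hx hy => simp only [map_add, hx, hy]
  | tmul c m => simp

theorem evalAct_self (g : C →ₗ[k] A) (z : C ⊗[k] A) :
    evalAct A g z = DoiHopfDatum.evalMul g z := by
  induction z with
  | zero => simp
  | add x y hx hy => simp only [map_add, hx, hy]
  | tmul c m => simp

theorem evalAct_rightOrbit (g : C →ₗ[k] A) (m : M) (z : C ⊗[k] A) :
    evalAct M g (LinearMap.lTensor C (rightOrbit k A m) z) =
      rightOrbit k A m (DoiHopfDatum.evalMul g z) := by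
  induction z with
  | zero => simp
  | add x y hx hy => simp only [map_add, hx, hy]
  | tmul c a => simp [mul_smul]

/-- `c ⊗ z ↦ evalAct (θ c) z`. -/
noncomputable def evalAct₂ (M : Type*) [AddCommGroup M] [Module k M] [Module Aᵐᵒᵖ M]
    [IsScalarTower k Aᵐᵒᵖ M] (θ : C →ₗ[k] C →ₗ[k] A) : C ⊗[k] (C ⊗[k] M) →ₗ[k] M :=
  TensorProduct.lift (LinearMap.mk₂ k (fun c z => evalAct M (θ c) z)
    (fun c c' z => by simp [evalAct, LinearMap.rTensor_add])
    (fun r c z => by simp [evalAct, LinearMap.rTensor_smul])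
    (fun c z z' => by simp) (fun r c z => by simp))

@[simp] theorem evalAct₂_tmul (θ : C →ₗ[k] C →ₗ[k] A) (c : C) (z : C ⊗[k] M) :
    evalAct₂ M θ (c ⊗ₜ z) = evalAct M (θ c) z := rfl

end action

variable {k L A C : Type*} [CommRing k] [Ring L] [Bialgebra k L] [Ring A] [Algebra k A]
  [AddCommGroup C] [Module k C] [Coalgebra k C]

namespace DoiHopfDatum
variable (D : DoiHopfDatum k L A C)

section
variable {M M' : Type*} [AddCommGroup M] [Module k M] [Module Aᵐᵒᵖ M] [IsScalarTower k Aᵐᵒᵖ M]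
  [AddCommGroup M'] [Module k M'] [Module Aᵐᵒᵖ M'] [IsScalarTower k Aᵐᵒᵖ M']

theorem tensorRightAction_tmul (a : A) (c : C) (m : M) :
    D.tensorRightAction M a (c ⊗ₜ m) = LinearMap.lTensor C (rightOrbit k A m) (D.twist (c ⊗ₜ a)) := by
  simp only [tensorRightAction, LinearMap.comp_apply, LinearEquiv.coe_coe,
    TensorProduct.comm_tmul, LinearMap.lTensor_tmul, LinearMap.flip_apply,
    TensorProduct.mk_apply]
  generalize D.twist (c ⊗ₜ a) = z
  induction z with
  | zero => simp
  | add x y hx hy => simp only [map_add, TensorProduct.tmul_add, hx, hy]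
  | tmul c a => simp

theorem tensorRightAction_one (z : C ⊗[k] M) : D.tensorRightAction M 1 z = z := by
  induction z with
  | zero => simp
  | add x y hx hy => simp only [map_add, hx, hy]
  | tmul c m => simp [tensorRightAction_tmul, twist_one]

/-- Reduces to multiplicativity of `twist`: applying the orbit map of `m` to `C ⊗ A` turns
`twist_mul` into associativity of the action on `C ⊗ M`. -/
theorem tensorRightAction_mul (a b : A) (z : C ⊗[k] M) :
    D.tensorRightAction M (a * b) z = D.tensorRightAction M b (D.tensorRightAction M a z) := by
  induction z with
  | zero => simp
  | add x y hx hy => simp only [map_add, hx, hy]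
  | tmul c m =>
    rw [tensorRightAction_tmul, tensorRightAction_tmul, twist_mul]
    generalize D.twist (c ⊗ₜ a) = z
    induction z with
    | zero => simp
    | add x y hx hy => simp only [map_add, hx, hy]
    | tmul d a =>
      simp only [bind_tmul, LinearMap.lTensor_tmul, tensorRightAction_tmul, LinearMap.comp_apply,
        LinearMap.flip_apply, TensorProduct.mk_apply]
      generalize D.twist (d ⊗ₜ b) = z
      induction z with
      | zero => simp
      | add x y hx hy => simp only [map_add, hx, hy]
      | tmul d b => simp [leftMul, mul_smul]

theorem tensorRightAction_add (a b : A) (z : C ⊗[k] M) :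
    D.tensorRightAction M (a + b) z = D.tensorRightAction M a z + D.tensorRightAction M b z := by
  simp [tensorRightAction, LinearMap.comp_add, LinearMap.lTensor_add]

theorem tensorRightAction_smul (r : k) (a : A) (z : C ⊗[k] M) :
    D.tensorRightAction M (r • a) z = r • D.tensorRightAction M a z := by
  simp [tensorRightAction, LinearMap.comp_smul, LinearMap.lTensor_smul]

theorem tensorRightAction_map (f : M →ₗ[Aᵐᵒᵖ] M') (a : A) (z : C ⊗[k] M) :
    LinearMap.lTensor C (f.restrictScalars k) (D.tensorRightAction M a z) =
      D.tensorRightAction M' a (LinearMap.lTensor C (f.restrictScalars k) z) := by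
  induction z with
  | zero => simp
  | add x y hx hy => simp only [map_add, hx, hy]
  | tmul c m =>
    rw [tensorRightAction_tmul, LinearMap.lTensor_tmul, tensorRightAction_tmul,
      ← LinearMap.comp_apply, ← LinearMap.lTensor_comp, map_comp_rightOrbit]
    rfl

/-- Says that `ε ⊗ M` is `A`-linear, as the counit of the adjunction must be. It comes from
`twist_counit`, that is, from counitality of the coaction on `A` and compatibility of `ε` with the
action on `C`. -/
theorem counit_tensorRightAction (a : A) (z : C ⊗[k] M) :
    TensorProduct.lid k M (LinearMap.rTensor M counit (D.tensorRightAction M a z)) =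
      MulOpposite.op a • TensorProduct.lid k M (LinearMap.rTensor M counit z) := by
  induction z with
  | zero => simp
  | add x y hx hy => simp only [map_add, smul_add, hx, hy]
  | tmul c m =>
    have h (z : C ⊗[k] A) : TensorProduct.lid k M (LinearMap.rTensor M counit
        (LinearMap.lTensor C (rightOrbit k A m) z)) =
        rightOrbit k A m (TensorProduct.lid k A (LinearMap.rTensor A counit z)) := by
      induction z with
      | zero => simp
      | add x y hx hy => simp only [map_add, hx, hy]
      | tmul c a => simp
    rw [tensorRightAction_tmul, h, twist_counit]
    simp only [LinearMap.rTensor_tmul, TensorProduct.lid_tmul, map_smul, rightOrbit_apply]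
    rw [smul_comm]

end

/-- The `k`-module `C ⊗ N` as a right `A`-module, `(c ⊗ n)·a = ∑ c·a₋₁ ⊗ n·a₀`. -/
def Cofree (_D : DoiHopfDatum k L A C) (N : Type*) [AddCommGroup N] [Module k N] : Type _ :=
  C ⊗[k] N

namespace Cofree

section
variable (N : Type*) [AddCommGroup N] [Module k N]
noncomputable instance : AddCommGroup (D.Cofree N) := inferInstanceAs (AddCommGroup (C ⊗[k] N))
noncomputable instance : Module k (D.Cofree N) := inferInstanceAs (Module k (C ⊗[k] N))

/-- The tensor product as a cofree module. -/
noncomputable def ofTensor : C ⊗[k] N ≃ₗ[k] D.Cofree N := LinearEquiv.refl k (C ⊗[k] N)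

variable [Module Aᵐᵒᵖ N] [IsScalarTower k Aᵐᵒᵖ N]

noncomputable instance : SMul Aᵐᵒᵖ (D.Cofree N) :=
  ⟨fun a z => ofTensor D N (D.tensorRightAction N a.unop ((ofTensor D N).symm z))⟩

variable {N} in
theorem smul_ofTensor (a : Aᵐᵒᵖ) (z : C ⊗[k] N) :
    a • ofTensor D N z = ofTensor D N (D.tensorRightAction N a.unop z) := rfl

noncomputable instance : Module Aᵐᵒᵖ (D.Cofree N) where
  one_smul z := by
    obtain ⟨z, rfl⟩ := (ofTensor D N).surjective z
    rw [smul_ofTensor, MulOpposite.unop_one, tensorRightAction_one]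
  mul_smul a b z := by
    obtain ⟨z, rfl⟩ := (ofTensor D N).surjective z
    simp only [smul_ofTensor, MulOpposite.unop_mul, tensorRightAction_mul]
  smul_zero a := by
    rw [← map_zero (ofTensor D N), smul_ofTensor, map_zero]
  smul_add a y z := by
    obtain ⟨y, rfl⟩ := (ofTensor D N).surjective y
    obtain ⟨z, rfl⟩ := (ofTensor D N).surjective z
    rw [← map_add, smul_ofTensor, smul_ofTensor, smul_ofTensor, map_add, map_add]
  add_smul a b z := by
    obtain ⟨z, rfl⟩ := (ofTensor D N).surjective z
    simp only [smul_ofTensor, MulOpposite.unop_add, tensorRightAction_add, map_add]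
  zero_smul z := by
    obtain ⟨z, rfl⟩ := (ofTensor D N).surjective z
    rw [smul_ofTensor, MulOpposite.unop_zero, ← zero_smul k (0 : A), tensorRightAction_smul,
      zero_smul, map_zero]

instance : IsScalarTower k Aᵐᵒᵖ (D.Cofree N) :=
  ⟨fun r a z => by
    obtain ⟨z, rfl⟩ := (ofTensor D N).surjective z
    simp only [smul_ofTensor, MulOpposite.unop_smul, tensorRightAction_smul, map_smul]⟩

end

section
variable {N : Type*} [AddCommGroup N] [Module k N]

/-- The coaction `Δ ⊗ N`. -/
noncomputable def coact (N : Type*) [AddCommGroup N] [Module k N] :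
    D.Cofree N →ₗ[k] C ⊗[k] D.Cofree N :=
  LinearMap.lTensor C (ofTensor D N).toLinearMap ∘ₗ (TensorProduct.assoc k C C N).toLinearMap ∘ₗ
    LinearMap.rTensor N comul ∘ₗ (ofTensor D N).symm.toLinearMap

theorem coact_ofTensor (z : C ⊗[k] N) :
    coact D N (ofTensor D N z) = LinearMap.lTensor C (ofTensor D N).toLinearMap
      (TensorProduct.assoc k C C N (LinearMap.rTensor N comul z)) := rfl

theorem counit_coact (z : D.Cofree N) : TensorProduct.lid k (D.Cofree N)
    (LinearMap.rTensor (D.Cofree N) counit (coact D N z)) = z := by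
  obtain ⟨z, rfl⟩ := (ofTensor D N).surjective z
  rw [coact_ofTensor]
  have h (y : (C ⊗[k] C) ⊗[k] N) : TensorProduct.lid k (D.Cofree N)
      (LinearMap.rTensor (D.Cofree N) counit (LinearMap.lTensor C (ofTensor D N).toLinearMap
        (TensorProduct.assoc k C C N y))) =
      ofTensor D N (LinearMap.rTensor N
        ((TensorProduct.lid k C).toLinearMap ∘ₗ LinearMap.rTensor C counit) y) := by
    induction y with
    | zero => simp
    | add x y hx hy => simp only [map_add, hx, hy]
    | tmul y n =>
      induction y with
      | zero => simp
      | add x y hx hy => simp only [map_add, TensorProduct.add_tmul, hx, hy]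
      | tmul c d => simp [← TensorProduct.smul_tmul']
  have h' : (TensorProduct.lid k C).toLinearMap ∘ₗ LinearMap.rTensor C counit ∘ₗ comul =
    (LinearMap.id : C →ₗ[k] C) := by ext; simp
  rw [h, ← LinearMap.comp_apply (f := LinearMap.rTensor N _), ← LinearMap.rTensor_comp,
    LinearMap.comp_assoc, h', LinearMap.rTensor_id, LinearMap.id_apply]

theorem coassoc_coact (z : D.Cofree N) : TensorProduct.assoc k C C (D.Cofree N)
    (LinearMap.rTensor (D.Cofree N) comul (coact D N z)) =
      LinearMap.lTensor C (coact D N) (coact D N z) := by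
  obtain ⟨z, rfl⟩ := (ofTensor D N).surjective z
  rw [coact_ofTensor]
  induction z with
  | zero => simp
  | add x y hx hy => simp only [map_add, hx, hy]
  | tmul c n =>
    have hl (y : C ⊗[k] C) : TensorProduct.assoc k C C (D.Cofree N) (LinearMap.rTensor (D.Cofree N)
        comul (LinearMap.lTensor C (ofTensor D N).toLinearMap
          (TensorProduct.assoc k C C N (y ⊗ₜ n)))) =
        LinearMap.lTensor C (LinearMap.lTensor C (ofTensor D N).toLinearMap ∘ₗ
          (TensorProduct.assoc k C C N).toLinearMap) (TensorProduct.assoc k C _ N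
          ((TensorProduct.assoc k C C C (LinearMap.rTensor C comul y)) ⊗ₜ n)) := by
      induction y with
      | zero => simp
      | add x y hx hy => simp only [map_add, TensorProduct.add_tmul, hx, hy]
      | tmul c d =>
        simp only [TensorProduct.assoc_tmul, LinearMap.rTensor_tmul, LinearMap.lTensor_tmul]
        generalize comul (R := k) c = y
        induction y with
        | zero => simp
        | add x y hx hy => simp only [map_add, TensorProduct.add_tmul, hx, hy]
        | tmul c e => simp
    have hr (y : C ⊗[k] C) : LinearMap.lTensor C (coact D N)
        (LinearMap.lTensor C (ofTensor D N).toLinearMap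
          (TensorProduct.assoc k C C N (y ⊗ₜ n))) =
        LinearMap.lTensor C (LinearMap.lTensor C (ofTensor D N).toLinearMap ∘ₗ
          (TensorProduct.assoc k C C N).toLinearMap) (TensorProduct.assoc k C _ N
          ((LinearMap.lTensor C comul y) ⊗ₜ n)) := by
      induction y with
      | zero => simp
      | add x y hx hy => simp only [map_add, TensorProduct.add_tmul, hx, hy]
      | tmul c d => simp [coact_ofTensor]
    rw [LinearMap.rTensor_tmul, hl, hr, coassoc_apply]

end

variable {N N' : Type*} [AddCommGroup N] [Module k N] [Module Aᵐᵒᵖ N] [IsScalarTower k Aᵐᵒᵖ N]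
  [AddCommGroup N'] [Module k N'] [Module Aᵐᵒᵖ N'] [IsScalarTower k Aᵐᵒᵖ N']

/-- The `A`-linear map `ε ⊗ N : C ⊗ N → N`. -/
noncomputable def proj (N : Type*) [AddCommGroup N] [Module k N] [Module Aᵐᵒᵖ N]
    [IsScalarTower k Aᵐᵒᵖ N] : D.Cofree N →ₗ[Aᵐᵒᵖ] N where
  toFun z := TensorProduct.lid k N (LinearMap.rTensor N counit ((ofTensor D N).symm z))
  map_add' x y := by simp
  map_smul' a z := D.counit_tensorRightAction a.unop ((ofTensor D N).symm z)

theorem proj_ofTensor (z : C ⊗[k] N) :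
    proj D N (ofTensor D N z) = TensorProduct.lid k N (LinearMap.rTensor N counit z) := rfl

/-- The map `C ⊗ f`. -/
noncomputable def map (f : N →ₗ[Aᵐᵒᵖ] N') : D.Cofree N →ₗ[Aᵐᵒᵖ] D.Cofree N' where
  toFun z := ofTensor D N' (LinearMap.lTensor C (f.restrictScalars k) ((ofTensor D N).symm z))
  map_add' x y := by simp
  map_smul' a z := congrArg (ofTensor D N')
    (D.tensorRightAction_map f a.unop ((ofTensor D N).symm z))

theorem map_ofTensor (f : N →ₗ[Aᵐᵒᵖ] N') (z : C ⊗[k] N) :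
    map D f (ofTensor D N z) = ofTensor D N' (LinearMap.lTensor C (f.restrictScalars k) z) := rfl

theorem map_map {N'' : Type*} [AddCommGroup N''] [Module k N''] [Module Aᵐᵒᵖ N'']
    [IsScalarTower k Aᵐᵒᵖ N''] (f : N →ₗ[Aᵐᵒᵖ] N') (g : N' →ₗ[Aᵐᵒᵖ] N'') (z : D.Cofree N) :
    map D g (map D f z) = map D (g ∘ₗ f) z := by
  obtain ⟨z, rfl⟩ := (ofTensor D N).surjective z
  rw [map_ofTensor, map_ofTensor, map_ofTensor, ← LinearMap.comp_apply, ← LinearMap.lTensor_comp]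
  rfl

theorem proj_map (f : N →ₗ[Aᵐᵒᵖ] N') (z : D.Cofree N) : proj D N' (map D f z) = f (proj D N z) := by
  obtain ⟨z, rfl⟩ := (ofTensor D N).surjective z
  rw [map_ofTensor, proj_ofTensor, proj_ofTensor]
  induction z with
  | zero => simp
  | add x y hx hy => simp only [map_add, hx, hy]
  | tmul c n => simp

theorem coact_map (f : N →ₗ[Aᵐᵒᵖ] N') (z : D.Cofree N) :
    coact D N' (map D f z) =
      LinearMap.lTensor C ((map D f).restrictScalars k) (coact D N z) := by
  obtain ⟨z, rfl⟩ := (ofTensor D N).surjective z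
  rw [map_ofTensor, coact_ofTensor, coact_ofTensor]
  induction z with
  | zero => simp
  | add x y hx hy => simp only [map_add, hx, hy]
  | tmul c n =>
    simp only [LinearMap.lTensor_tmul, LinearMap.rTensor_tmul]
    generalize comul (R := k) c = y
    induction y with
    | zero => simp
    | add x y hx hy => simp only [map_add, TensorProduct.add_tmul, hx, hy]
    | tmul c d => simp [map_ofTensor]

/-- A triangle identity of the adjunction: an element of `C ⊗ N` is recovered from its coaction.
Later it converts colinearity of the retraction into colinearity of the integral. -/
theorem lTensor_proj_coact (z : D.Cofree N) :
    LinearMap.lTensor C ((proj D N).restrictScalars k) (coact D N z) = (ofTensor D N).symm z := by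
  obtain ⟨z, rfl⟩ := (ofTensor D N).surjective z
  rw [coact_ofTensor, LinearEquiv.symm_apply_apply]
  have h (y : (C ⊗[k] C) ⊗[k] N) : LinearMap.lTensor C ((proj D N).restrictScalars k)
      (LinearMap.lTensor C (ofTensor D N).toLinearMap (TensorProduct.assoc k C C N y)) =
      LinearMap.rTensor N ((TensorProduct.rid k C).toLinearMap ∘ₗ LinearMap.lTensor C counit) y := by
    induction y with
    | zero => simp
    | add x y hx hy => simp only [map_add, hx, hy]
    | tmul y n =>
      induction y with
      | zero => simp
      | add x y hx hy => simp only [map_add, TensorProduct.add_tmul, hx, hy]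
      | tmul c d => simp [proj_ofTensor, TensorProduct.smul_tmul]
  have h' : (TensorProduct.rid k C).toLinearMap ∘ₗ LinearMap.lTensor C counit ∘ₗ comul =
    (LinearMap.id : C →ₗ[k] C) := by ext; simp
  rw [h, ← LinearMap.comp_apply, ← LinearMap.rTensor_comp, LinearMap.comp_assoc, h',
    LinearMap.rTensor_id, LinearMap.id_apply]

/-- By `comul_twist`, applying `Δ` after a twist is the double twist `twist2` applied after `Δ`; and
`twist2` is the right action of `a` on the iterated tensor product `C ⊗ (C ⊗ N)`. -/
theorem coact_smul (z : D.Cofree N) (a : A) :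
    coact D N (MulOpposite.op a • z) = D.tensorRightAction (D.Cofree N) a (coact D N z) := by
  have h1 (n : N) (z : C ⊗[k] A) : TensorProduct.assoc k C C N
      (LinearMap.rTensor N comul (LinearMap.lTensor C (rightOrbit k A n) z)) =
      LinearMap.lTensor C (LinearMap.lTensor C (rightOrbit k A n))
        (TensorProduct.assoc k C C A (LinearMap.rTensor A comul z)) := by
    induction z with
    | zero => simp
    | add x y hx hy => simp only [map_add, hx, hy]
    | tmul c a =>
      simp only [LinearMap.lTensor_tmul, LinearMap.rTensor_tmul]
      generalize comul (R := k) c = y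
      induction y with
      | zero => simp
      | add x y hx hy => simp only [map_add, TensorProduct.add_tmul, hx, hy]
      | tmul c d => simp
  have h2 (y : C ⊗[k] C) (n : N) : LinearMap.lTensor C (ofTensor D N).toLinearMap
      (LinearMap.lTensor C (LinearMap.lTensor C (rightOrbit k A n))
        (D.twist2 (TensorProduct.assoc k C C A (y ⊗ₜ a)))) =
      D.tensorRightAction (D.Cofree N) a (LinearMap.lTensor C (ofTensor D N).toLinearMap
        (TensorProduct.assoc k C C N (y ⊗ₜ n))) := by
    induction y with
    | zero => simp
    | add x y hx hy => simp only [map_add, TensorProduct.add_tmul, hx, hy]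
    | tmul d e =>
      simp only [TensorProduct.assoc_tmul, twist2, LinearMap.comp_apply, LinearEquiv.coe_coe,
        TensorProduct.leftComm_tmul, LinearMap.lTensor_tmul, tensorRightAction_tmul]
      generalize D.twist (d ⊗ₜ a) = z
      induction z with
      | zero => simp
      | add x y hx hy => simp only [map_add, TensorProduct.tmul_add, hx, hy]
      | tmul d a =>
        simp [smul_ofTensor, tensorRightAction_tmul]
  obtain ⟨z, rfl⟩ := (ofTensor D N).surjective z
  rw [smul_ofTensor, coact_ofTensor, coact_ofTensor, MulOpposite.unop_op]
  induction z with
  | zero => simp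
  | add x y hx hy => simp only [map_add, hx, hy]
  | tmul c n => rw [tensorRightAction_tmul, h1, comul_twist, h2]; rfl

end Cofree

/-- The cofree Doi-Hopf module `C ⊗ N` on a right `A`-module `N`. -/
noncomputable def cofree {C : Type w} [AddCommGroup C] [Module k C] [Coalgebra k C]
    (D : DoiHopfDatum k L A C) (N : Type w) [AddCommGroup N] [Module k N] [Module Aᵐᵒᵖ N]
    [IsScalarTower k Aᵐᵒᵖ N] : DoiHopfModule.{w} D where
  carrier := D.Cofree N
  coact := Cofree.coact D N
  counit_coact := Cofree.counit_coact D
  coassoc_coact := Cofree.coassoc_coact D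
  coact_smul := Cofree.coact_smul D

end DoiHopfDatum
end cofree

/-! ### Rafael's criterion, and natural retractions as total integrals. -/

section separable
open CategoryTheory

universe w

variable {k L : Type*} {A C : Type w} [CommRing k] [Ring L] [Bialgebra k L] [Ring A] [Algebra k A]
  [AddCommGroup C] [Module k C] [Coalgebra k C]

namespace DoiHopfModule
open DoiHopfDatum

variable {D : DoiHopfDatum k L A C}

theorem hom_ext {M N : DoiHopfModule.{w} D} {f g : M ⟶ N}
    (h : ∀ m, Hom.toLinearMap f m = Hom.toLinearMap g m) : f = g :=
  Hom.ext (LinearMap.ext h)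

theorem colinear_apply {M N : DoiHopfModule.{w} D} (f : M ⟶ N) (m : M.carrier) :
    N.coact (Hom.toLinearMap f m) =
      LinearMap.lTensor C ((Hom.toLinearMap f).restrictScalars k) (M.coact m) :=
  Hom.colinear f m

/-- The functoriality of the cofree Doi-Hopf module. -/
noncomputable def cofreeMap {N N' : Type w} [AddCommGroup N] [Module k N] [Module Aᵐᵒᵖ N]
    [IsScalarTower k Aᵐᵒᵖ N] [AddCommGroup N'] [Module k N'] [Module Aᵐᵒᵖ N']
    [IsScalarTower k Aᵐᵒᵖ N'] (f : N →ₗ[Aᵐᵒᵖ] N') : D.cofree N ⟶ D.cofree N' :=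
  Hom.mk (M := D.cofree N) (N := D.cofree N') (Cofree.map D f) (Cofree.coact_map D f)

/-- The coaction, as a morphism to the cofree Doi-Hopf module. -/
noncomputable def coactHom (M : DoiHopfModule.{w} D) : M ⟶ D.cofree M.carrier :=
  Hom.mk (M := M) (N := D.cofree M.carrier)
    { toFun := fun m => Cofree.ofTensor D _ (M.coact m)
      map_add' := fun x y => (congrArg (Cofree.ofTensor D _) (map_add M.coact x y)).trans
        (map_add (Cofree.ofTensor D _) _ _)
      map_smul' := fun a m => congrArg (Cofree.ofTensor D _) (M.coact_smul m a.unop) }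
    (fun m => by
      refine (Cofree.coact_ofTensor D (M.coact m)).trans ?_
      rw [M.coassoc_coact, ← LinearMap.comp_apply, ← LinearMap.lTensor_comp]
      rfl)

/-- The `A`-linear map underlying a morphism between underlying `A`-modules. -/
noncomputable def forgetHom {M N : DoiHopfModule.{w} D}
    (f : (forget D).obj M ⟶ (forget D).obj N) : M.carrier →ₗ[Aᵐᵒᵖ] N.carrier := f.hom

/-- A natural retraction of the coactions `M → C ⊗ M`. -/
structure NaturalRetraction (D : DoiHopfDatum k L A C) where
  /-- the retractions -/
  app : ∀ M : DoiHopfModule.{w} D, D.Cofree M.carrier →ₗ[Aᵐᵒᵖ] M.carrier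
  colinear : ∀ (M : DoiHopfModule.{w} D) (z : D.Cofree M.carrier),
    M.coact (app M z) =
      LinearMap.lTensor C ((app M).restrictScalars k) (Cofree.coact D M.carrier z)
  natural : ∀ {M N : DoiHopfModule.{w} D} (f : M ⟶ N) (z : D.Cofree M.carrier),
    app N (Cofree.map D (Hom.toLinearMap f) z) = Hom.toLinearMap f (app M z)
  retract : ∀ (M : DoiHopfModule.{w} D) (m : M.carrier),
    app M (Cofree.ofTensor D M.carrier (M.coact m)) = m

/-- The components of a natural retraction as morphisms of Doi-Hopf modules. -/
noncomputable def NaturalRetraction.appHom (ν : NaturalRetraction D) (M : DoiHopfModule.{w} D) :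
    D.cofree M.carrier ⟶ M :=
  Hom.mk (M := D.cofree M.carrier) (N := M) (ν.app M) (ν.colinear M)

/-- Rafael's criterion for the functor forgetting the coaction. -/
theorem isSeparableFunctor_forget_iff_nonempty (D : DoiHopfDatum k L A C) :
    IsSeparableFunctor (DoiHopfModule.forget.{w} D) ↔ Nonempty (NaturalRetraction D) := by
  constructor
  · rintro ⟨P, hP, hid⟩
    -- The retraction is `P(ε_M)`, where `ε_M` is the counit of the adjunction, not itself a
    -- morphism of Doi-Hopf modules.
    let ε (M : DoiHopfModule.{w} D) : (forget D).obj (D.cofree M.carrier) ⟶ (forget D).obj M :=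
      ModuleCat.ofHom (Cofree.proj D M.carrier)
    -- Naturality of `P` in each variable carries both sides to `P` of a composite; the two
    -- composites agree because `ε ⊗ -` is natural.
    have hnat {M N : DoiHopfModule.{w} D} (f : M ⟶ N) :
        cofreeMap (Hom.toLinearMap f) ≫ P _ _ (ε N) = P _ _ (ε M) ≫ f := by
      have h1 := hP (cofreeMap (Hom.toLinearMap f)) (ε N) (𝟙 N)
      have h2 := hP (𝟙 (D.cofree M.carrier)) (ε M) f
      simp only [Category.comp_id, Category.id_comp, CategoryTheory.Functor.map_id] at h1 h2
      rw [← h1, ← h2]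
      congr 1
      ext z
      exact Cofree.proj_map D (Hom.toLinearMap f) z
    -- The composite of the coaction with `ε_M` is the identity of `M`, and `P` splits `f ↦ F f`.
    have hret (M : DoiHopfModule.{w} D) : coactHom M ≫ P _ _ (ε M) = 𝟙 M := by
      have h1 := hP (coactHom M) (ε M) (𝟙 M)
      have h2 := hid (𝟙 M)
      simp only [Category.comp_id, CategoryTheory.Functor.map_id] at h1 h2
      rw [← h1, ← h2]
      congr 1
      ext m
      exact M.counit_coact m
    exact ⟨⟨fun M => Hom.toLinearMap (P _ _ (ε M)), fun M => Hom.colinear (P _ _ (ε M)),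
      fun f => LinearMap.congr_fun (congrArg Hom.toLinearMap (hnat f)),
      fun M => LinearMap.congr_fun (congrArg Hom.toLinearMap (hret M))⟩⟩
  · rintro ⟨ν⟩
    -- Conversely, an `A`-linear `f : M → N` is sent to `ν_N ∘ (C ⊗ f) ∘ ρ_M`, its adjoint transpose
    -- followed by the retraction.
    refine ⟨fun M N f => coactHom M ≫ cofreeMap (forgetHom f) ≫ ν.appHom N,
      fun {X' X Y Y'} a g b => hom_ext fun x => ?_, fun {X Y} f => hom_ext fun x => ?_⟩
    -- The morphism `b` passes through `ν` by naturality, and `a` passes through the coaction by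
    -- colinearity.
    · have h : ν.app Y' (Cofree.map D (Hom.toLinearMap b) (Cofree.map D (forgetHom g)
          (Cofree.map D (Hom.toLinearMap a) (Cofree.ofTensor D _ (X'.coact x))))) =
          Hom.toLinearMap b (ν.app Y (Cofree.map D (forgetHom g) (Cofree.ofTensor D _
            (X.coact (Hom.toLinearMap a x))))) := by
        rw [ν.natural, colinear_apply, Cofree.map_ofTensor]
      refine Eq.trans ?_ h
      rw [Cofree.map_map, Cofree.map_map]
      rfl
    · have h := ν.natural f (Cofree.ofTensor D _ (X.coact x))
      rw [ν.retract] at h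
      exact h

section ofIntegral
variable {θ : C →ₗ[k] C →ₗ[k] A} (hθ : D.IsTotalIntegral θ) (M : DoiHopfModule.{w} D)
include hθ

/-- Linearity of `c ⊗ m ↦ ∑ m₀ · θ c m₋₁`. Since `ρ(m·a) = ρ(m)·a`, acting by `a` twists both `c`
and `m₋₁`, and the centrality condition moves `a` to the right of `θ`. -/
theorem evalAct₂_tensorRightAction (a : A) (z : C ⊗[k] M.carrier) :
    evalAct₂ M.carrier θ (LinearMap.lTensor C M.coact (D.tensorRightAction M.carrier a z)) =
      MulOpposite.op a • evalAct₂ M.carrier θ (LinearMap.lTensor C M.coact z) := by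
  induction z with
  | zero => simp
  | add x y hx hy => simp only [map_add, smul_add, hx, hy]
  | tmul c m =>
    -- Here `ρ(m)` is replaced by an arbitrary `y : C ⊗ M`, so that it may be taken to be a pure
    -- tensor.
    have h (y : C ⊗[k] M.carrier) : evalAct₂ M.carrier θ (LinearMap.lTensor C
        ((Cofree.ofTensor D M.carrier).symm.toLinearMap ∘ₗ
          rightOrbit k A (Cofree.ofTensor D M.carrier y)) (D.twist (c ⊗ₜ a))) =
        MulOpposite.op a • evalAct M.carrier (θ c) y := by
      induction y with
      | zero => simp [rightOrbit]
      | add x y hx hy =>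
        rw [map_add (evalAct M.carrier (θ c)), smul_add, ← hx, ← hy]
        simp [rightOrbit, LinearMap.comp_add, LinearMap.lTensor_add]
      | tmul d n =>
        rw [evalAct_tmul, ← mul_smul, ← MulOpposite.op_mul, ← hθ.central]
        simp only [twist2, LinearMap.comp_apply, LinearEquiv.coe_coe,
          TensorProduct.leftComm_tmul, LinearMap.lTensor_tmul]
        generalize D.twist (c ⊗ₜ a) = z
        induction z with
        | zero => simp
        | add x y hx hy =>
          simp only [map_add, TensorProduct.tmul_add, hx, hy, MulOpposite.op_add, add_smul]
        | tmul c a =>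
          simp [Cofree.smul_ofTensor, tensorRightAction_tmul, evalAct_rightOrbit]
    have h' : M.coact ∘ₗ rightOrbit k A m = (Cofree.ofTensor D M.carrier).symm.toLinearMap ∘ₗ
        rightOrbit k A (Cofree.ofTensor D M.carrier (M.coact m)) := by
      ext a
      exact M.coact_smul m a
    rw [tensorRightAction_tmul, ← LinearMap.comp_apply (f := LinearMap.lTensor C _),
      ← LinearMap.lTensor_comp, h', h]
    simp

/-- Colinearity of the retraction. By compatibility `ρ(m₀ · θ c m₋₁) = ρ(m₀) · θ c m₋₁`;
coassociativity brings both legs under one comultiplication, where the right side of the integral's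
colinearity identity appears. Replacing it by `∑ c₁ ⊗ θ c₂ m₋₁` gives the claim. -/
theorem coact_evalAct₂ (z : C ⊗[k] M.carrier) :
    M.coact (evalAct₂ M.carrier θ (LinearMap.lTensor C M.coact z)) =
      LinearMap.lTensor C (evalAct₂ M.carrier θ ∘ₗ LinearMap.lTensor C M.coact)
        (TensorProduct.assoc k C C M.carrier (LinearMap.rTensor M.carrier comul z)) := by
  induction z with
  | zero => simp
  | add x y hx hy => simp only [map_add, hx, hy]
  | tmul c m =>
    -- The map `d ⊗ (e ⊗ n) ↦ (e ⊗ n) · θ c d`, with the action of the cofree module.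
    let T : C ⊗[k] (C ⊗[k] M.carrier) →ₗ[k] C ⊗[k] M.carrier :=
      (Cofree.ofTensor D M.carrier).symm.toLinearMap ∘ₗ evalAct (D.Cofree M.carrier) (θ c) ∘ₗ
        LinearMap.lTensor C (Cofree.ofTensor D M.carrier).toLinearMap
    have h1 (y : C ⊗[k] M.carrier) : M.coact (evalAct M.carrier (θ c) y) =
        T (LinearMap.lTensor C M.coact y) := by
      induction y with
      | zero => simp
      | add x y hx hy => simp only [map_add, hx, hy]
      | tmul d n =>
        rw [evalAct_tmul, M.coact_smul]
        rfl
    have h2 (d : C) (n : M.carrier) : T (TensorProduct.assoc k C C M.carrier (comul d ⊗ₜ n)) =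
        LinearMap.lTensor C (rightOrbit k A n) (D.spread (θ c) d) := by
      rw [spread]
      simp only [LinearMap.comp_apply]
      generalize comul (R := k) d = y
      induction y with
      | zero => simp
      | add x y hx hy => simp only [map_add, TensorProduct.add_tmul, hx, hy]
      | tmul d e => simp [T, Cofree.smul_ofTensor, tensorRightAction_tmul]
    have h3 (y : C ⊗[k] M.carrier) : T (TensorProduct.assoc k C C M.carrier
        (LinearMap.rTensor M.carrier comul y)) =
        LinearMap.lTensor C (evalAct₂ M.carrier θ ∘ₗ (TensorProduct.mk k C (C ⊗[k] M.carrier)).flip y)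
          (comul c) := by
      induction y with
      | zero => simp
      | add x y hx hy =>
        simp only [map_add, hx, hy, LinearMap.comp_add, LinearMap.lTensor_add,
          LinearMap.add_apply]
      | tmul d n =>
        rw [LinearMap.rTensor_tmul, h2, ← hθ.colinear, ← LinearMap.comp_apply,
          ← LinearMap.lTensor_comp]
        rfl
    simp only [LinearMap.lTensor_tmul, evalAct₂_tmul, LinearMap.rTensor_tmul]
    rw [h1, ← M.coassoc_coact, h3]
    generalize comul (R := k) c = y
    induction y with
    | zero => simp
    | add x y hx hy => simp only [map_add, TensorProduct.add_tmul, hx, hy]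
    | tmul d e => simp

/-- By coassociativity the composite is `∑ m₀ · θ (m₋₁)₁ (m₋₁)₂`; totality reduces it to `∑ ε(m₋₁)
m₀ = m`. -/
theorem evalAct₂_coact (m : M.carrier) :
    evalAct₂ M.carrier θ (LinearMap.lTensor C M.coact (M.coact m)) = m := by
  have h1 (d : C) (n : M.carrier) : evalAct₂ M.carrier θ
      (TensorProduct.assoc k C C M.carrier (comul d ⊗ₜ n)) = counit (R := k) d • n := by
    have h2 : evalAct₂ M.carrier θ (TensorProduct.assoc k C C M.carrier (comul d ⊗ₜ n)) =
        rightOrbit k A n (TensorProduct.lift θ (comul d)) := by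
      generalize comul (R := k) d = y
      induction y with
      | zero => simp
      | add x y hx hy => simp only [map_add, TensorProduct.add_tmul, hx, hy]
      | tmul d e => simp
    rw [h2, hθ.total, Algebra.algebraMap_eq_smul_one, map_smul]
    simp
  have h3 (y : C ⊗[k] M.carrier) : evalAct₂ M.carrier θ (TensorProduct.assoc k C C M.carrier
        (LinearMap.rTensor M.carrier comul y)) =
      TensorProduct.lid k M.carrier (LinearMap.rTensor M.carrier counit y) := by
    induction y with
    | zero => simp
    | add x y hx hy => simp only [map_add, hx, hy]
    | tmul d n => simp [h1]
  rw [← M.coassoc_coact, h3, M.counit_coact]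

/-- The natural retraction `c ⊗ m ↦ m₀ · θ c m₋₁` given by a total integral `θ`. -/
noncomputable def NaturalRetraction.ofIntegral : NaturalRetraction D where
  app M :=
    { toFun := fun z => evalAct₂ M.carrier θ
        (LinearMap.lTensor C M.coact ((Cofree.ofTensor D M.carrier).symm z))
      map_add' := fun x y => by simp
      map_smul' := fun a z => evalAct₂_tensorRightAction hθ M a.unop _ }
  colinear M z := by
    obtain ⟨z, rfl⟩ := (Cofree.ofTensor D _).surjective z
    refine (coact_evalAct₂ hθ M z).trans ?_
    rw [Cofree.coact_ofTensor, ← LinearMap.comp_apply (f := LinearMap.lTensor C _),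
      ← LinearMap.lTensor_comp]
    rfl
  natural {M N} f z := by
    obtain ⟨z, rfl⟩ := (Cofree.ofTensor D _).surjective z
    change evalAct₂ N.carrier θ (LinearMap.lTensor C N.coact (LinearMap.lTensor C
      ((Hom.toLinearMap f).restrictScalars k) z)) =
      Hom.toLinearMap f (evalAct₂ M.carrier θ (LinearMap.lTensor C M.coact z))
    induction z with
    | zero => simp
    | add x y hx hy => simp only [map_add, hx, hy]
    | tmul c m => simp [colinear_apply, evalAct_map]
  retract M m := evalAct₂_coact hθ M m

end ofIntegral

namespace NaturalRetraction
variable (ν : NaturalRetraction D)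

/-- The component at a cofree module. -/
noncomputable def appCofree (N : Type w) [AddCommGroup N] [Module k N] [Module Aᵐᵒᵖ N]
    [IsScalarTower k Aᵐᵒᵖ N] : D.Cofree (D.Cofree N) →ₗ[Aᵐᵒᵖ] D.Cofree N :=
  ν.app (D.cofree N)

variable {N N' : Type w} [AddCommGroup N] [Module k N] [Module Aᵐᵒᵖ N]
    [IsScalarTower k Aᵐᵒᵖ N] [AddCommGroup N'] [Module k N'] [Module Aᵐᵒᵖ N']
    [IsScalarTower k Aᵐᵒᵖ N']

theorem appCofree_map (f : N →ₗ[Aᵐᵒᵖ] N') (z : D.Cofree (D.Cofree N)) :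
    ν.appCofree N' (Cofree.map D (Cofree.map D f) z) = Cofree.map D f (ν.appCofree N z) :=
  ν.natural (cofreeMap f) z

theorem appCofree_coact (M : DoiHopfModule.{w} D) (z : D.Cofree M.carrier) :
    ν.appCofree M.carrier (Cofree.map D (Hom.toLinearMap (coactHom M)) z) =
      Cofree.ofTensor D _ (M.coact (ν.app M z)) :=
  ν.natural (coactHom M) z

theorem coact_appCofree (z : D.Cofree (D.Cofree N)) :
    Cofree.coact D N (ν.appCofree N z) =
      LinearMap.lTensor C ((ν.appCofree N).restrictScalars k) (Cofree.coact D (D.Cofree N) z) :=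
  ν.colinear (D.cofree N) z

theorem appCofree_retract (z : D.Cofree N) :
    ν.appCofree N (Cofree.ofTensor D (D.Cofree N) (Cofree.coact D N z)) = z :=
  ν.retract (D.cofree N) z

/-- The map `C ⊗ (C ⊗ N) → C ⊗ N → N`. -/
noncomputable def projApp (N : Type w) [AddCommGroup N] [Module k N] [Module Aᵐᵒᵖ N]
    [IsScalarTower k Aᵐᵒᵖ N] : C ⊗[k] (C ⊗[k] N) →ₗ[k] N :=
  (Cofree.proj D N ∘ₗ ν.appCofree N).restrictScalars k ∘ₗ
    (Cofree.ofTensor D (D.Cofree N)).toLinearMap ∘ₗ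
    LinearMap.lTensor C (Cofree.ofTensor D N).toLinearMap

/-- The integral `θ c d = (ε ⊗ A) (ν (c ⊗ (d ⊗ 1)))`. -/
noncomputable def integral : C →ₗ[k] C →ₗ[k] A :=
  LinearMap.mk₂ k (fun c d => ν.projApp A (c ⊗ₜ (d ⊗ₜ 1)))
    (fun c c' d => by simp [TensorProduct.add_tmul])
    (fun r c d => by simp [← TensorProduct.smul_tmul'])
    (fun c d d' => by simp [TensorProduct.add_tmul, TensorProduct.tmul_add])
    (fun r c d => by simp [← TensorProduct.smul_tmul'])

/-- Naturality of `ν` at the morphism `C ⊗ f`, followed by naturality of `ε ⊗ -`. -/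
theorem projApp_map (f : N →ₗ[Aᵐᵒᵖ] N') (w : C ⊗[k] (C ⊗[k] N)) :
    ν.projApp N' (LinearMap.lTensor C (LinearMap.lTensor C (f.restrictScalars k)) w) =
      f (ν.projApp N w) := by
  have h := ν.appCofree_map f (Cofree.ofTensor D _
    (LinearMap.lTensor C (Cofree.ofTensor D N).toLinearMap w))
  rw [Cofree.map_ofTensor, ← LinearMap.comp_apply (f := LinearMap.lTensor C _),
    ← LinearMap.lTensor_comp] at h
  have h' := congrArg (Cofree.proj D N') h
  rw [Cofree.proj_map] at h'
  rw [projApp, LinearMap.comp_apply, LinearMap.comp_apply,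
    ← LinearMap.comp_apply (f := LinearMap.lTensor C _), ← LinearMap.lTensor_comp]
  exact h'

/-- The right module `A` is free on `1`, so every `n` is the image of `1` under an `A`-linear map `A
→ N`; naturality transports the value at `1`, which defines `ν.integral`, to the value at `n`. -/
theorem projApp_tmul (c : C) (z : C ⊗[k] N) :
    ν.projApp N (c ⊗ₜ z) = evalAct N (ν.integral c) z := by
  induction z with
  | zero => simp
  | add x y hx hy => simp only [map_add, TensorProduct.tmul_add, hx, hy]
  | tmul d n =>
    let f : A →ₗ[Aᵐᵒᵖ] N :=
      { rightOrbit k A n with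
        map_smul' := fun a b => by simp [← mul_smul] }
    have h := ν.projApp_map f (c ⊗ₜ (d ⊗ₜ 1))
    have h1 : f 1 = n := one_smul Aᵐᵒᵖ n
    simp only [LinearMap.lTensor_tmul, LinearMap.restrictScalars_apply, h1] at h
    exact h

/-- The coaction `M → C ⊗ M` is a morphism of Doi-Hopf modules, so naturality along it expresses
`ν_M` through `ν` at a cofree module; applying `ε ⊗ M` then removes the extra coaction. Hence `ν` is
determined by its integral. -/
theorem app_ofTensor (M : DoiHopfModule.{w} D) (c : C) (m : M.carrier) :
    ν.app M (Cofree.ofTensor D _ (c ⊗ₜ m)) = evalAct M.carrier (ν.integral c) (M.coact m) := by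
  rw [← projApp_tmul]
  have h := congrArg (Cofree.proj D _) (ν.appCofree_coact M (Cofree.ofTensor D _ (c ⊗ₜ m)))
  refine Eq.trans (M.counit_coact _).symm (h.symm.trans ?_)
  rfl

/-- The formula for `ν` at the cofree module `C ⊗ A`: on `d ⊗ 1` the coaction is `∑ d₁ ⊗ (d₂ ⊗ 1)`,
and acting by `θ c d₁` on `d₂ ⊗ 1` gives `spread`. -/
theorem appCofree_ofTensor (c d : C) :
    ν.appCofree A (Cofree.ofTensor D _ (c ⊗ₜ Cofree.ofTensor D A (d ⊗ₜ 1))) =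
      Cofree.ofTensor D A (D.spread (ν.integral c) d) := by
  refine (ν.app_ofTensor (D.cofree A) c (Cofree.ofTensor D A (d ⊗ₜ 1))).trans ?_
  change evalAct (D.Cofree A) (ν.integral c) (Cofree.coact D A (Cofree.ofTensor D A (d ⊗ₜ 1))) = _
  rw [Cofree.coact_ofTensor, LinearMap.rTensor_tmul, spread]
  simp only [LinearMap.comp_apply]
  generalize comul (R := k) d = y
  induction y with
  | zero => simp
  | add x y hx hy => simp only [map_add, TensorProduct.add_tmul, hx, hy]
  | tmul d e =>
    have h : rightOrbit k A (1 : A) = LinearMap.id := by ext; simp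
    simp [Cofree.smul_ofTensor, tensorRightAction_tmul, h]

theorem projApp_eq (w : C ⊗[k] (C ⊗[k] A)) : ν.projApp A w = evalMul₂ ν.integral w := by
  induction w with
  | zero => simp
  | add x y hx hy => simp only [map_add, hx, hy]
  | tmul c z => rw [projApp_tmul, evalAct_self, evalMul₂_tmul]

/-- Each property of `ν` is tested on the cofree module `C ⊗ A` and projected by `ε ⊗ A`:
colinearity at `c ⊗ (d ⊗ 1)`, `A`-linearity at the same element, and the retraction property at `c ⊗
1`. -/
theorem isTotalIntegral : D.IsTotalIntegral ν.integral where
  colinear c d := by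
    have h := congrArg (LinearMap.lTensor C ((Cofree.proj D A).restrictScalars k))
      (ν.coact_appCofree (Cofree.ofTensor D _ (c ⊗ₜ Cofree.ofTensor D A (d ⊗ₜ 1))))
    rw [Cofree.lTensor_proj_coact, appCofree_ofTensor, LinearEquiv.symm_apply_apply] at h
    rw [h, Cofree.coact_ofTensor, LinearMap.rTensor_tmul]
    generalize comul (R := k) c = y
    induction y with
    | zero => simp
    | add x y hx hy => simp only [map_add, TensorProduct.add_tmul, hx, hy]
    | tmul c e => simp only [LinearMap.lTensor_tmul, TensorProduct.assoc_tmul]; rfl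
  central c d a := by
    -- Acting by `a` on `c ⊗ (d ⊗ 1)` yields exactly the double twist of `c ⊗ (d ⊗ a)`.
    have h : Cofree.ofTensor D (D.Cofree A) (LinearMap.lTensor C (Cofree.ofTensor D A).toLinearMap
        (D.twist2 (c ⊗ₜ (d ⊗ₜ a)))) =
        MulOpposite.op a • Cofree.ofTensor D (D.Cofree A) (c ⊗ₜ Cofree.ofTensor D A (d ⊗ₜ 1)) := by
      have h1 : rightOrbit k A (1 : A) = LinearMap.id := by ext; simp
      rw [Cofree.smul_ofTensor, MulOpposite.unop_op, tensorRightAction_tmul]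
      simp only [twist2, LinearMap.comp_apply, LinearEquiv.coe_coe,
          TensorProduct.leftComm_tmul, LinearMap.lTensor_tmul]
      generalize D.twist (c ⊗ₜ a) = z
      induction z with
      | zero => simp
      | add x y hx hy => simp only [map_add, TensorProduct.tmul_add, hx, hy]
      | tmul c a => simp [Cofree.smul_ofTensor, tensorRightAction_tmul, h1]
    have h2 := congrArg (Cofree.proj D A ∘ₗ ν.appCofree A) h
    rw [map_smul] at h2
    rw [← projApp_eq]
    exact h2
  total c := by
    have h := congrArg (Cofree.proj D A) (ν.appCofree_retract (Cofree.ofTensor D A (c ⊗ₜ 1)))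
    rw [Cofree.coact_ofTensor, Cofree.proj_ofTensor] at h
    have h1 : ν.projApp A (TensorProduct.assoc k C C A (comul c ⊗ₜ 1)) =
        algebraMap k A (counit c) := by
      refine Eq.trans ?_ (h.trans ?_)
      · rfl
      · simp [Algebra.algebraMap_eq_smul_one]
    rw [← h1, projApp_eq]
    generalize comul (R := k) c = y
    induction y with
    | zero => simp
    | add x y hx hy => simp only [map_add, TensorProduct.add_tmul, hx, hy]
    | tmul d e => simp

end NaturalRetraction

theorem isSeparableFunctor_forget_iff (D : DoiHopfDatum k L A C) :
    IsSeparableFunctor (DoiHopfModule.forget.{w} D) ↔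
      ∃ θ : C →ₗ[k] C →ₗ[k] A, D.IsTotalIntegral θ :=
  (isSeparableFunctor_forget_iff_nonempty D).trans
    ⟨fun ⟨ν⟩ => ⟨ν.integral, ν.isTotalIntegral⟩, fun ⟨_, hθ⟩ => ⟨.ofIntegral hθ⟩⟩

end DoiHopfModule
end separable

/-! ### Separability elements of a ring extension. -/

section extension
variable {k R S : Type*} [CommRing k] [Ring R] [Algebra k R] [Ring S] [Algebra k S]

namespace BalancedTensor
variable (φ : R →ₐ[k] S)

/-- The class of `x ⊗ y` in `S ⊗_R S`. -/
abbrev mk : S ⊗[k] S →ₗ[k] BalancedTensor φ := (balancedRel φ).mkQ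

theorem mk_balanced (x : S) (r : R) (y : S) :
    mk φ ((x * φ r) ⊗ₜ y) = mk φ (x ⊗ₜ (φ r * y)) :=
  (Submodule.Quotient.eq _).2 (Submodule.subset_span ⟨x, r, y, rfl⟩)

theorem mk_surjective : Function.Surjective (mk φ) := Submodule.mkQ_surjective _

/-- A balanced `k`-linear map on `S ⊗ S` induces a map on `S ⊗_R S`. -/
def lift {N : Type*} [AddCommGroup N] [Module k N] (f : S ⊗[k] S →ₗ[k] N)
    (hf : ∀ x r y, f ((x * φ r) ⊗ₜ y) = f (x ⊗ₜ (φ r * y))) : BalancedTensor φ →ₗ[k] N :=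
  Submodule.liftQ _ f <| by
    rw [balancedRel, Submodule.span_le]
    rintro _ ⟨x, r, y, rfl⟩
    simp [hf]

theorem leftAct_mk (s : S) (z : S ⊗[k] S) :
    leftAct φ s (mk φ z) = mk φ (LinearMap.rTensor S (LinearMap.mulLeft k s) z) := rfl

theorem rightAct_mk (s : S) (z : S ⊗[k] S) :
    rightAct φ s (mk φ z) = mk φ (LinearMap.lTensor S (LinearMap.mulRight k s) z) := rfl

theorem mult_mk (z : S ⊗[k] S) : mult φ (mk φ z) = LinearMap.mul' k S z := rfl

theorem leftAct_mul (s t : S) (e : BalancedTensor φ) :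
    leftAct φ (s * t) e = leftAct φ s (leftAct φ t e) := by
  obtain ⟨z, rfl⟩ := mk_surjective φ e
  rw [leftAct_mk, leftAct_mk, leftAct_mk, ← LinearMap.comp_apply (f := LinearMap.rTensor S _),
    ← LinearMap.rTensor_comp, LinearMap.mulLeft_mul]

theorem rightAct_mul (s t : S) (e : BalancedTensor φ) :
    rightAct φ (s * t) e = rightAct φ t (rightAct φ s e) := by
  obtain ⟨z, rfl⟩ := mk_surjective φ e
  rw [rightAct_mk, rightAct_mk, rightAct_mk, ← LinearMap.comp_apply (f := LinearMap.lTensor S _),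
    ← LinearMap.lTensor_comp, LinearMap.mulRight_mul]

theorem leftAct_rightAct (s t : S) (e : BalancedTensor φ) :
    leftAct φ s (rightAct φ t e) = rightAct φ t (leftAct φ s e) := by
  obtain ⟨z, rfl⟩ := mk_surjective φ e
  rw [rightAct_mk, leftAct_mk, leftAct_mk, rightAct_mk,
    ← LinearMap.comp_apply (f := LinearMap.rTensor S _),
    ← LinearMap.comp_apply (f := LinearMap.lTensor S _), LinearMap.rTensor_comp_lTensor,
    LinearMap.lTensor_comp_rTensor]

theorem leftAct_add (s t : S) (e : BalancedTensor φ) :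
    leftAct φ (s + t) e = leftAct φ s e + leftAct φ t e := by
  obtain ⟨z, rfl⟩ := mk_surjective φ e
  have : LinearMap.mulLeft k (s + t) = LinearMap.mulLeft k s + LinearMap.mulLeft k t := by
    ext; simp [add_mul]
  simp only [leftAct_mk, this, LinearMap.rTensor_add, LinearMap.add_apply, map_add]

theorem rightAct_add (s t : S) (e : BalancedTensor φ) :
    rightAct φ (s + t) e = rightAct φ s e + rightAct φ t e := by
  obtain ⟨z, rfl⟩ := mk_surjective φ e
  have : LinearMap.mulRight k (s + t) = LinearMap.mulRight k s + LinearMap.mulRight k t := by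
    ext; simp [mul_add]
  simp only [rightAct_mk, this, LinearMap.lTensor_add, LinearMap.add_apply, map_add]

theorem leftAct_smul (r : k) (s : S) (e : BalancedTensor φ) :
    leftAct φ (r • s) e = r • leftAct φ s e := by
  obtain ⟨z, rfl⟩ := mk_surjective φ e
  have : LinearMap.mulLeft k (r • s) = r • LinearMap.mulLeft k s := by
    ext; simp
  simp only [leftAct_mk, this, LinearMap.rTensor_smul, LinearMap.smul_apply, map_smul]

theorem leftAct_one (e : BalancedTensor φ) : leftAct φ 1 e = e := by
  obtain ⟨z, rfl⟩ := mk_surjective φ e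
  rw [leftAct_mk, LinearMap.mulLeft_one, LinearMap.rTensor_id, LinearMap.id_apply]

theorem rightAct_one (e : BalancedTensor φ) : rightAct φ 1 e = e := by
  obtain ⟨z, rfl⟩ := mk_surjective φ e
  rw [rightAct_mk, LinearMap.mulRight_one, LinearMap.lTensor_id, LinearMap.id_apply]

theorem mult_leftAct (s : S) (e : BalancedTensor φ) :
    mult φ (leftAct φ s e) = s * mult φ e := by
  obtain ⟨z, rfl⟩ := mk_surjective φ e
  rw [leftAct_mk, mult_mk, mult_mk]
  induction z with
  | zero => simp
  | add x y hx hy => simp only [map_add, mul_add, hx, hy]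
  | tmul x y => simp [mul_assoc]

/-- A separability element of a ring extension. -/
structure IsSeparabilityElement (e : BalancedTensor φ) : Prop where
  comm : ∀ s, leftAct φ s e = rightAct φ s e
  mult_eq_one : mult φ e = 1

end BalancedTensor

open BalancedTensor in
-- A bimodule section is determined by `e = σ(1)`, through `σ(x) = x e`; commutation of `e` with `S`
-- is what makes this formula a bimodule map.
theorem isSeparableExtension_iff (φ : R →ₐ[k] S) :
    IsSeparableExtension φ ↔ ∃ e, IsSeparabilityElement φ e := by
  constructor
  · rintro ⟨σ, hσ, hm⟩
    refine ⟨σ 1, fun s => ?_, hm 1⟩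
    have h1 := hσ s 1 1
    have h2 := hσ 1 s 1
    rw [rightAct_one] at h1
    rw [leftAct_one] at h2
    rw [← h1, ← h2]
    simp
  · rintro ⟨e, he, hm⟩
    refine ⟨{ toFun := fun x => leftAct φ x e
              map_add' := fun x y => leftAct_add φ x y e
              map_smul' := fun r x => leftAct_smul φ r x e }, fun s t x => ?_, fun x => ?_⟩
    · change leftAct φ (s * x * t) e = leftAct φ s (rightAct φ t (leftAct φ x e))
      rw [leftAct_mul, leftAct_mul, he t, leftAct_rightAct]
    · exact (mult_leftAct φ x e).trans (by rw [hm, mul_one])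

end extension

/-! ### The duality `C* ⊗ B ≅ Hom(C, B)` for finitely generated projective `C`. -/

section convTensorHom

/-- `f ⊗ b ↦ (c ↦ f c • b)`. -/
noncomputable def convTensorHom (k C B : Type*) [CommRing k] [AddCommGroup C] [Module k C]
    [AddCommGroup B] [Module k B] : WithConv (C →ₗ[k] k) ⊗[k] B →ₗ[k] C →ₗ[k] B :=
  dualTensorHom k C B ∘ₗ LinearMap.rTensor B (WithConv.linearEquiv k (C →ₗ[k] k)).toLinearMap

variable {k A B C : Type*} [CommRing k] [Ring A] [Algebra k A] [AddCommGroup C] [Module k C]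
  [AddCommGroup B] [Module k B]

@[simp] theorem convTensorHom_tmul (f : WithConv (C →ₗ[k] k)) (b : B) (c : C) :
    convTensorHom k C B (f ⊗ₜ b) c = f.ofConv c • b := rfl

theorem convTensorHom_bijective [Module.Finite k C] [Module.Projective k C] :
    Function.Bijective (convTensorHom k C B) :=
  (dualTensorHom_bijective (R := k) (M := C) (N := B)).comp
    (LinearEquiv.rTensor B (WithConv.linearEquiv k (C →ₗ[k] k))).bijective
theorem SmashProduct.tensorToHom_eq : SmashProduct.tensorToHom k A C =
    convTensorHom k C A ∘ₗ (TensorProduct.comm k A (WithConv (C →ₗ[k] k))).toLinearMap := by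
  ext a f c
  simp

end convTensorHom

section smashExtension
variable {k L A C : Type*} [CommRing k] [Ring L] [Bialgebra k L] [Ring A] [Algebra k A]
  [AddCommGroup C] [Module k C] [Coalgebra k C] (D : DoiHopfDatum k L A C)

namespace SmashProduct
open DoiHopfDatum BalancedTensor

/-- The map is multiplicative by construction, so only linear bijectivity is needed; up to swapping
the factors, the underlying map is `C* ⊗ A → Hom(C, A)`. -/
theorem toKoppinen_bijective [Module.Finite k C] [Module.Projective k C] :
    Function.Bijective (toKoppinen D) := by
  have h : Function.Bijective (tensorToHom k A C) := by
    rw [tensorToHom_eq]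
    exact convTensorHom_bijective.comp
      (TensorProduct.comm k A (WithConv (C →ₗ[k] k))).bijective
  exact h

end SmashProduct
end smashExtension

/-! ### Separability of `A → A # C*` in terms of total integrals. -/

section smashSeparable
variable {k L A C : Type*} [CommRing k] [Ring L] [Bialgebra k L] [Ring A] [Algebra k A]
  [AddCommGroup C] [Module k C] [Coalgebra k C] (D : DoiHopfDatum k L A C)

namespace SmashProduct
open DoiHopfDatum BalancedTensor

/-- In this order no twist occurs. Thus `A # C*` is `C* ⊗ A` as a right `A`-module, and it is
generated as an algebra by `C*` and `A`. -/
theorem inclusionDual_mul_inclusion (f : WithConv (C →ₗ[k] k)) (a : A) :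
    inclusionDual D f * inclusion D a = (toTensor D).symm (a ⊗ₜ f) := by
  apply (toTensor D).injective
  rw [toTensor_mul, LinearEquiv.apply_symm_apply]
  change mulMap D ((1 ⊗ₜ f) ⊗ₜ (a ⊗ₜ 1)) = _
  simp [mulMap_tmul, cotwist_one_left, sandwich]

theorem inclusion_mul_inclusionDual (a : A) (f : WithConv (C →ₗ[k] k)) :
    inclusion D a * inclusionDual D f = (toTensor D).symm (D.cotwist (a ⊗ₜ f)) := by
  apply (toTensor D).injective
  rw [toTensor_mul, LinearEquiv.apply_symm_apply]
  change mulMap D ((a ⊗ₜ 1) ⊗ₜ (1 ⊗ₜ f)) = _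
  have : sandwich (1 : WithConv (C →ₗ[k] k)) (1 : A) = LinearMap.id := by
    rw [sandwich, LinearMap.mulRight_one, LinearMap.mulLeft_one, TensorProduct.map_id]
  rw [mulMap_tmul, this, LinearMap.id_apply]

theorem toTensor_mul_inclusion (x : SmashProduct D) (a : A) :
    toTensor D (x * inclusion D a) = LinearMap.rTensor _ (LinearMap.mulRight k a) (toTensor D x) := by
  rw [toTensor_mul]
  change mulMap D (toTensor D x ⊗ₜ (a ⊗ₜ 1)) = _
  generalize toTensor D x = z
  induction z with
  | zero => simp
  | add x y hx hy => simp only [map_add, TensorProduct.add_tmul, hx, hy]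
  | tmul b f => simp [mulMap_tmul, cotwist_one_right, sandwich]

/-- `(a ⊗ f) ⊗ b ↦ f ⊗ a b`. -/
noncomputable def pullLeft : (A ⊗[k] WithConv (C →ₗ[k] k)) ⊗[k] SmashProduct D →ₗ[k]
    WithConv (C →ₗ[k] k) ⊗[k] SmashProduct D :=
  LinearMap.lTensor _ (LinearMap.mul' k (SmashProduct D) ∘ₗ
    LinearMap.rTensor _ (inclusion D).toLinearMap) ∘ₗ
    (TensorProduct.assoc k _ _ _).toLinearMap ∘ₗ
    LinearMap.rTensor _ (TensorProduct.comm k A _).toLinearMap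

@[simp] theorem pullLeft_tmul (a : A) (f : WithConv (C →ₗ[k] k)) (b : SmashProduct D) :
    pullLeft D ((a ⊗ₜ f) ⊗ₜ b) = f ⊗ₜ (inclusion D a * b) := by
  simp [pullLeft]

/-- `f ⊗ b ↦ (1 # f) ⊗ b`, from `C* ⊗ (A # C*)` to the tensor square of `A # C*` over `A`. -/
noncomputable def toBalanced : WithConv (C →ₗ[k] k) ⊗[k] SmashProduct D →ₗ[k]
    BalancedTensor (inclusion D) :=
  BalancedTensor.mk (inclusion D) ∘ₗ LinearMap.rTensor _ (inclusionDual D).toLinearMap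

theorem toBalanced_pullLeft (x b : SmashProduct D) :
    toBalanced D (pullLeft D (toTensor D x ⊗ₜ b)) = BalancedTensor.mk (inclusion D) (x ⊗ₜ b) := by
  obtain ⟨x, rfl⟩ := (toTensor D).symm.surjective x
  rw [LinearEquiv.apply_symm_apply]
  induction x with
  | zero => simp
  | add x y hx hy => simp only [map_add, TensorProduct.add_tmul, hx, hy]
  | tmul a f =>
    rw [← inclusionDual_mul_inclusion, mk_balanced, pullLeft_tmul]
    rfl

/-- Moving the `A`-part of the left factor across the balanced tensor sign gives the inverse:
`pullLeft` is balanced, so it descends to `S ⊗_A S`, where `S = A # C*`. -/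
theorem toBalanced_bijective : Function.Bijective (toBalanced D) := by
  constructor
  · have h (x : SmashProduct D) (a : A) (y : SmashProduct D) :
        pullLeft D (toTensor D (x * inclusion D a) ⊗ₜ y) =
          pullLeft D (toTensor D x ⊗ₜ (inclusion D a * y)) := by
      rw [toTensor_mul_inclusion]
      generalize toTensor D x = z
      induction z with
      | zero => simp
      | add x z hx hz => simp only [map_add, TensorProduct.add_tmul, hx, hz]
      | tmul b f => simp [mul_assoc]
    let p : SmashProduct D ⊗[k] SmashProduct D →ₗ[k] WithConv (C →ₗ[k] k) ⊗[k] SmashProduct D :=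
      pullLeft D ∘ₗ LinearMap.rTensor (SmashProduct D) (toTensor D).toLinearMap
    let Φ := BalancedTensor.lift (N := WithConv (C →ₗ[k] k) ⊗[k] SmashProduct D) (inclusion D) p h
    have h' : Φ ∘ₗ toBalanced D = LinearMap.id := by
      ext f b
      change pullLeft D ((1 ⊗ₜ f) ⊗ₜ b) = f ⊗ₜ b
      simp
    exact Function.LeftInverse.injective (g := Φ) (LinearMap.congr_fun h')
  · intro e
    obtain ⟨z, rfl⟩ := mk_surjective _ e
    induction z with
    | zero => exact ⟨0, by simp⟩
    | add x y hx hy =>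
      obtain ⟨s, hs⟩ := hx
      obtain ⟨t, ht⟩ := hy
      exact ⟨s + t, by rw [map_add, map_add, hs, ht]⟩
    | tmul x b => exact ⟨_, toBalanced_pullLeft D x b⟩

variable (t : WithConv (C →ₗ[k] k) ⊗[k] SmashProduct D)

theorem leftAct_inclusionDual (f : WithConv (C →ₗ[k] k)) :
    leftAct (inclusion D) (inclusionDual D f) (toBalanced D t) =
      toBalanced D (LinearMap.rTensor _ (LinearMap.mulLeft k f) t) := by
  induction t with
  | zero => simp
  | add x y hx hy => simp only [map_add, hx, hy]
  | tmul g b =>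
    rw [toBalanced, LinearMap.comp_apply, LinearMap.comp_apply, leftAct_mk]
    simp

theorem rightAct_toBalanced (b : SmashProduct D) :
    rightAct (inclusion D) b (toBalanced D t) =
      toBalanced D (LinearMap.lTensor _ (LinearMap.mulRight k b) t) := by
  induction t with
  | zero => simp
  | add x y hx hy => simp only [map_add, hx, hy]
  | tmul g b =>
    rw [toBalanced, LinearMap.comp_apply, LinearMap.comp_apply, rightAct_mk]
    simp

/-- `g ⊗ b ↦ ∑ g' ⊗ a' b`, where `(a # ε)(1 # g) = ∑ a' # g'`. -/
noncomputable def cotwistAct (a : A) : WithConv (C →ₗ[k] k) ⊗[k] SmashProduct D →ₗ[k]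
    WithConv (C →ₗ[k] k) ⊗[k] SmashProduct D :=
  pullLeft D ∘ₗ LinearMap.rTensor _ (D.cotwist ∘ₗ TensorProduct.mk k A _ a)

/-- Moving `a` past `1 # g` costs a `cotwist`; the resulting `A`-part is then pulled across the
tensor sign. -/
theorem leftAct_inclusion (a : A) :
    leftAct (inclusion D) (inclusion D a) (toBalanced D t) = toBalanced D (cotwistAct D a t) := by
  induction t with
  | zero => simp
  | add x y hx hy => simp only [map_add, hx, hy]
  | tmul g b =>
    have h := toBalanced_pullLeft D (inclusion D a * inclusionDual D g) b
    rw [inclusion_mul_inclusionDual, LinearEquiv.apply_symm_apply] at h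
    refine Eq.trans ?_ h.symm
    rw [← inclusion_mul_inclusionDual]
    rfl

/-- Since `(f * g)(c) = ∑ f(c₁) g(c₂)`, convolution by `f` on the left is precomposition with `c ↦ ∑
f(c₁) c₂`: the left side of dual linearity. -/
theorem convTensorHom_mulLeft (f : WithConv (C →ₗ[k] k)) (c : C) :
    convTensorHom k C _ (LinearMap.rTensor _ (LinearMap.mulLeft k f) t) c =
      convTensorHom k C _ t (TensorProduct.lid k C (LinearMap.rTensor C f.ofConv (comul c))) := by
  induction t with
  | zero => simp
  | add x y hx hy => simp only [map_add, LinearMap.add_apply, hx, hy]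
  | tmul g b =>
    simp only [LinearMap.rTensor_tmul, convTensorHom_tmul, LinearMap.mulLeft_apply]
    congr 1
    change (f * g) c = _
    rw [LinearMap.convMul_apply]
    generalize comul (R := k) c = y
    induction y with
    | zero => simp
    | add x y hx hy => simp only [map_add, hx, hy]
    | tmul d e => simp

theorem convTensorHom_mulRight (b : SmashProduct D) (c : C) :
    convTensorHom k C _ (LinearMap.lTensor _ (LinearMap.mulRight k b) t) c =
      convTensorHom k C _ t c * b := by
  induction t with
  | zero => simp
  | add x y hx hy => simp only [map_add, LinearMap.add_apply, add_mul, hx, hy]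
  | tmul g b => simp

/-- `cotwist` is the transpose of `twist`, because `(a₋₁·g)(c) = g(c·a₋₁)`. This produces the left
side of the centrality condition. -/
theorem convTensorHom_cotwistAct (a : A) (c : C) :
    convTensorHom k C _ (cotwistAct D a t) c =
      Koppinen.smulLift (inclusion D) (convTensorHom k C _ t) (D.twist (c ⊗ₜ a)) := by
  induction t with
  | zero =>
    have (z : C ⊗[k] A) : Koppinen.smulLift (inclusion D) 0 z = 0 := by
      induction z with
      | zero => simp
      | add x y hx hy => simp only [map_add, hx, hy, add_zero]
      | tmul d e => simp
    simp [this]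
  | add x y hx hy =>
    have (γ γ' : C →ₗ[k] SmashProduct D) (z : C ⊗[k] A) :
        Koppinen.smulLift (inclusion D) (γ + γ') z =
        Koppinen.smulLift (inclusion D) γ z + Koppinen.smulLift (inclusion D) γ' z := by
      induction z with
      | zero => simp
      | add x y hx hy => rw [map_add, map_add, map_add, hx, hy]; abel
      | tmul d e => simp [mul_add]
    simp only [map_add, LinearMap.add_apply, hx, hy, this]
  | tmul g b =>
    simp only [cotwistAct, LinearMap.comp_apply, LinearMap.rTensor_tmul, TensorProduct.mk_apply,
      cotwist, twist, LinearEquiv.coe_coe, LinearMap.lTensor_tmul]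
    generalize D.coaction.toLinearMap a = w
    induction w with
    | zero => simp
    | add x y hx hy =>
      simp only [map_add, TensorProduct.add_tmul, TensorProduct.tmul_add, LinearMap.add_apply,
        hx, hy]
    | tmul x a => simp

/-- The product of `1 # g` and `b`, read in `#(C, A)`, takes the value `∑ g(c₁) b(c₂)` at `c`, which
is `∑ γ(c₁)(c₂)` for the corresponding `γ`. -/
theorem toHom_mult_toBalanced (c : C) :
    Koppinen.toHom D (toKoppinen D (mult (inclusion D) (toBalanced D t))) c =
      TensorProduct.lift ((Koppinen.toHom D).toLinearMap ∘ₗ (toKoppinen D).toLinearMap ∘ₗ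
        convTensorHom k C _ t) (comul c) := by
  induction t with
  | zero =>
    have : TensorProduct.lift (0 : C →ₗ[k] C →ₗ[k] A) = 0 := by ext; simp
    simp [this]
  | add x y hx hy =>
    simp only [map_add, LinearMap.add_apply, hx, hy]
    rw [← LinearMap.add_apply]
    congr 1
    ext; simp
  | tmul g b =>
    rw [toBalanced, LinearMap.comp_apply, LinearMap.rTensor_tmul, mult_mk, LinearMap.mul'_apply,
      map_mul]
    refine (Koppinen.toHom_inclusionDual_mul D g _ c).trans ?_
    generalize comul (R := k) c = y
    induction y with
    | zero => simp
    | add x y hx hy => simp only [map_add, hx, hy]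
    | tmul d e => simp

/-- Commutation with `C*`, commutation with `A` and the product being `1` become the three
conditions on `γ`. The two injectivity hypotheses serve the converse, where identities between
functions into `#(C, A)` are lifted back to tensors. -/
theorem isSeparabilityElement_toBalanced_iff (hD : Function.Injective (toKoppinen D))
    (hC : Function.Injective (convTensorHom k C (SmashProduct D))) :
    IsSeparabilityElement (inclusion D) (toBalanced D t) ↔
      Koppinen.IsTotalIntegral D ((toKoppinen D).toLinearMap ∘ₗ convTensorHom k C _ t) := by
  have hsm (z : C ⊗[k] A) : Koppinen.smulLift ((toKoppinen D).comp (inclusion D))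
      ((toKoppinen D).toLinearMap ∘ₗ convTensorHom k C _ t) z =
      toKoppinen D (Koppinen.smulLift (inclusion D) (convTensorHom k C _ t) z) := by
    induction z with
    | zero => simp
    | add x y hx hy => simp only [map_add, hx, hy]
    | tmul c a => simp
  constructor
  · rintro ⟨hc, hm⟩
    refine ⟨fun c f => ?_, fun a c => ?_, fun c => ?_⟩
    · have h := hc (inclusionDual D f)
      rw [leftAct_inclusionDual, rightAct_toBalanced] at h
      have h' := LinearMap.congr_fun (congrArg (convTensorHom k C _)
        ((toBalanced_bijective D).1 h)) c
      rw [convTensorHom_mulLeft, convTensorHom_mulRight] at h'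
      simp only [LinearMap.comp_apply, AlgHom.toLinearMap_apply, ← map_mul]
      rw [h']
    · have h := hc (inclusion D a)
      rw [leftAct_inclusion, rightAct_toBalanced] at h
      have h' := LinearMap.congr_fun (congrArg (convTensorHom k C _)
        ((toBalanced_bijective D).1 h)) c
      rw [convTensorHom_cotwistAct, convTensorHom_mulRight] at h'
      rw [hsm, h', map_mul]
      rfl
    · rw [← toHom_mult_toBalanced, hm, map_one]
      rfl
  · intro h
    have hdual (f : WithConv (C →ₗ[k] k)) :
        leftAct (inclusion D) (inclusionDual D f) (toBalanced D t) =
          rightAct (inclusion D) (inclusionDual D f) (toBalanced D t) := by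
      rw [leftAct_inclusionDual, rightAct_toBalanced]
      congr 1
      refine hC (LinearMap.ext fun c => hD ?_)
      rw [convTensorHom_mulLeft, convTensorHom_mulRight, map_mul]
      exact h.dual_linear c f
    have hincl (a : A) : leftAct (inclusion D) (inclusion D a) (toBalanced D t) =
          rightAct (inclusion D) (inclusion D a) (toBalanced D t) := by
      rw [leftAct_inclusion, rightAct_toBalanced]
      congr 1
      refine hC (LinearMap.ext fun c => hD ?_)
      rw [convTensorHom_cotwistAct, convTensorHom_mulRight, map_mul, ← hsm]
      exact h.central a c
    refine ⟨fun s => ?_, hD ((Koppinen.toHom D).injective (LinearMap.ext fun c => ?_))⟩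
    -- Sums of products `(1 # f)(a # ε)` exhaust the algebra, and the two actions commute with each
    -- other, so commutation with the generators suffices.
    · obtain ⟨s, rfl⟩ := (toTensor D).symm.surjective s
      induction s with
      | zero =>
        have h1 := leftAct_smul (inclusion D) 0 0 (toBalanced D t)
        have h2 := rightAct_add (inclusion D) 0 0 (toBalanced D t)
        rw [zero_smul, zero_smul] at h1
        rw [add_zero, left_eq_add] at h2
        rw [map_zero, h1, h2]
      | add x y hx hy => rw [map_add, leftAct_add, rightAct_add, hx, hy]
      | tmul a f =>
        rw [← inclusionDual_mul_inclusion, leftAct_mul, rightAct_mul, hincl, leftAct_rightAct,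
          hdual]
    · rw [toHom_mult_toBalanced, map_one]
      exact h.total c

theorem isSeparableExtension_inclusion_iff [Module.Finite k C] [Module.Projective k C] :
    IsSeparableExtension (inclusion D) ↔ ∃ γ, Koppinen.IsTotalIntegral D γ := by
  have hC := convTensorHom_bijective (k := k) (C := C) (B := SmashProduct D)
  rw [isSeparableExtension_iff]
  constructor
  · rintro ⟨e, he⟩
    obtain ⟨t, rfl⟩ := (toBalanced_bijective D).2 e
    exact ⟨_, (isSeparabilityElement_toBalanced_iff D t (toKoppinen_bijective D).1 hC.1).1 he⟩
  · rintro ⟨γ, hγ⟩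
    let τ := LinearEquiv.ofBijective (toKoppinen D).toLinearMap (toKoppinen_bijective D)
    obtain ⟨t, ht⟩ := hC.2 (τ.symm.toLinearMap ∘ₗ γ)
    refine ⟨toBalanced D t,
      (isSeparabilityElement_toBalanced_iff D t (toKoppinen_bijective D).1 hC.1).2 ?_⟩
    rw [ht]
    convert hγ
    ext c
    exact τ.apply_symm_apply (γ c)

end SmashProduct
end smashSeparable

/-! ### Bijectivity of the antipode through the Hopf module `H*`. -/

section antipodeBijective
open HopfAlgebra

variable {k H : Type*} [CommRing k] [Ring H] [HopfAlgebra k H]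

namespace DualHopfModule

/-- `T f x = ∑ f(x₂) x₁`. -/
noncomputable def translate : Module.Dual k H →ₗ[k] H →ₗ[k] H :=
  LinearMap.mk₂ k (fun f x => TensorProduct.rid k H (LinearMap.lTensor H f (comul x)))
    (fun f g x => by simp [LinearMap.lTensor_add]) (fun r f x => by simp [LinearMap.lTensor_smul])
    (fun f x y => by simp) (fun r f x => by simp)

theorem translate_apply (f : Module.Dual k H) (x : H) :
    translate f x = TensorProduct.rid k H (LinearMap.lTensor H f (comul x)) := rfl

/-- The right action `f ⊗ h ↦ f (? S(h))` of `H` on `H*`. -/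
noncomputable def act : Module.Dual k H ⊗[k] H →ₗ[k] Module.Dual k H :=
  TensorProduct.lift (LinearMap.mk₂ k (fun f h => f ∘ₗ LinearMap.mulRight k (antipode k h))
    (fun f g h => by ext; simp) (fun r f h => by ext; simp)
    (fun f g h => by ext; simp [mul_add]) (fun r f h => by ext; simp))

@[simp] theorem act_tmul_apply (f : Module.Dual k H) (h x : H) :
    act (f ⊗ₜ h) x = f (x * antipode k h) := rfl

theorem act_act (f : Module.Dual k H) (a b : H) :
    act (act (f ⊗ₜ a) ⊗ₜ b) = act (f ⊗ₜ[k] (a * b)) := by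
  ext x
  simp [antipode_mul_antidistrib, mul_assoc]

theorem act_one (f : Module.Dual k H) : act (f ⊗ₜ[k] (1 : H)) = f := by
  ext x
  simp

/-- `a ⊗ b ↦ T_f(x S(a)) b`. -/
noncomputable def translateMul (f : Module.Dual k H) (x : H) : H ⊗[k] H →ₗ[k] H :=
  LinearMap.mul' k H ∘ₗ
    LinearMap.rTensor H (translate f ∘ₗ LinearMap.mulLeft k x ∘ₗ antipode k)

/-- The Hopf module compatibility `ρ(f·h) = ∑ f₀·h₁ ⊗ f₁ h₂`, in a form needing no finiteness. As
`Δ(S(h₁)) = ∑ S(h₁₂) ⊗ S(h₁₁)`, the right side is `∑ f(x₂ S(h₁)) x₁ S(h₂) h₃`, and the last two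
factors cancel. -/
theorem translate_act (f : Module.Dual k H) (h x : H) :
    translate (act (f ⊗ₜ h)) x = translateMul f x (comul h) := by
  let E : H ⊗[k] H →ₗ[k] H := (TensorProduct.rid k H).toLinearMap ∘ₗ LinearMap.lTensor H f
  -- `Δ(x)` is generalized to an arbitrary `X`, so that it may be split into pure tensors.
  have hX (X : H ⊗[k] H) : LinearMap.mul' k H (LinearMap.rTensor H (E ∘ₗ LinearMap.mulLeft k X ∘ₗ
      comul ∘ₗ antipode k) (comul h)) = E (X * 1 ⊗ₜ antipode k h) := by
    induction X with
    | zero => simp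
    | add X Y hX hY =>
      have : LinearMap.mulLeft k (X + Y) = LinearMap.mulLeft k X + LinearMap.mulLeft k Y := by
        ext; simp [add_mul]
      rw [add_mul, map_add, ← hX, ← hY, this]
      simp only [LinearMap.add_comp, LinearMap.comp_add, LinearMap.rTensor_add,
        LinearMap.add_apply, map_add]
    | tmul u v =>
      let W : H ⊗[k] (H ⊗[k] H) →ₗ[k] H := LinearMap.mulLeft k u ∘ₗ
        (TensorProduct.lid k H).toLinearMap ∘ₗ
        TensorProduct.map (f ∘ₗ LinearMap.mulLeft k v ∘ₗ antipode k)
          (LinearMap.mul' k H ∘ₗ LinearMap.rTensor H (antipode k))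
      have h1 (z : H ⊗[k] H) : LinearMap.mul' k H (LinearMap.rTensor H (E ∘ₗ
          LinearMap.mulLeft k (u ⊗ₜ v) ∘ₗ comul ∘ₗ antipode k) z) =
          W (TensorProduct.assoc k H H H (LinearMap.rTensor H comul z)) := by
        induction z with
        | zero => simp
        | add x y hx hy => simp only [map_add, hx, hy]
        | tmul a b =>
          rw [comul_comp_antipode]
          simp only [LinearMap.rTensor_tmul, LinearMap.comp_apply]
          generalize comul (R := k) a = y
          induction y with
          | zero => simp
          | add x y hx hy => simp only [map_add, TensorProduct.add_tmul, hx, hy]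
          | tmul c d => simp [E, W, mul_assoc]
      have h2 (z : H ⊗[k] H) : W (LinearMap.lTensor H comul z) =
          E (u ⊗ₜ (v * antipode k (TensorProduct.rid k H (LinearMap.lTensor H counit z)))) := by
        induction z with
        | zero => simp
        | add x y hx hy => simp only [map_add, mul_add, TensorProduct.tmul_add, hx, hy]
        | tmul a b =>
          simp only [W, LinearMap.lTensor_tmul, LinearMap.comp_apply, TensorProduct.map_tmul,
            mul_antipode_rTensor_comul_apply]
          simp [E, Algebra.algebraMap_eq_smul_one, smul_smul]
      rw [h1, coassoc_apply, h2]
      simp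
  have h3 := hX (comul x)
  have h4 : E ∘ₗ LinearMap.mulLeft k (comul x) ∘ₗ comul ∘ₗ antipode k =
      translate f ∘ₗ LinearMap.mulLeft k x ∘ₗ antipode k := by
    ext y
    simp [translate_apply, E]
  rw [h4] at h3
  refine Eq.trans ?_ h3.symm
  rw [translate_apply]
  generalize comul (R := k) x = X
  induction X with
  | zero => simp
  | add x y hx hy => simp only [map_add, add_mul, hx, hy]
  | tmul c d => simp [E]

variable [Module.Finite k H] [Module.Projective k H]

/-- The coaction `f ↦ ∑ f₀ ⊗ f₁` on `H*`, with `∑ f₀(x) f₁ = ∑ f(x₂) x₁`. -/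
noncomputable def coact : Module.Dual k H →ₗ[k] Module.Dual k H ⊗[k] H :=
  (LinearEquiv.ofBijective _ (dualTensorHom_bijective (R := k) (M := H) (N := H))).symm.toLinearMap ∘ₗ
    translate

theorem dualTensorHom_coact (f : Module.Dual k H) :
    dualTensorHom k H H (coact f) = translate f :=
  (LinearEquiv.ofBijective _
    (dualTensorHom_bijective (R := k) (M := H) (N := H))).apply_symm_apply _

/-- Under `dualTensorHom` both sides, evaluated at `x`, become `∑ f(x₃) x₁ ⊗ x₂`. -/
theorem coact_coassoc (f : Module.Dual k H) :
    TensorProduct.assoc k _ H H (LinearMap.rTensor H coact (coact f)) =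
      LinearMap.lTensor _ comul (coact f) := by
  apply (dualTensorHom_bijective (R := k) (M := H) (N := H ⊗[k] H)).1
  ext x
  have h1 (w : Module.Dual k H ⊗[k] H) : dualTensorHom k H (H ⊗[k] H)
      (TensorProduct.assoc k _ H H (LinearMap.rTensor H coact w)) x =
      LinearMap.lTensor H (dualTensorHom k H H w) (comul x) := by
    induction w with
    | zero => simp
    | add x y hx hy => simp only [map_add, LinearMap.add_apply, hx, hy, LinearMap.lTensor_add]
    | tmul g b =>
      have h2 (z : Module.Dual k H ⊗[k] H) : dualTensorHom k H (H ⊗[k] H)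
          (TensorProduct.assoc k _ H H (z ⊗ₜ b)) x = dualTensorHom k H H z x ⊗ₜ b := by
        induction z with
        | zero => simp
        | add x y hx hy =>
          simp only [map_add, LinearMap.add_apply, hx, hy, TensorProduct.add_tmul]
        | tmul g c => simp [TensorProduct.smul_tmul']
      rw [LinearMap.rTensor_tmul, h2, dualTensorHom_coact, translate_apply]
      generalize comul (R := k) x = y
      induction y with
      | zero => simp
      | add x y hx hy => simp only [map_add, hx, hy, TensorProduct.add_tmul]
      | tmul c d => simp [TensorProduct.smul_tmul]
  have h3 (w : Module.Dual k H ⊗[k] H) : dualTensorHom k H (H ⊗[k] H)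
      (LinearMap.lTensor _ comul w) x = comul (dualTensorHom k H H w x) := by
    induction w with
    | zero => simp
    | add x y hx hy => simp only [map_add, LinearMap.add_apply, hx, hy]
    | tmul g b => simp
  let Q : (H ⊗[k] H) ⊗[k] H →ₗ[k] H ⊗[k] H :=
    (TensorProduct.rid k (H ⊗[k] H)).toLinearMap ∘ₗ LinearMap.lTensor (H ⊗[k] H) f
  have h4 (z : H ⊗[k] H) : LinearMap.lTensor H (translate f) z =
      Q ((TensorProduct.assoc k H H H).symm (LinearMap.lTensor H comul z)) := by
    induction z with
    | zero => simp
    | add x y hx hy => simp only [map_add, hx, hy]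
    | tmul a b =>
      rw [LinearMap.lTensor_tmul, LinearMap.lTensor_tmul, translate_apply]
      generalize comul (R := k) b = y
      induction y with
      | zero => simp
      | add x y hx hy => simp only [map_add, TensorProduct.tmul_add, hx, hy]
      | tmul c d => simp [Q]
  have h5 (z : H ⊗[k] H) : comul (TensorProduct.rid k H (LinearMap.lTensor H f z)) =
      Q (LinearMap.rTensor H comul z) := by
    induction z with
    | zero => simp
    | add x y hx hy => simp only [map_add, hx, hy]
    | tmul a b => simp [Q]
  rw [h1, h3, dualTensorHom_coact, translate_apply, h4, h5, coassoc_symm_apply]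

theorem counit_coact (f : Module.Dual k H) :
    TensorProduct.rid k _ (LinearMap.lTensor _ counit (coact f)) = f := by
  ext x
  have h1 (w : Module.Dual k H ⊗[k] H) : TensorProduct.rid k _ (LinearMap.lTensor _ counit w) x =
      counit (R := k) (dualTensorHom k H H w x) := by
    induction w with
    | zero => simp
    | add x y hx hy => simp only [map_add, LinearMap.add_apply, hx, hy]
    | tmul g b => simp [mul_comm]
  have h2 (z : H ⊗[k] H) : counit (R := k) (TensorProduct.rid k H (LinearMap.lTensor H f z)) =
      f (TensorProduct.lid k H (LinearMap.rTensor H counit z)) := by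
    induction z with
    | zero => simp
    | add x y hx hy => simp only [map_add, hx, hy]
    | tmul a b => simp [mul_comm]
  rw [h1, dualTensorHom_coact, translate_apply, h2]
  simp

/-- The projection `f ↦ ∑ f₀ · S(f₁)` onto the left integrals on `H`. -/
noncomputable def toIntegral : Module.Dual k H →ₗ[k] Module.Dual k H :=
  act ∘ₗ LinearMap.lTensor _ (antipode k) ∘ₗ coact

/-- The generation half of the fundamental theorem of Hopf modules: `∑ f₀ · S(f₁) f₂ = f`. Every
functional is thus a combination of integrals acted on by `H`. -/
theorem act_toIntegral (f : Module.Dual k H) :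
    act (LinearMap.rTensor H toIntegral (coact f)) = f := by
  let m : H ⊗[k] H →ₗ[k] H := LinearMap.mul' k H ∘ₗ LinearMap.rTensor H (antipode k)
  have h1 (w : Module.Dual k H ⊗[k] H) : act (LinearMap.rTensor H toIntegral w) =
      act (LinearMap.lTensor _ m (TensorProduct.assoc k _ H H (LinearMap.rTensor H coact w))) := by
    induction w with
    | zero => simp
    | add x y hx hy => simp only [map_add, hx, hy]
    | tmul g b =>
      rw [LinearMap.rTensor_tmul, LinearMap.rTensor_tmul, toIntegral]
      simp only [LinearMap.comp_apply]
      generalize coact g = q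
      induction q with
      | zero => simp
      | add x y hx hy => simp only [map_add, TensorProduct.add_tmul, hx, hy]
      | tmul g a => rw [LinearMap.lTensor_tmul, act_act]; simp [m]
  have h2 (w : Module.Dual k H ⊗[k] H) : act (LinearMap.lTensor _ m (LinearMap.lTensor _ comul w)) =
      TensorProduct.rid k _ (LinearMap.lTensor _ counit w) := by
    induction w with
    | zero => simp
    | add x y hx hy => simp only [map_add, hx, hy]
    | tmul g b =>
      simp only [m, LinearMap.lTensor_tmul, LinearMap.comp_apply,
        mul_antipode_rTensor_comul_apply, Algebra.algebraMap_eq_smul_one]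
      rw [TensorProduct.tmul_smul, map_smul, act_one]
      simp
  rw [h1, coact_coassoc, h2, counit_coact]

/-- The functional `p = ∑ f₀·S(f₁)` is coinvariant. By `translate_act` and anticomultiplicativity of
`S`, the left side is `∑ f₀(x S²(f₃)) f₁ S(f₂)`; the factor `f₁ S(f₂)` collapses to a counit. -/
theorem translate_toIntegral (f : Module.Dual k H) (x : H) :
    translate (toIntegral f) x = toIntegral f x • 1 := by
  let S : H →ₗ[k] H := antipode k
  let G : Module.Dual k H →ₗ[k] H ⊗[k] H →ₗ[k] H :=
    LinearMap.mk₂ k (fun g z => translateMul g x (TensorProduct.map S S (TensorProduct.comm k H H z)))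
      (fun g g' z => by simp [translateMul, LinearMap.add_comp, LinearMap.rTensor_add])
      (fun r g z => by simp [translateMul, LinearMap.smul_comp, LinearMap.rTensor_smul])
      (fun g z z' => by simp) (fun r g z => by simp)
  have hG (w : Module.Dual k H ⊗[k] H) : translate (act (LinearMap.lTensor _ S w)) x =
      TensorProduct.lift G (LinearMap.lTensor _ comul w) := by
    induction w with
    | zero => simp
    | add x y hx hy => simp only [map_add, LinearMap.add_apply, hx, hy]
    | tmul g b =>
      rw [LinearMap.lTensor_tmul, translate_act]
      have := LinearMap.congr_fun (comul_comp_antipode (k := k) (H := H)) b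
      simp only [LinearMap.comp_apply, LinearEquiv.coe_coe] at this
      rw [this]
      rfl
  -- `K g (a ⊗ (b ⊗ c)) = g(x S²(c)) a S(b)`; `Γ` below applies it after comultiplying the last
  -- factor.
  let K : Module.Dual k H →ₗ[k] H ⊗[k] (H ⊗[k] H) →ₗ[k] H :=
    LinearMap.mk₂ k (fun g z => LinearMap.mul' k H (LinearMap.lTensor H
        ((TensorProduct.rid k H).toLinearMap ∘ₗ
          TensorProduct.map S (g ∘ₗ LinearMap.mulLeft k x ∘ₗ S ∘ₗ S)) z))
      (fun g g' z => by
        simp [LinearMap.add_comp, TensorProduct.map_add_right, LinearMap.comp_add,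
          LinearMap.lTensor_add])
      (fun r g z => by
        simp [LinearMap.smul_comp, TensorProduct.map_smul_right, LinearMap.comp_smul,
          LinearMap.lTensor_smul])
      (fun g z z' => by simp) (fun r g z => by simp)
  have hK (g : Module.Dual k H) (a b c : H) :
      K g (a ⊗ₜ (b ⊗ₜ c)) = g (x * S (S c)) • (a * S b) := by
    simp [K]
  let Γ : Module.Dual k H ⊗[k] (H ⊗[k] H) →ₗ[k] H :=
    TensorProduct.lift K ∘ₗ LinearMap.lTensor _ (LinearMap.lTensor H comul)
  have h1 (w : Module.Dual k H ⊗[k] H) : TensorProduct.lift G (LinearMap.lTensor _ comul w) =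
      Γ (TensorProduct.assoc k _ H H (LinearMap.rTensor H coact w)) := by
    induction w with
    | zero => simp
    | add x y hx hy => simp only [map_add, hx, hy]
    | tmul g h =>
      have h2 (q : Module.Dual k H ⊗[k] H) (y : H ⊗[k] H) :
          LinearMap.mul' k H (LinearMap.rTensor H (dualTensorHom k H H q ∘ₗ
            LinearMap.mulLeft k x ∘ₗ S) (TensorProduct.map S S (TensorProduct.comm k H H y))) =
          TensorProduct.lift K (LinearMap.lTensor _
            ((TensorProduct.mk k H (H ⊗[k] H)).flip y) q) := by
        induction q with
        | zero => simp
        | add x y hx hy =>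
          simp only [map_add, LinearMap.add_comp, LinearMap.rTensor_add, LinearMap.add_apply,
            hx, hy]
        | tmul g h' =>
          rw [LinearMap.lTensor_tmul, TensorProduct.lift.tmul]
          induction y with
          | zero => simp
          | add x y hx hy =>
            simp only [map_add, LinearMap.add_apply, hx, hy]
          | tmul a b =>
            rw [LinearMap.flip_apply, TensorProduct.mk_apply, hK]
            simp
      have h3 (q : Module.Dual k H ⊗[k] H) : Γ (TensorProduct.assoc k _ H H (q ⊗ₜ h)) =
          TensorProduct.lift K (LinearMap.lTensor _
            ((TensorProduct.mk k H (H ⊗[k] H)).flip (comul h)) q) := by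
        induction q with
        | zero => simp
        | add x y hx hy => simp only [map_add, TensorProduct.add_tmul, hx, hy]
        | tmul g h' => simp [Γ]
      rw [LinearMap.rTensor_tmul, h3, ← h2, dualTensorHom_coact]
      rfl
  have h3 (w : Module.Dual k H ⊗[k] H) : Γ (LinearMap.lTensor _ comul w) =
      act (LinearMap.lTensor _ S w) x • 1 := by
    induction w with
    | zero => simp
    | add x y hx hy => simp only [map_add, LinearMap.add_apply, add_smul, hx, hy]
    | tmul g h =>
      have h4 (z : H ⊗[k] H) : K g (TensorProduct.assoc k H H H (LinearMap.rTensor H comul z)) =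
          g (x * S (S (TensorProduct.lid k H (LinearMap.rTensor H counit z)))) • 1 := by
        induction z with
        | zero => simp
        | add x y hx hy => simp only [map_add, mul_add, add_smul, hx, hy]
        | tmul b c =>
          have h5 (y : H ⊗[k] H) : K g (TensorProduct.assoc k H H H (y ⊗ₜ c)) =
              g (x * S (S c)) • LinearMap.mul' k H (LinearMap.lTensor H S y) := by
            induction y with
            | zero => simp
            | add x y hx hy => simp only [map_add, TensorProduct.add_tmul, smul_add, hx, hy]
            | tmul a b => rw [TensorProduct.assoc_tmul, hK]; simp
          rw [LinearMap.rTensor_tmul, h5, mul_antipode_lTensor_comul_apply]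
          simp [Algebra.algebraMap_eq_smul_one, smul_smul, mul_comm]
      have h6 : Γ (g ⊗ₜ comul h) = K g (LinearMap.lTensor H comul (comul h)) := rfl
      rw [LinearMap.lTensor_tmul, h6, ← coassoc_apply, h4]
      simp [S]
  have h7 : toIntegral f = act (LinearMap.lTensor _ S (coact f)) := rfl
  rw [h7, hG, h1, coact_coassoc, h3]

/-- If `S(h) = 0` then `p·h = 0`. For an integral `p` the compatibility of `translate_act` turns
this into `∑ p·h₁ ⊗ h₂ = 0`. Applying `S(h₂)` on the left leg while keeping `h₃` gives `∑ p·(h₁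
S(h₂)) ⊗ h₃ = p ⊗ h`, which therefore vanishes as well. -/
theorem smul_eq_zero_of_antipode_eq_zero (p : Module.Dual k H)
    (hp : ∀ x, translate p x = p x • 1) {h : H} (hh : antipode k h = 0) (x : H) :
    p x • h = 0 := by
  let q : H →ₗ[k] Module.Dual k H := act ∘ₗ TensorProduct.mk k _ H p
  have h1 : LinearMap.rTensor H q (comul h) = 0 := by
    apply (dualTensorHom_bijective (R := k) (M := H) (N := H)).1
    ext x
    have h2 : act (p ⊗ₜ h) = 0 := by ext; simp [hh]
    have h3 := translate_act p h x
    rw [h2] at h3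
    have h4 (z : H ⊗[k] H) : translateMul p x z =
        dualTensorHom k H H (LinearMap.rTensor H q z) x := by
      induction z with
      | zero => simp
      | add x y hx hy => simp only [map_add, LinearMap.add_apply, hx, hy]
      | tmul a b => simp [translateMul, hp, q]
    rw [← h4, ← h3]
    simp
  let M : H ⊗[k] (H ⊗[k] H) →ₗ[k] H ⊗[k] H :=
    LinearMap.rTensor H (LinearMap.mul' k H) ∘ₗ (TensorProduct.assoc k H H H).symm.toLinearMap ∘ₗ
      LinearMap.lTensor H (LinearMap.rTensor H (antipode k))
  -- `Λ(g ⊗ b) = ∑ g·S(b₁) ⊗ b₂`, while `M(a ⊗ (b ⊗ c)) = a S(b) ⊗ c`; `h2` says that they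
  -- correspond under `h ↦ p·h`.
  let Λ : Module.Dual k H ⊗[k] H →ₗ[k] Module.Dual k H ⊗[k] H :=
    LinearMap.rTensor H act ∘ₗ (TensorProduct.assoc k _ H H).symm.toLinearMap ∘ₗ
      LinearMap.lTensor _ (LinearMap.rTensor H (antipode k) ∘ₗ comul)
  have h2 (z : H ⊗[k] H) : Λ (LinearMap.rTensor H q z) =
      LinearMap.rTensor H q (M (LinearMap.lTensor H comul z)) := by
    induction z with
    | zero => simp
    | add x y hx hy => simp only [map_add, hx, hy]
    | tmul a b =>
      simp only [Λ, LinearMap.rTensor_tmul, LinearMap.lTensor_tmul, LinearMap.comp_apply]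
      generalize comul (R := k) b = y
      induction y with
      | zero => simp
      | add x y hx hy => simp only [map_add, TensorProduct.tmul_add, hx, hy]
      | tmul c d =>
        simp [q, M, act_act]
  have h3 (z : H ⊗[k] H) : M (TensorProduct.assoc k H H H (LinearMap.rTensor H comul z)) =
      1 ⊗ₜ TensorProduct.lid k H (LinearMap.rTensor H counit z) := by
    induction z with
    | zero => simp
    | add x y hx hy => simp only [map_add, TensorProduct.tmul_add, hx, hy]
    | tmul a b =>
      have h4 (y : H ⊗[k] H) : M (TensorProduct.assoc k H H H (y ⊗ₜ b)) =
          LinearMap.mul' k H (LinearMap.lTensor H (antipode k) y) ⊗ₜ b := by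
        induction y with
        | zero => simp
        | add x y hx hy => simp only [map_add, TensorProduct.add_tmul, hx, hy]
        | tmul c d => simp [M]
      rw [LinearMap.rTensor_tmul, h4, mul_antipode_lTensor_comul_apply]
      simp [Algebra.algebraMap_eq_smul_one, TensorProduct.smul_tmul]
  have h4 := h2 (comul h)
  rw [h1, map_zero, ← coassoc_apply, h3] at h4
  have h5 := LinearMap.congr_fun (congrArg (dualTensorHom k H H) h4) x
  simpa [q, act_one] using h5.symm

end DualHopfModule

open DualHopfModule in
-- Values of integrals generate the unit ideal of `k`: write `ε` as a combination of integrals acted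
-- on by `H` and evaluate at `1`, where `ε(1) = 1`. All these values annihilate the kernel of `S`.
theorem antipode_injective [Module.Finite k H] [Module.Projective k H] :
    Function.Injective (antipode k (A := H)) := by
  rw [← LinearMap.ker_eq_bot, LinearMap.ker_eq_bot']
  intro h hh
  have h1 (w : Module.Dual k H ⊗[k] H) : act (LinearMap.rTensor H toIntegral w) 1 • h = 0 := by
    induction w with
    | zero => simp
    | add x y hx hy => simp only [map_add, LinearMap.add_apply, add_smul, hx, hy, add_zero]
    | tmul g b =>
      exact smul_eq_zero_of_antipode_eq_zero _ (translate_toIntegral g) hh _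
  have h2 := h1 (coact (counit (R := k) (A := H)))
  rw [act_toIntegral] at h2
  simpa using h2

/-- After base change to the field `K`, the antipode of `K ⊗ H` is an injective endomorphism of a
finite-dimensional space, hence surjective; so the extension of `φ` vanishes everywhere. -/
theorem eq_zero_of_comp_antipode_eq_zero [Module.Finite k H] [Module.Projective k H]
    {K : Type*} [Field K] [Algebra k K] (φ : H →ₗ[k] K) (hφ : φ ∘ₗ antipode k = 0) : φ = 0 := by
  have hS : Function.Surjective (antipode K (A := K ⊗[k] H)) :=
    LinearMap.injective_iff_surjective.mp antipode_injective
  have h : LinearMap.liftBaseChange K φ = 0 := by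
    ext x
    obtain ⟨y, hy⟩ := hS (1 ⊗ₜ x)
    have h1 (z : K ⊗[k] H) : LinearMap.liftBaseChange K φ (antipode K z) = 0 := by
      induction z with
      | zero => simp
      | add x y hx hy => simp only [map_add, hx, hy, add_zero]
      | tmul a b => simp [show φ (antipode k b) = 0 from LinearMap.congr_fun hφ b]
    have h2 := h1 y
    rw [hy] at h2
    simpa using h2
  ext x
  have h1 := LinearMap.congr_fun h (1 ⊗ₜ x)
  simpa using h1

theorem antipode_bijective [Module.Finite k H] [Module.Projective k H] :
    Function.Bijective (antipode k (A := H)) := by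
  have hsurj : Function.Surjective (antipode k (A := H)) := by
    rw [← LinearMap.range_eq_top]
    by_contra hne
    -- A proper range lies in a maximal submodule `N`, since `H` is finitely generated. The quotient
    -- `H ⧸ N` is a residue field of `k`, so the projection is a functional into a field that kills
    -- the range of `S`; it must vanish, contradicting properness of `N`.
    obtain ⟨N, hN, hle⟩ := (eq_top_or_exists_le_coatom _).resolve_left hne
    have : IsSimpleModule k (H ⧸ N) := isSimpleModule_iff_isCoatom.mpr hN
    obtain ⟨m, hm, ⟨e⟩⟩ := isSimpleModule_iff_quot_maximal.mp this
    let : Field (k ⧸ m) := Ideal.Quotient.field m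
    have h := eq_zero_of_comp_antipode_eq_zero (e.toLinearMap ∘ₗ N.mkQ) (by
      ext x
      have : N.mkQ (antipode k x) = 0 := by simpa using hle (LinearMap.mem_range_self _ x)
      simp [this])
    apply hN.1
    rw [eq_top_iff]
    intro x _
    have h1 := LinearMap.congr_fun h x
    simpa using h1
  exact ⟨antipode_injective, hsurj⟩

end antipodeBijective

/-! ### The Yetter-Drinfel'd case. -/

theorem isSeparableFunctor_forget_iff_exists_isTotalQuantumIntegral {k : Type u} [CommRing k]
    {H : Type v} [Ring H] [HopfAlgebra k H] [Module.Projective k H]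
    (hS : Function.Bijective (HopfAlgebra.antipode k (A := H))) :
    IsSeparableFunctor (YetterDrinfeldModule.forget.{v} hS) ↔
      ∃ γ : H →ₗ[k] GeneralizedDouble hS, IsTotalQuantumIntegral hS γ := by
  rw [YetterDrinfeldModule.forget, DoiHopfModule.isSeparableFunctor_forget_iff]
  simp only [isTotalQuantumIntegral_iff, Koppinen.isTotalIntegral_iff]
  exact ⟨fun ⟨θ, hθ⟩ => ⟨(Koppinen.toHom (ydDatum hS)).symm.toLinearMap ∘ₗ θ, hθ⟩,
    fun ⟨γ, hγ⟩ => ⟨_, hγ⟩⟩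

theorem corollary3p5p2 (k : Type u) [CommRing k] (H : Type v) [Ring H] [HopfAlgebra k H]
    [Module.Projective k H] :
    (∀ hS : Function.Bijective (HopfAlgebra.antipode k (A := H)),
      IsSeparableFunctor (YetterDrinfeldModule.forget.{v} hS) ↔
        ∃ γ : H →ₗ[k] GeneralizedDouble hS, IsTotalQuantumIntegral hS γ) ∧
    (Module.Finite k H →
      ∃ hS : Function.Bijective (HopfAlgebra.antipode k (A := H)),
        Function.Bijective (drinfeldToGeneralized hS) ∧
        List.TFAE [
          IsSeparableFunctor (YetterDrinfeldModule.forget.{v} hS),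
          IsSeparableExtension (toDrinfeldDouble hS),
          ∃ γ : H →ₗ[k] GeneralizedDouble hS, IsTotalQuantumIntegral hS γ]) := by
  refine ⟨fun hS => isSeparableFunctor_forget_iff_exists_isTotalQuantumIntegral hS, fun _ =>
    ⟨antipode_bijective, SmashProduct.toKoppinen_bijective _, ?_⟩⟩
  have h13 := isSeparableFunctor_forget_iff_exists_isTotalQuantumIntegral
    (antipode_bijective (k := k) (H := H))
  have h23 := SmashProduct.isSeparableExtension_inclusion_iff
    (ydDatum (antipode_bijective (k := k) (H := H)))
  simp only [← isTotalQuantumIntegral_iff] at h23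
  tfae_have 1 ↔ 3 := h13
  tfae_have 2 ↔ 3 := h23
  tfae_finish
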